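/- Fix countably infinite lists of concept names $A_i$, role names $R_i$ and individual names $a_i$ ($i<\omega$). $\mathcal{ALC}$-concepts are given by $C ::= A_i \mid \top \mid \neg C \mid C_1\sqcap C_2 \mid \exists R_i.C$; an $\mathcal{ALC}$ TBox is a finite set of inclusions $C\sqsubseteq D$; it is a Horn-$\mathcal{ALC}$ TBox if no concept of the form $\neg C$ occurs in it negatively and no concept of the form $\exists R.\neg C$ occurs in it positively (in $C\sqsubseteq D$, the concept $C$ occurs negatively and $D$ positively; $\neg$ reverses polarity, $\sqcap$ and $\exists R$ preserve it). An ABox is a finite set of assertions $A_k(a_i)$, $R_k(a_i,a_j)$, and $\mathsf{ind}(\mathcal A)$ is the set of individual names in it. Models of a knowledge base $(\mathcal T,\mathcal A)$ are defined as usual, under the standard name assumption. A conjunctive query (CQ) $q(\vec x)=\exists\vec y\,\varphi(\vec x,\vec y)$ has as $\varphi$ a conjunction of atoms $A_k(z)$, $R_k(z,z')$ with variables in $\vec x,\vec y$; it is rooted (an rCQ) if every variable of $\vec y$ is connected to some variable of $\vec x$ in the graph whose nodes are the variables of $q$ and whose edges are the pairs $\{u,v\}$ with $R(u,v)$ in $q$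 for some $R$. We write $(\mathcal T,\mathcal A)\models q(\vec a)$ if $q(\vec a)$ holds in all models of $(\mathcal T,\mathcal A)$. A signature is a set of concept and role names. Let $\mathcal Q$ be CQ or rCQ and $\Theta=(\Sigma_1,\Sigma_2)$ a pair of signatures. A TBox $\mathcal T_1$ $\Theta$-$\mathcal Q$ entails a TBox $\mathcal T_2$ if, for every ABox $\mathcal A$ that uses only names from $\Sigma_1$ and is consistent with both $\mathcal T_1$ and $\mathcal T_2$, every query $q(\vec x)$ in $\mathcal Q$ that uses only names from $\Sigma_2$, and every tuple $\vec a$ in $\mathsf{ind}(\mathcal A)$, $(\mathcal T_2,\mathcal A)\models q(\vec a)$ implies $(\mathcal T_1,\mathcal A)\models q(\vec a)$. They are $\Theta$-$\mathcal Q$ inseparable if they $\Theta$-$\mathcal Q$ entail each other. Theorem. (i) For each $\mathcal Q\in\{\mathrm{CQ},\mathrm{rCQ}\}$, the following problem is undecidable: given a Horn-$\mathcal{ALC}$ TBox $\mathcal T_1$, an $\mathcal{ALC}$ TBox $\mathcal T_2$ and a pair $\Theta=(\Sigma_1,\Sigma_2)$ of finite signatures, decide whether $\mathcal T_1$ $\Theta$-$\mathcal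 Q$ entails $\mathcal T_2$. (ii) For each $\mathcal Q\in\{\mathrm{CQ},\mathrm{rCQ}\}$, the following problem is undecidable: given a Horn-$\mathcal{ALC}$ TBox $\mathcal T_1$, an $\mathcal{ALC}$ TBox $\mathcal T_2$ and a pair $\Theta=(\Sigma_1,\Sigma_2)$ of finite signatures, decide whether $\mathcal T_1$ and $\mathcal T_2$ are $\Theta$-$\mathcal Q$ inseparable. (iii) For $\mathcal Q=\mathrm{CQ}$, both problems remain undecidable when $\Sigma_1$ is fixed to be the full signature of all concept and role names (the input being $\mathcal T_1$, $\mathcal T_2$ and a finite $\Sigma_2$), and also when they are restricted to inputs with $\Sigma_1=\Sigma_2$ (the input being $\mathcal T_1$, $\mathcal T_2$ and a finite signature $\Sigma_1=\Sigma_2$). -/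

import Mathlib

namespace ALC

/-! ### Syntax of the description logic -/

/-- Concept names `A_i`, `i < ω`. -/
abbrev ConceptName := ℕ
/-- Role names `R_i`, `i < ω`. -/
abbrev RoleName := ℕ
/-- Individual names `a_i`, `i < ω`. -/
abbrev IndName := ℕ

/-- Concepts `C ::= A | ⊤ | ¬C | C ⊓ C | ∃R.C`. -/
inductive Concept : Type where
  | atom (A : ConceptName) : Concept
  | top : Concept
  | neg (C : Concept) : Concept
  | inter (C D : Concept) : Concept
  | ex (R : RoleName) (C : Concept) : Concept

/-- A concept inclusion `C ⊑ D`, as the pair `(C, D)`. -/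
abbrev CI := Concept × Concept

/-- A TBox is a finite set of concept inclusions, presented as a list. -/
abbrev TBox := List CI

/-- `Occurs E p C`: the concept `E` occurs in the concept `C`, positively if `p = true` (below an
even number of negations) and negatively if `p = false` (below an odd number of negations). -/
def Occurs (E : Concept) : Bool → Concept → Prop
  | p, .atom A => p = true ∧ E = .atom A
  | p, .top => p = true ∧ E = .top
  | p, .neg C => (p = true ∧ E = .neg C) ∨ Occurs E (!p) C
  | p, .inter C D => (p = true ∧ E = .inter C D) ∨ Occurs E p C ∨ Occurs E p D
  | p, .ex R C => (p = true ∧ E = .ex R C) ∨ Occurs E p C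

/-- Polarity of occurrences in an inclusion `C ⊑ D`: the polarity in `D` is kept, the polarity
in `C` is reversed. -/
def OccursInCI (E : Concept) (p : Bool) (α : CI) : Prop :=
  Occurs E (!p) α.1 ∨ Occurs E p α.2

/-- Horn TBoxes: no concept of the form `¬C` occurs negatively and no `∃R.¬C` occurs
positively. -/
def IsHornTBox (T : TBox) : Prop :=
  ∀ α ∈ T,
    (∀ C : Concept, ¬ OccursInCI (Concept.neg C) false α) ∧
    (∀ (R : RoleName) (C : Concept), ¬ OccursInCI (Concept.ex R (Concept.neg C)) true α)

/-- Atoms `A(v)` and `R(u, v)` over a type of terms. -/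
inductive Atom (V : Type) : Type where
  | concept (A : ConceptName) (v : V) : Atom V
  | role (R : RoleName) (u v : V) : Atom V

/-- The term `w` occurs in an atom. -/
def Atom.Mentions {V : Type} (w : V) : Atom V → Prop
  | .concept _ v => w = v
  | .role _ u v => w = u ∨ w = v

/-- An ABox is a finite set of assertions `A(a)`, `R(a, b)` about individual names, presented as
a list. -/
abbrev ABox := List (Atom IndName)

/-- The set `ind(𝒜)` of the individual names that occur in the ABox. -/
def ABox.inds (A : ABox) : Set IndName := {a | ∃ α ∈ A, α.Mentions a}

/-- A knowledge base. -/
structure KB where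
  tbox : TBox
  abox : ABox

/-- `ind(𝒦) = ind(𝒜)`. -/
def KB.inds (K : KB) : Set IndName := ABox.inds K.abox

/-! ### Semantics -/

/-- Interpretations. Individual names are standard names: distinct names denote distinct elements
of the domain (up to isomorphism, each name denotes itself). -/
structure Interp where
  Dom : Type
  ind : IndName → Dom
  ind_injective : Function.Injective ind
  conceptExt : ConceptName → Set Dom
  roleExt : RoleName → Dom → Dom → Prop

/-- The extension of a concept. -/
def Interp.ext (I : Interp) : Concept → Set I.Dom
  | .atom A => I.conceptExt A
  | .top => Set.univ
  | .neg C => (I.ext C)ᶜ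
  | .inter C D => I.ext C ∩ I.ext D
  | .ex R C => {d | ∃ e, I.roleExt R d e ∧ e ∈ I.ext C}

/-- Truth of an atom under an assignment of domain elements to the terms. -/
def Atom.Holds {V : Type} (I : Interp) (f : V → I.Dom) : Atom V → Prop
  | .concept A v => f v ∈ I.conceptExt A
  | .role R u v => I.roleExt R (f u) (f v)

/-- `I` is a model of the knowledge base `K`. -/
def Interp.IsModel (I : Interp) (K : KB) : Prop :=
  (∀ α ∈ K.tbox, I.ext α.1 ⊆ I.ext α.2) ∧ (∀ α ∈ K.abox, α.Holds I I.ind)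

/-- A knowledge base is consistent if it has a model. -/
def KB.Consistent (K : KB) : Prop := ∃ I : Interp, I.IsModel K

/-! ### Conjunctive queries -/

/-- A conjunctive query `∃ y₁ … y_m φ(x₁, …, x_n, y₁, …, y_m)`: `n = arity` is the number of answer
variables `x_i` (the terms `Sum.inl i`), `m = numEx` the number of quantified variables `y_j`
(the terms `Sum.inr j`), and `φ` is the conjunction of the listed atoms. -/
structure CQ where
  arity : ℕ
  numEx : ℕ
  atoms : List (Atom (Fin arity ⊕ Fin numEx))

/-- `I ⊨ q(a)`. -/
def Interp.Satisfies (I : Interp) (q : CQ) (a : Fin q.arity → IndName) : Prop :=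
  ∃ g : Fin q.numEx → I.Dom, ∀ α ∈ q.atoms, α.Holds I (Sum.elim (fun i => I.ind (a i)) g)

/-- The graph of a query: its nodes are the variables, its edges the pairs `{u, v}` with an atom
`R(u, v)` in the query. -/
def CQ.graph (q : CQ) : SimpleGraph (Fin q.arity ⊕ Fin q.numEx) :=
  SimpleGraph.fromRel fun u v => ∃ R : RoleName, Atom.role R u v ∈ q.atoms

/-- Rooted queries: every quantified variable is connected to some answer variable. -/
def CQ.IsRooted (q : CQ) : Prop :=
  ∀ y : Fin q.numEx, ∃ x : Fin q.arity, q.graph.Reachable (Sum.inr y) (Sum.inl x)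

/-- `K ⊨ q(a)`: the tuple `a` is a certain answer to `q` over `K`. -/
def KB.CertainAnswer (K : KB) (q : CQ) (a : Fin q.arity → IndName) : Prop :=
  ∀ I : Interp, I.IsModel K → I.Satisfies q a

/-- The two query classes: conjunctive queries and rooted conjunctive queries. -/
inductive QueryClass where
  | CQ
  | rCQ

/-- Membership of a conjunctive query in a query class. -/
def QueryClass.Contains : QueryClass → ALC.CQ → Prop
  | .CQ, _ => True
  | .rCQ, q => q.IsRooted

/-! ### Signatures, entailment and inseparability -/

/-- A signature: a set of concept and role names. -/
structure Signature where
  concepts : Set ConceptName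
  roles : Set RoleName

/-- The full signature, of all concept and role names. -/
def Signature.full : Signature := ⟨Set.univ, Set.univ⟩

/-- The concept or role name of an atom belongs to the signature. -/
def Atom.InSignature {V : Type} (S : Signature) : Atom V → Prop
  | .concept A _ => A ∈ S.concepts
  | .role R _ _ => R ∈ S.roles

/-- `K₁` `S`-`Q`-entails `K₂`. -/
def KBEntails (S : Signature) (Q : QueryClass) (K₁ K₂ : KB) : Prop :=
  ∀ q : CQ, Q.Contains q → (∀ α ∈ q.atoms, α.InSignature S) →
    ∀ a : Fin q.arity → IndName, (∀ i, a i ∈ K₂.inds) →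
      K₂.CertainAnswer q a → (∀ i, a i ∈ K₁.inds) ∧ K₁.CertainAnswer q a

/-- `T₁` `(S₁, S₂)`-`Q`-entails `T₂`: for every `S₁`-ABox `A` consistent with both `T₁` and `T₂`,
`(T₁, A)` `S₂`-`Q`-entails `(T₂, A)`. -/
def TBoxEntails (S₁ S₂ : Signature) (Q : QueryClass) (T₁ T₂ : TBox) : Prop :=
  ∀ A : ABox, (∀ α ∈ A, α.InSignature S₁) →
    (KB.mk T₁ A).Consistent → (KB.mk T₂ A).Consistent →
      KBEntails S₂ Q (KB.mk T₁ A) (KB.mk T₂ A)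

/-- `T₁` and `T₂` are `(S₁, S₂)`-`Q`-inseparable. -/
def TBoxInseparable (S₁ S₂ : Signature) (Q : QueryClass) (T₁ T₂ : TBox) : Prop :=
  TBoxEntails S₁ S₂ Q T₁ T₂ ∧ TBoxEntails S₁ S₂ Q T₂ T₁

/-- A finite signature, as it is given to an algorithm: a list of concept names and a list of role
names. -/
abbrev FinSignature := List ConceptName × List RoleName

/-- The signature presented by two lists. -/
def FinSignature.toSignature (S : FinSignature) : Signature :=
  ⟨{A | A ∈ S.1}, {R | R ∈ S.2}⟩

/-! ### Concepts as inputs of algorithms -/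

/-- Gödel numbering of concepts. -/
def Concept.toNat : Concept → ℕ
  | .top => 0
  | .atom A => 4 * A + 1
  | .neg C => 4 * C.toNat + 2
  | .inter C D => 4 * Nat.pair C.toNat D.toNat + 3
  | .ex R C => 4 * Nat.pair R C.toNat + 4

/-- The concept with a given Gödel number. -/
def Concept.ofNat : ℕ → Concept
  | 0 => .top
  | n + 1 =>
    have hm : n / 4 < n + 1 := by omega
    have _h₁ : (n / 4).unpair.1 < n + 1 := lt_of_le_of_lt (n / 4).unpair_left_le hm
    have _h₂ : (n / 4).unpair.2 < n + 1 := lt_of_le_of_lt (n / 4).unpair_right_le hm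
    match n % 4 with
    | 0 => .atom (n / 4)
    | 1 => .neg (Concept.ofNat (n / 4))
    | 2 => .inter (Concept.ofNat (n / 4).unpair.1) (Concept.ofNat (n / 4).unpair.2)
    | _ => .ex (n / 4).unpair.1 (Concept.ofNat (n / 4).unpair.2)
  termination_by n => n
  decreasing_by all_goals assumption

theorem Concept.ofNat_toNat (C : Concept) : Concept.ofNat C.toNat = C := by
  induction C with
  | top => simp [Concept.toNat, Concept.ofNat]
  | atom A =>
    simp [Concept.toNat, Concept.ofNat]
  | neg C ih =>
    have h₁ : (4 * C.toNat + 1) / 4 = C.toNat := by omega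
    have h₂ : (4 * C.toNat + 1) % 4 = 1 := by omega
    simp [Concept.toNat, Concept.ofNat, h₁, h₂, ih]
  | inter C D ihC ihD =>
    have h₁ : (4 * Nat.pair C.toNat D.toNat + 2) / 4 = Nat.pair C.toNat D.toNat := by omega
    have h₂ : (4 * Nat.pair C.toNat D.toNat + 2) % 4 = 2 := by omega
    simp [Concept.toNat, Concept.ofNat, h₁, h₂, ihC, ihD]
  | ex R C ih =>
    have h₁ : (4 * Nat.pair R C.toNat + 3) / 4 = Nat.pair R C.toNat := by omega
    have h₂ : (4 * Nat.pair R C.toNat + 3) % 4 = 3 := by omega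
    simp [Concept.toNat, Concept.ofNat, h₁, h₂, ih]

theorem Concept.toNat_ofNat (n : ℕ) : (Concept.ofNat n).toNat = n := by
  induction n using Nat.strong_induction_on with
  | _ n ih =>
    cases n with
    | zero => simp [Concept.ofNat, Concept.toNat]
    | succ n =>
      have hm : n / 4 < n + 1 := by omega
      have h₁ := ih _ hm
      have h₂ := ih _ (lt_of_le_of_lt (n / 4).unpair_left_le hm)
      have h₃ := ih _ (lt_of_le_of_lt (n / 4).unpair_right_le hm)
      have h : n % 4 = 0 ∨ n % 4 = 1 ∨ n % 4 = 2 ∨ n % 4 = 3 := by omega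
      rcases h with h | h | h | h <;>
        simp [Concept.ofNat, h, Concept.toNat, h₁, h₂, h₃, Nat.pair_unpair] <;> omega

/-- The Gödel numbering is a bijection. -/
def Concept.equivNat : Concept ≃ ℕ where
  toFun := Concept.toNat
  invFun := Concept.ofNat
  left_inv := Concept.ofNat_toNat
  right_inv := Concept.toNat_ofNat

instance : Primcodable Concept := Primcodable.ofEquiv ℕ Concept.equivNat

/-- The decision problem `P`, restricted to the inputs with `dom`, is undecidable: no decidable
predicate agrees with `P` on all these inputs. -/
def UndecidableOn {α : Type} [Primcodable α] (dom P : α → Prop) : Prop :=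
  ¬ ∃ D : α → Prop, ComputablePred D ∧ ∀ x, dom x → (D x ↔ P x)

end ALC

/-!
The halting problem of counter machines is reduced to the complement of entailment, in two steps.

*Helices.* A run of a counter machine is written as a word: a row of cells for each configuration,
where each cell holds a token of a register or nothing. Winding the word up into rows of a fixed
length, each cell finds its successor one row later, so that the word represents a halting run
exactly if it satisfies a horizontal constraint on neighbouring letters and a vertical constraint
between a letter and the letter one row later (`Counter.halts_of_helix`,
`Counter.helix_of_halts`). The length of a row is not known in advance; it is only required to be
odd. A machine with an undecidable halting problem is compiled from a nondeterministic counter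
program that searches for a zero of a primitive recursive function
(`Counter.exists_machine_undecidable`, `exists_helixSystem_undecidable`).

*The TBoxes.* Below each element with the name `root`, the `ALC` TBox generates the tree of all
words that satisfy the horizontal constraint. A node with letter `c` has the label `c`, and all
labels `b` that are vertically compatible with `c`; the labels of the two kinds are told apart by
the parity of the depth, since rows have odd length. At a letter `halt` there is a disjunction:
either the label `halt` is present, or the words continue. If there is a helix, consider the query
for a path with the labels of the word up to `halt`. It is satisfied in each model: if the label
`halt` is present at the end of this word, the query is mapped to the word itself, and otherwise
the word has a continuation, and the query is mapped to the helix, shifted by one row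
(`ALC.exists_labelled_path`). Both TBoxes also generate the template, a finite graph in which all
paths of labels are present except those that spell a word from `init` to `halt`; the template
does not satisfy the query (`ALC.not_satisfies_pathQuery`).

Conversely, assume that there is no helix, and that a tuple is a certain answer over the `ALC`
TBox. A model `J` of the Horn TBox is extended by trees of words to a model of the `ALC` TBox
(`ALC.isModel_treeInterp`), where the words that continue after `halt` can be chosen freely. If
the words read off the query along its paths include one that ends in `halt`, then the
homomorphism to the model in which exactly this word continues after `halt` exhibits a helix
(`ALC.HomSystem.not_reads_halt`). Hence no reading is completed, and the part of the query that is
mapped to the trees can be mapped to the template (`ALC.HomSystem.Mappable.map_role`).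

For CQs, the role that leads to the trees does not belong to the query signature, and the
components of the query are treated one by one (`ALC.certainAnswer_of_not_helix`). For rooted CQs,
the ABoxes contain no labels, and the template in `J` is unravelled
(`ALC.certainAnswer_of_not_helix_of_rootSig`). As the `ALC` TBox always entails the Horn TBox
(`ALC.alcTBox_entails_hornTBox`), entailment and inseparability coincide.
-/

namespace Counter

/-! ### Nondeterministic counter programs -/

open Function

/-- Actions of a counter machine with registers `0, 1, 2, …`. -/
inductive Act : Type where
  | nop : Act
  | inc (r : ℕ) : Act
  | dec (r : ℕ) : Act
  | zero (r : ℕ) : Act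

/-- The effect of an action on the registers; `dec r` blocks at `0`, and `zero r` blocks unless
register `r` is `0`. -/
def Act.Exec : Act → (ℕ → ℕ) → (ℕ → ℕ) → Prop
  | .nop, s, t => t = s
  | .inc r, s, t => t = update s r (s r + 1)
  | .dec r, s, t => 0 < s r ∧ t = update s r (s r - 1)
  | .zero r, s, t => s r = 0 ∧ t = s

/-- Nondeterministic counter programs: regular expressions over the actions. -/
inductive Prog : Type where
  | act (a : Act) : Prog
  | seq (p q : Prog) : Prog
  | star (p : Prog) : Prog

/-- The input-output relation of a program. -/
def Prog.Rel : Prog → (ℕ → ℕ) → (ℕ → ℕ) → Prop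
  | .act a => a.Exec
  | .seq p q => Relation.Comp p.Rel q.Rel
  | .star p => Relation.ReflTransGen p.Rel

/-- On the states satisfying `Inv`, the program `p` computes the total function `F`. -/
def Computes (p : Prog) (Inv : (ℕ → ℕ) → Prop) (F : (ℕ → ℕ) → (ℕ → ℕ)) : Prop :=
  ∀ s, Inv s → ∀ t, p.Rel s t ↔ t = F s

theorem computes_inc (r : ℕ) (Inv) :
    Computes (.act (.inc r)) Inv (fun s => update s r (s r + 1)) := fun _ _ _ => Iff.rfl

theorem Computes.seq {p q : Prog} {I J : (ℕ → ℕ) → Prop} {F G : (ℕ → ℕ) → (ℕ → ℕ)}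
    (hp : Computes p I F) (hq : Computes q J G) (h : ∀ s, I s → J (F s)) :
    Computes (p.seq q) I (fun s => G (F s)) := by
  intro s hs t
  simp only [Prog.Rel, Relation.Comp]
  constructor
  · rintro ⟨m, h₁, h₂⟩
    rw [hp s hs] at h₁
    subst h₁
    exact (hq _ (h s hs) t).1 h₂
  · intro ht
    exact ⟨F s, (hp s hs _).2 rfl, (hq _ (h s hs) t).2 ht⟩

theorem Computes.congr {p : Prog} {I J : (ℕ → ℕ) → Prop} {F G : (ℕ → ℕ) → (ℕ → ℕ)}
    (hp : Computes p I F) (h : ∀ s, J s → I s) (hFG : ∀ s, J s → F s = G s) :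
    Computes p J G := by
  intro s hs t
  rw [hp s (h s hs) t, hFG s hs]

/-- `while r_c ≠ 0 do (dec r_c; b)`. -/
def whileDec (c : ℕ) (b : Prog) : Prog :=
  .seq (.star (.seq (.act (.dec c)) b)) (.act (.zero c))

/-- A loop computes `G` if `G` is invariant under one round and is the identity at its end. -/
theorem computes_whileDec {c : ℕ} {b : Prog} {I J : (ℕ → ℕ) → Prop}
    {F G : (ℕ → ℕ) → (ℕ → ℕ)} (hb : Computes b J F)
    (hIJ : ∀ s, I s → 0 < s c → J (update s c (s c - 1)))
    (hI : ∀ s, I s → 0 < s c → I (F (update s c (s c - 1))))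
    (hc : ∀ s, J s → F s c = s c)
    (hG₀ : ∀ s, I s → s c = 0 → G s = s)
    (hG : ∀ s, I s → 0 < s c → G (F (update s c (s c - 1))) = G s) :
    Computes (whileDec c b) I G := by
  have body : ∀ s, I s → ∀ t, (Prog.seq (.act (.dec c)) b).Rel s t ↔
      0 < s c ∧ t = F (update s c (s c - 1)) := by
    intro s hs t
    simp only [Prog.Rel, Relation.Comp, Act.Exec]
    constructor
    · rintro ⟨m, ⟨h₀, rfl⟩, h₂⟩
      exact ⟨h₀, (hb _ (hIJ s hs h₀) t).1 h₂⟩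
    · rintro ⟨h₀, ht⟩
      exact ⟨_, ⟨h₀, rfl⟩, (hb _ (hIJ s hs h₀) t).2 ht⟩
  intro s hs t
  simp only [whileDec]
  rw [Prog.Rel, Prog.Rel]
  constructor
  · rintro ⟨m, h₁, h₂, rfl⟩
    induction h₁ using Relation.ReflTransGen.head_induction_on with
    | refl => exact (hG₀ _ hs h₂).symm
    | head h _ ih =>
      obtain ⟨h₀, rfl⟩ := (body _ hs _).1 h
      rw [ih (hI _ hs h₀), hG _ hs h₀]
  · rintro rfl
    induction hk : s c generalizing s with
    | zero =>
      rw [hG₀ s hs hk]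
      exact ⟨s, .refl, hk, rfl⟩
    | succ k ih =>
      have h₀ : 0 < s c := by omega
      obtain ⟨m, h₁, h₂⟩ := ih _ (hI s hs h₀) (by
        rw [hc _ (hIJ s hs h₀)]; simp [hk])
      rw [hG s hs h₀] at h₂
      exact ⟨m, .head ((body s hs _).2 ⟨h₀, rfl⟩) h₁, h₂⟩

/-- Set register `c` to `0`. -/
def clear (c : ℕ) : Prog := whileDec c (.act .nop)

theorem computes_clear (c : ℕ) : Computes (clear c) (fun _ => True) (fun s => update s c 0) := by
  refine computes_whileDec (J := fun _ => True) (F := id) (fun s _ t => Iff.rfl) ?_ ?_ ?_ ?_ ?_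
  · intros; trivial
  · intros; trivial
  · intros; rfl
  · intro s _ h; rw [← h]; simp
  · intro s _ h; simp

/-- Add register `a` to register `b`, and set `a` to `0`. -/
def move (a b : ℕ) : Prog := whileDec a (.act (.inc b))

theorem computes_move {a b : ℕ} (hab : a ≠ b) :
    Computes (move a b) (fun _ => True) (fun s => update (update s b (s b + s a)) a 0) := by
  refine computes_whileDec (J := fun _ => True) (computes_inc b _) ?_ ?_ ?_ ?_ ?_
  · intros; trivial
  · intros; trivial
  · intro s _; simp [hab]
  · intro s _ h
    funext r
    by_cases h₁ : r = a
    · subst h₁; simp [h]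
    · by_cases h₂ : r = b
      · subst h₂; simp [h₁, h]
      · simp [h₁, h₂]
  · intro s _ h
    funext r
    by_cases h₁ : r = a
    · subst h₁; simp
    · by_cases h₂ : r = b
      · subst h₂; simp [h₁, hab]; omega
      · simp [h₁, h₂]

/-- Add register `a` to register `b`; register `c` is auxiliary. -/
def copy (a b c : ℕ) : Prog :=
  .seq (whileDec a (.seq (.act (.inc b)) (.act (.inc c)))) (move c a)

theorem computes_copy {a b c : ℕ} (hab : a ≠ b) (hac : a ≠ c) (hbc : b ≠ c) :
    Computes (copy a b c) (fun s => s c = 0) (fun s => update s b (s b + s a)) := by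
  have h₁ : Computes (whileDec a (.seq (.act (.inc b)) (.act (.inc c)))) (fun _ => True)
      (fun s => update (update (update s b (s b + s a)) c (s c + s a)) a 0) := by
    refine computes_whileDec (J := fun _ => True)
      ((computes_inc b (fun _ => True)).seq (computes_inc c (fun _ => True)) ?_) ?_ ?_ ?_ ?_ ?_
    · intros; trivial
    · intros; trivial
    · intros; trivial
    · intro s _; simp [hab, hac]
    · intro s _ h
      funext r
      by_cases h₁ : r = a
      · subst h₁; simp [h]
      · by_cases h₂ : r = b
        · subst h₂; simp [h₁, h]
        · by_cases h₃ : r = c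
          · subst h₃; simp [h₁, h]
          · simp [h₁, h₂, h₃]
    · intro s _ h
      funext r
      by_cases h₁ : r = a
      · subst h₁; simp
      · by_cases h₂ : r = b
        · subst h₂; simp [h₁, hbc, hab, hac]; omega
        · by_cases h₃ : r = c
          · subst h₃; simp [h₁, h₂, hac, hab]; omega
          · simp [h₁, h₂, h₃]
  refine (h₁.seq (computes_move hac.symm) (fun _ _ => trivial)).congr (fun _ _ => trivial) ?_
  intro s hs
  funext r
  by_cases h₂ : r = a
  · subst h₂; simp [hac, hac.symm, hab, hs]
  · by_cases h₃ : r = b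
    · subst h₃; simp [h₂, hbc, hac.symm]
    · by_cases h₄ : r = c
      · subst h₄; simp [h₃, hs]
      · simp [h₂, h₃, h₄]

/-! ### Primitive recursive functions are computed by counter programs -/

/-- `f` is computable by counter programs: whatever the input registers `ρ`, the output register
`o` and the bound `K` above which all registers are free (and hold `0`). -/
def Computable {n : ℕ} (f : List.Vector ℕ n → ℕ) : Prop :=
  ∀ (ρ : Fin n → ℕ) (o K : ℕ), (∀ i, ρ i < K) → o < K → (∀ i, ρ i ≠ o) →
    ∃ p, Computes p (fun s => (∀ r, K ≤ r → s r = 0) ∧ s o = 0)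
      (fun s => update s o (f (List.Vector.ofFn fun i => s (ρ i))))

theorem Computable.zero : Computable (n := 0) (fun _ => 0) := by
  intro ρ o K _ _ _
  refine ⟨.act .nop, fun s hs t => ?_⟩
  change t = s ↔ t = update s o 0
  rw [← hs.2, update_eq_self]

theorem Computable.get {n : ℕ} (i : Fin n) : Computable (fun v => v.get i) := by
  intro ρ o K hρ ho hne
  refine ⟨copy (ρ i) o K, (computes_copy (hne i) (hρ i).ne ho.ne).congr
    (fun s hs => hs.1 K le_rfl) fun s hs => ?_⟩
  simp [hs.2]

theorem Computable.succ : Computable (n := 1) (fun v => v.head.succ) := by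
  intro ρ o K hρ ho hne
  refine ⟨.seq (copy (ρ 0) o K) (.act (.inc o)),
    ((computes_copy (hne 0) (hρ 0).ne ho.ne).seq (computes_inc o (fun _ => True))
      (fun _ _ => trivial)).congr (fun s hs => hs.1 K le_rfl) fun s hs => ?_⟩
  simp [hs.2, List.Vector.ofFn]

theorem Computable.comp {m n : ℕ} {f : List.Vector ℕ n → ℕ} {g : Fin n → List.Vector ℕ m → ℕ}
    (hf : Computable f) (hg : ∀ i, Computable (g i)) :
    Computable (fun a => f (List.Vector.ofFn fun i => g i a)) := by
  intro ρ o K hρ ho hne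
  -- the values of the `g i` are computed into the registers `K + i`
  have args : ∀ j ≤ n, ∃ p, Computes p (fun s => ∀ r, K ≤ r → s r = 0)
      (fun s r => if h : K ≤ r ∧ r < K + j ∧ r - K < n then
        g ⟨r - K, h.2.2⟩ (List.Vector.ofFn fun i => s (ρ i)) else s r) := by
    intro j hj
    induction j with
    | zero =>
      refine ⟨.act .nop, fun s _ t => ?_⟩
      have : ∀ r, ¬ (K ≤ r ∧ r < K + 0 ∧ r - K < n) := fun r h => by omega
      simp only [this, dite_false]
      exact Iff.rfl
    | succ j ih =>
      obtain ⟨p, hp⟩ := ih (by omega)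
      obtain ⟨q, hq⟩ := hg ⟨j, by omega⟩ ρ (K + j) (K + n) (fun i => by have := hρ i; omega)
        (by omega) (fun i => by have := hρ i; omega)
      refine ⟨p.seq q, (hp.seq hq ?_).congr (fun _ h => h) ?_⟩
      · intro s hs
        refine ⟨fun r hr => ?_, ?_⟩
        · exact (dif_neg (by omega)).trans (hs r (by omega))
        · exact (dif_neg (by omega)).trans (hs _ (by omega))
      · intro s hs
        have hin : ∀ i, (if h : K ≤ ρ i ∧ ρ i < K + j ∧ ρ i - K < n then
            g ⟨ρ i - K, h.2.2⟩ (List.Vector.ofFn fun i => s (ρ i)) else s (ρ i)) = s (ρ i) :=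
          fun i => dif_neg (by have := hρ i; omega)
        simp only [hin]
        funext r
        by_cases hr : r = K + j
        · subst hr
          rw [update_self, dif_pos (by omega)]
          simp
        · rw [update_of_ne hr]
          by_cases h : K ≤ r ∧ r < K + j ∧ r - K < n
          · rw [dif_pos h, dif_pos (by omega)]
          · rw [dif_neg h, dif_neg (by omega)]
  have clean : ∀ j, ∃ p, Computes p (fun _ => True)
      (fun s r => if K ≤ r ∧ r < K + j then 0 else s r) := by
    intro j
    induction j with
    | zero =>
      refine ⟨.act .nop, fun s _ t => ?_⟩
      have : ∀ r, ¬ (K ≤ r ∧ r < K + 0) := fun r h => by omega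
      simp only [this, if_false]
      exact Iff.rfl
    | succ j ih =>
      obtain ⟨p, hp⟩ := ih
      refine ⟨p.seq (clear (K + j)), (hp.seq (computes_clear (K + j)) fun _ _ => trivial).congr
        (fun _ h => h) fun s _ => ?_⟩
      funext r
      by_cases hr : r = K + j
      · subst hr; simp
      · rw [update_of_ne hr]
        by_cases h : K ≤ r ∧ r < K + j
        · rw [if_pos h, if_pos (by omega)]
        · rw [if_neg h, if_neg (by omega)]
  obtain ⟨p, hp⟩ := args n le_rfl
  obtain ⟨q, hq⟩ := hf (fun i => K + i) o (K + n) (fun i => by omega) (by omega)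
    (fun i => by omega)
  obtain ⟨c, hc⟩ := clean n
  refine ⟨(p.seq q).seq c, (((hp.congr (J := fun s => (∀ r, K ≤ r → s r = 0) ∧ s o = 0)
    (fun _ h => h.1) (fun _ _ => rfl)).seq hq ?_).seq hc fun _ _ => trivial).congr
      (fun _ h => h) ?_⟩
  · intro s hs
    exact ⟨fun r hr => (dif_neg (by omega)).trans (hs.1 r (by omega)),
      (dif_neg (by omega)).trans hs.2⟩
  · intro s hs
    have hval : ∀ i : Fin n, (if h : K ≤ K + (i : ℕ) ∧ K + (i : ℕ) < K + n ∧ K + (i : ℕ) - K < n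
        then g ⟨K + (i : ℕ) - K, h.2.2⟩ (List.Vector.ofFn fun i => s (ρ i)) else s (K + (i : ℕ)))
        = g i (List.Vector.ofFn fun i => s (ρ i)) := by
      intro i
      rw [dif_pos (by omega)]
      simp
    simp only [hval]
    funext r
    by_cases hr : r = o
    · subst hr
      rw [if_neg (by omega)]
      simp
    · rw [update_of_ne hr, update_of_ne hr]
      by_cases h : K ≤ r ∧ r < K + n
      · rw [if_pos h, hs.1 r h.1]
      · rw [if_neg h, dif_neg (by omega)]

theorem rec_shift (h : ℕ → ℕ → ℕ) (y a k : ℕ) :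
    (Nat.rec (h y a) (fun i IH => h (y + 1 + i) IH) k : ℕ) =
      Nat.rec a (fun i IH => h (y + i) IH) (k + 1) := by
  induction k with
  | zero => rfl
  | succ k ih =>
    change h (y + 1 + k) _ = h (y + (k + 1)) _
    rw [ih, Nat.add_assoc, Nat.add_comm 1 k]

theorem Computable.prec {n : ℕ} {f : List.Vector ℕ n → ℕ} {g : List.Vector ℕ (n + 2) → ℕ}
    (hf : Computable f) (hg : Computable g) :
    Computable (fun v : List.Vector ℕ (n + 1) =>
      v.head.rec (f v.tail) fun y IH => g (y ::ᵥ IH ::ᵥ v.tail)) := by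
  intro ρ o K hρ ho hne
  -- register `K` counts down, `K + 1` counts up, `o` accumulates, `K + 2` holds the next value
  obtain ⟨p, hp⟩ := hf (fun i => ρ i.succ) o (K + 1) (fun i => (hρ _).trans (by omega))
    (by omega) (fun i => hne _)
  obtain ⟨q, hq⟩ := hg (Fin.cons (K + 1) (Fin.cons o fun i => ρ i.succ)) (K + 2) (K + 3)
    (by
      intro i
      refine Fin.cases ?_ (fun i => Fin.cases ?_ (fun i => ?_) i) i
      · simp
      · simp; omega
      · simp only [Fin.cons_succ]; have := hρ i.succ; omega)
    (by omega)
    (by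
      intro i
      refine Fin.cases ?_ (fun i => Fin.cases ?_ (fun i => ?_) i) i
      · simp
      · simp; omega
      · simp only [Fin.cons_succ]; have := hρ i.succ; omega)
  have hin : ∀ s : ℕ → ℕ, (List.Vector.ofFn fun i =>
      s ((Fin.cons (K + 1) (Fin.cons o fun i => ρ i.succ) : Fin (n + 2) → ℕ) i)) =
      s (K + 1) ::ᵥ s o ::ᵥ List.Vector.ofFn fun i => s (ρ i.succ) := fun s => rfl
  have hbody : Computes (((q.seq (clear o)).seq (move (K + 2) o)).seq (.act (.inc (K + 1))))
      (fun s => ∀ r, K + 2 ≤ r → s r = 0)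
      (fun s => update (update s o
        (g (s (K + 1) ::ᵥ s o ::ᵥ List.Vector.ofFn fun i => s (ρ i.succ)))) (K + 1)
          (s (K + 1) + 1)) := by
    refine ((((hq.seq (computes_clear o) fun _ _ => trivial).seq
      (computes_move (a := K + 2) (b := o) (by omega)) fun _ _ => trivial).seq
      (computes_inc (K + 1) fun _ => True) fun _ _ => trivial)).congr
      (fun s hs => ⟨fun r hr => hs r (by omega), hs _ le_rfl⟩) fun s hs => ?_
    rw [hin]
    have h2 := hs (K + 2) le_rfl
    have e₁ : o ≠ K + 1 := by omega
    have e₂ : o ≠ K + 2 := by omega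
    funext r
    by_cases h₁ : r = K + 1
    · subst h₁; simp [e₁.symm]
    · by_cases h₃ : r = o
      · subst h₃; simp [h₁, e₂, e₂.symm]
      · by_cases h₄ : r = K + 2
        · subst h₄; simp [e₂.symm, h2]
        · simp [h₁, h₃, h₄]
  have hloop : Computes (whileDec K (((q.seq (clear o)).seq (move (K + 2) o)).seq
      (.act (.inc (K + 1))))) (fun s => ∀ r, K + 2 ≤ r → s r = 0)
      (fun s => update (update (update s o (Nat.rec (s o) (fun i IH =>
        g ((s (K + 1) + i) ::ᵥ IH ::ᵥ List.Vector.ofFn fun i => s (ρ i.succ))) (s K)))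
          (K + 1) (s (K + 1) + s K)) K 0) := by
    have e₀ : o ≠ K := by omega
    have e₁ : o ≠ K + 1 := by omega
    have e₃ : ∀ i, ρ i ≠ K := fun i => (hρ i).ne
    have e₄ : ∀ i, ρ i ≠ K + 1 := fun i => by have := hρ i; omega
    refine computes_whileDec hbody ?_ ?_ ?_ ?_ ?_
    · intro s hs _ r hr
      rw [update_of_ne (by omega)]; exact hs r hr
    · intro s hs _ r hr
      rw [update_of_ne (by omega), update_of_ne (by omega), update_of_ne (by omega)]
      exact hs r hr
    · intro s _
      rw [update_of_ne (by omega), update_of_ne (by omega)]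
    · intro s _ h
      funext r
      by_cases h₁ : r = K
      · subst h₁; simp [h]
      · by_cases h₂ : r = K + 1
        · subst h₂; simp [h]
        · by_cases h₃ : r = o
          · subst h₃; simp [h, h₁]
          · simp [h₁, h₂, h₃]
    · intro s _ h
      funext r
      obtain ⟨k, hk⟩ : ∃ k, s K = k + 1 := ⟨s K - 1, by omega⟩
      by_cases h₁ : r = K
      · subst h₁; simp
      · by_cases h₂ : r = K + 1
        · subst h₂; simp [hk, e₀.symm]; omega
        · by_cases h₃ : r = o
          · subst h₃
            have := rec_shift (fun y IH => g (y ::ᵥ IH ::ᵥ List.Vector.ofFn fun i =>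
              s (ρ i.succ))) (s (K + 1)) (s r) k
            simp [hk, h₁, h₂, e₃, e₄, e₀.symm, hne] at this ⊢
            exact this
          · simp [h₁, h₂, h₃]
  refine ⟨(((copy (ρ 0) K (K + 1)).seq p).seq (whileDec K _)).seq (clear (K + 1)),
    (((((computes_copy (a := ρ 0) (b := K) (c := K + 1) (hρ 0).ne
      (by have := hρ 0; omega) (by omega)).congr
      (J := fun s => (∀ r, K ≤ r → s r = 0) ∧ s o = 0) (fun s hs => hs.1 _ (by omega))
        fun _ _ => rfl).seq hp ?_).seq hloop ?_).seq
          (computes_clear (K + 1)) fun _ _ => trivial).congr (fun _ h => h) ?_⟩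
  · intro s hs
    refine ⟨fun r hr => ?_, ?_⟩
    · rw [update_of_ne (by omega)]; exact hs.1 r (by omega)
    · rw [update_of_ne (by omega)]; exact hs.2
  · intro s hs r hr
    rw [update_of_ne (by omega), update_of_ne (by omega)]; exact hs.1 r (by omega)
  · intro s hs
    have e₀ : o ≠ K := by omega
    have e₁ : o ≠ K + 1 := by omega
    have e₃ : ∀ i, ρ i ≠ K := fun i => (hρ i).ne
    have hK := hs.1 K le_rfl
    have hK1 := hs.1 (K + 1) (by omega)
    funext r
    by_cases h₂ : r = K + 1
    · subst h₂; simp [hK1, e₁.symm]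
    · by_cases h₁ : r = K
      · subst h₁; simp [hK, e₀.symm]
      · by_cases h₃ : r = o
        · subst h₃
          simp [h₁, h₂, e₃, hne, hK, hK1, e₀.symm, e₁.symm, List.Vector.ofFn]
        · simp [h₁, h₂, h₃]

theorem computable_of_primrec' {n : ℕ} {f : List.Vector ℕ n → ℕ} (hf : Nat.Primrec' f) :
    Computable f := by
  induction hf with
  | zero => exact Computable.zero
  | succ => exact Computable.succ
  | get i => exact Computable.get i
  | comp g _ _ hf hg => exact hf.comp hg
  | prec _ _ hf hg => exact hf.prec hg

end Counter

namespace Counter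

open Function

/-! ### Counter machines with finite control -/

/-- A counter machine with control states `Q`: a state determines an action and the possible
next states. -/
structure Machine (Q : Type) where
  act : Q → Act
  next : Q → Q → Prop
  start : Q
  final : Q

/-- From control state `q` and registers `s`, some run of at least one step reaches the final
control state. -/
inductive Machine.Halts {Q : Type} (M : Machine Q) : Q → (ℕ → ℕ) → Prop
  | last {q s t} : (M.act q).Exec s t → M.next q M.final → M.Halts q s
  | step {q q' s t} : (M.act q).Exec s t → M.next q q' → M.Halts q' t → M.Halts q s

/-- All registers of the action are smaller than `B`. -/
def Act.Below (B : ℕ) : Act → Prop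
  | .nop => True
  | .inc r => r < B
  | .dec r => r < B
  | .zero r => r < B

/-- All registers of the program are smaller than `B`. -/
def Prog.Below (B : ℕ) : Prog → Prop
  | .act a => a.Below B
  | .seq p q => p.Below B ∧ q.Below B
  | .star p => p.Below B

theorem Act.Below.mono {B C : ℕ} (h : B ≤ C) : ∀ {a : Act}, a.Below B → a.Below C
  | .nop, _ => trivial
  | .inc _, ha => lt_of_lt_of_le ha h
  | .dec _, ha => lt_of_lt_of_le ha h
  | .zero _, ha => lt_of_lt_of_le ha h

theorem Prog.Below.mono {B C : ℕ} (h : B ≤ C) : ∀ {p : Prog}, p.Below B → p.Below C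
  | .act _, hp => Act.Below.mono h hp
  | .seq _ _, hp => ⟨hp.1.mono h, hp.2.mono h⟩
  | .star p, hp => Prog.Below.mono (p := p) h hp

theorem Prog.exists_below (p : Prog) : ∃ B, p.Below B := by
  induction p with
  | act a =>
    cases a with
    | nop => exact ⟨0, trivial⟩
    | inc r => exact ⟨r + 1, r.lt_succ_self⟩
    | dec r => exact ⟨r + 1, r.lt_succ_self⟩
    | zero r => exact ⟨r + 1, r.lt_succ_self⟩
  | seq p q hp hq =>
    obtain ⟨B, hB⟩ := hp
    obtain ⟨C, hC⟩ := hq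
    exact ⟨max B C, hB.mono (le_max_left _ _), hC.mono (le_max_right _ _)⟩
  | star p hp => exact hp

/-- One step of the control of a program; a control state is the list of the programs that remain
to be executed. -/
inductive CStep : List Prog → List Prog → Prop
  | act (a k) : CStep (.act a :: k) k
  | seq (p q k) : CStep (.seq p q :: k) (p :: q :: k)
  | done (p k) : CStep (.star p :: k) k
  | again (p k) : CStep (.star p :: k) (p :: .star p :: k)

/-- The action performed in a control state. -/
def ctrlAct : List Prog → Act
  | .act a :: _ => a
  | _ => .nop

/-- The control states reachable from `p :: k` before `k` is reached. -/
def reach : Prog → List Prog → Set (List Prog)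
  | .act a, k => {.act a :: k}
  | .seq p q, k => {.seq p q :: k} ∪ (reach p (q :: k) ∪ reach q k)
  | .star p, k => {.star p :: k} ∪ reach p (.star p :: k)

theorem mem_reach (p : Prog) (k : List Prog) : p :: k ∈ reach p k := by
  cases p <;> simp [reach]

theorem finite_reach (p : Prog) : ∀ k, (reach p k).Finite := by
  induction p with
  | act a => intro k; exact Set.finite_singleton _
  | seq p q hp hq => intro k; exact (Set.finite_singleton _).union ((hp _).union (hq _))
  | star p hp => intro k; exact (Set.finite_singleton _).union (hp _)

theorem reach_closed (p : Prog) :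
    ∀ k x y, x ∈ reach p k → CStep x y → y ∈ reach p k ∨ y = k := by
  induction p with
  | act a =>
    rintro k x y rfl h
    cases h
    exact .inr rfl
  | seq p q hp hq =>
    rintro k x y (rfl | hx | hx) h
    · cases h
      exact .inl (.inr (.inl (mem_reach _ _)))
    · rcases hp _ _ _ hx h with h | rfl
      · exact .inl (.inr (.inl h))
      · exact .inl (.inr (.inr (mem_reach _ _)))
    · rcases hq _ _ _ hx h with h | rfl
      · exact .inl (.inr (.inr h))
      · exact .inr rfl
  | star p hp =>
    rintro k x y (rfl | hx) h
    · cases h with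
      | done => exact .inr rfl
      | again => exact .inl (.inr (mem_reach _ _))
    · rcases hp _ _ _ hx h with h | rfl
      · exact .inl (.inr h)
      · exact .inl (.inl rfl)

theorem below_of_mem_reach {B : ℕ} (p : Prog) : p.Below B → ∀ k, (∀ q ∈ k, q.Below B) →
    ∀ x ∈ reach p k, ∀ q ∈ x, q.Below B := by
  induction p with
  | act a =>
    rintro hp k hk x rfl q hq
    rcases List.mem_cons.1 hq with rfl | hq
    · exact hp
    · exact hk q hq
  | seq p q hp hq =>
    rintro h k hk x (rfl | hx | hx) r hr
    · rcases List.mem_cons.1 hr with rfl | hr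
      · exact h
      · exact hk r hr
    · refine hp h.1 _ ?_ x hx r hr
      intro r hr
      rcases List.mem_cons.1 hr with rfl | hr
      · exact h.2
      · exact hk r hr
    · exact hq h.2 k hk x hx r hr
  | star p hp =>
    rintro h k hk x (rfl | hx) r hr
    · rcases List.mem_cons.1 hr with rfl | hr
      · exact h
      · exact hk r hr
    · refine hp h _ ?_ x hx r hr
      intro r hr
      rcases List.mem_cons.1 hr with rfl | hr
      · exact h
      · exact hk r hr

/-- The counter machine that executes the program `p`; its control states are all lists of
programs. -/
def Prog.ctrlMachine (p : Prog) : Machine (List Prog) where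
  act := ctrlAct
  next := CStep
  start := [p]
  final := []

/-- The sequential composition of a list of programs. -/
def listRel : List Prog → (ℕ → ℕ) → (ℕ → ℕ) → Prop
  | [], s, t => s = t
  | p :: k, s, t => Relation.Comp p.Rel (listRel k) s t

theorem listRel_of_step {x y : List Prog} {s s' t : ℕ → ℕ} (h : CStep x y)
    (hs : (ctrlAct x).Exec s s') (ht : listRel y s' t) : listRel x s t := by
  cases h with
  | act a k => exact ⟨s', hs, ht⟩
  | seq p q k =>
    obtain rfl : s' = s := hs
    obtain ⟨m, h₁, m', h₂, h₃⟩ : ∃ m, p.Rel s' m ∧ ∃ m', q.Rel m m' ∧ listRel k m' t := ht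
    exact ⟨m', ⟨m, h₁, h₂⟩, h₃⟩
  | done p k =>
    obtain rfl : s' = s := hs
    exact ⟨s', Relation.ReflTransGen.refl, ht⟩
  | again p k =>
    obtain rfl : s' = s := hs
    obtain ⟨m, h₁, m', h₂, h₃⟩ : ∃ m, p.Rel s' m ∧ ∃ m', Relation.ReflTransGen p.Rel m m' ∧
      listRel k m' t := ht
    exact ⟨m', Relation.ReflTransGen.head h₁ h₂, h₃⟩

theorem Prog.listRel_of_halts {p : Prog} {q} {s : ℕ → ℕ} (h : p.ctrlMachine.Halts q s) :
    ∃ t, listRel q s t := by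
  induction h with
  | last h₁ h₂ => exact ⟨_, listRel_of_step h₂ h₁ rfl⟩
  | step h₁ h₂ _ ih =>
    obtain ⟨t, ht⟩ := ih
    exact ⟨t, listRel_of_step h₂ h₁ ht⟩

theorem Prog.halts_of_step {p : Prog} {x y : List Prog} {s t : ℕ → ℕ}
    (h : CStep x y) (hs : (ctrlAct x).Exec s t)
    (hy : y = [] ∨ p.ctrlMachine.Halts y t) : p.ctrlMachine.Halts x s := by
  rcases hy with rfl | hy
  · exact .last (M := p.ctrlMachine) hs h
  · exact .step (M := p.ctrlMachine) hs h hy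

theorem Prog.halts_of_rel {p : Prog} (r : Prog) : ∀ (k : List Prog) (s t : ℕ → ℕ),
    r.Rel s t → (k = [] ∨ p.ctrlMachine.Halts k t) → p.ctrlMachine.Halts (r :: k) s := by
  induction r with
  | act a =>
    intro k s t hr hk
    exact halts_of_step (.act a k) hr hk
  | seq a b iha ihb =>
    rintro k s t ⟨m, h₁, h₂⟩ hk
    exact halts_of_step (.seq a b k) rfl (.inr (iha _ _ _ h₁ (.inr (ihb _ _ _ h₂ hk))))
  | star a iha =>
    intro k s t hr hk
    induction hr using Relation.ReflTransGen.head_induction_on with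
    | refl => exact halts_of_step (.done a k) rfl hk
    | head h₁ _ ih => exact halts_of_step (.again a k) rfl (.inr (iha _ _ _ h₁ (.inr ih)))

/-- The counter machine that executes the program `p`, with the finitely many control states that
it can reach. -/
def Prog.machine (p : Prog) : Machine ↥(reach p [] ∪ {[]}) where
  act q := ctrlAct q.1
  next q q' := CStep q.1 q'.1
  start := ⟨[p], .inl (mem_reach p [])⟩
  final := ⟨[], .inr rfl⟩

theorem Prog.machine_halts_iff {p : Prog} (x : ↥(reach p [] ∪ {[]})) (s : ℕ → ℕ) :
    p.machine.Halts x s ↔ p.ctrlMachine.Halts x.1 s := by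
  constructor
  · intro h
    induction h with
    | last h₁ h₂ => exact .last (M := p.ctrlMachine) h₁ h₂
    | step h₁ h₂ _ ih => exact .step (M := p.ctrlMachine) h₁ h₂ ih
  · obtain ⟨x, hx⟩ := x
    intro h
    change p.ctrlMachine.Halts x s at h
    induction h with
    | last h₁ h₂ => exact .last (M := p.machine) (q := ⟨_, hx⟩) h₁ h₂
    | @step q q' s t h₁ h₂ _ ih =>
      have hq' : q' ∈ reach p [] ∪ {[]} := by
        rcases hx with hx | rfl
        · exact reach_closed p _ _ _ hx h₂
        · cases h₂
      exact .step (M := p.machine) (q := ⟨_, hx⟩) (q' := ⟨q', hq'⟩) h₁ h₂ (ih hq')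

theorem Prog.machine_halts_start_iff (p : Prog) (s : ℕ → ℕ) :
    p.machine.Halts p.machine.start s ↔ ∃ t, p.Rel s t := by
  rw [machine_halts_iff]
  constructor
  · intro h
    obtain ⟨t, m, h₁, _⟩ := listRel_of_halts h
    exact ⟨m, h₁⟩
  · rintro ⟨t, h⟩
    exact halts_of_rel p [] s t h (.inl rfl)

theorem Prog.machine_act_below {p : Prog} {B : ℕ} (hp : p.Below B) (q) :
    (p.machine.act q).Below B := by
  obtain ⟨x, hx⟩ := q
  have hx' : ∀ q ∈ x, q.Below B := by
    rcases hx with hx | rfl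
    · exact below_of_mem_reach p hp [] (by simp) x hx
    · simp
  change (ctrlAct x).Below B
  match x, hx' with
  | .act a :: k, h => exact h _ (List.mem_cons_self ..)
  | [], _ => trivial
  | .seq _ _ :: _, _ => trivial
  | .star _ :: _, _ => trivial

/-! ### A counter machine with an undecidable halting problem -/

open Nat.Partrec in
/-- The halting problem asks for a zero of a primitive recursive function: the number of steps after
which the program has halted. -/
theorem exists_primrec'_undecidable : ∃ f : List.Vector ℕ 2 → ℕ, Nat.Primrec' f ∧
    ¬ ComputablePred fun n => ∃ k, f (n ::ᵥ k ::ᵥ List.Vector.nil) = 0 := by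
  classical
  let g : ℕ → ℕ → ℕ := fun n k =>
    if (Code.evaln k (Denumerable.ofNat Code n) 0).isSome then 0 else 1
  have hg : Primrec₂ g := by
    have h : Primrec fun a : ℕ × ℕ => Code.evaln a.2 (Denumerable.ofNat Code a.1) 0 :=
      Code.primrec_evaln.comp ((Primrec.snd.pair ((Primrec.ofNat Code).comp Primrec.fst)).pair
        (Primrec.const 0))
    exact Primrec.ite (Primrec.eq.comp (Primrec.option_isSome.comp h) (Primrec.const true))
      (Primrec.const 0) (Primrec.const 1)
  refine ⟨fun v => g v.head v.tail.head, Nat.Primrec'.prim_iff₂.2 hg, fun h => ?_⟩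
  refine ComputablePred.halting_problem 0 (ComputablePred.computable_of_manyOneReducible ?_ h)
  refine ⟨Encodable.encode, Computable.encode, fun c => ?_⟩
  have hk : ∀ k, g (Encodable.encode c) k = 0 ↔ ∃ x, x ∈ Code.evaln k c 0 := by
    intro k
    simp only [g, Denumerable.ofNat_encode, Option.isSome_iff_exists, Option.mem_def]
    split_ifs with h <;> simp [h]
  constructor
  · intro h
    obtain ⟨k, hk'⟩ := Code.evaln_complete.1 (Part.get_mem h)
    exact ⟨k, (hk k).2 ⟨_, hk'⟩⟩
  · rintro ⟨k, h⟩
    obtain ⟨x, hx⟩ := (hk k).1 h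
    exact Part.dom_iff_mem.2 ⟨x, Code.evaln_sound hx⟩

/-- Some counter machine with finitely many control states has an undecidable halting problem,
the input being the initial value of register `0`. -/
theorem exists_machine_undecidable : ∃ (Q : Type) (_ : Finite Q) (M : Machine Q) (B : ℕ),
    0 < B ∧ (∀ q, (M.act q).Below B) ∧
      ¬ ComputablePred fun n => M.Halts M.start (update (fun _ => 0) 0 n) := by
  obtain ⟨f, hf, hund⟩ := exists_primrec'_undecidable
  obtain ⟨p, hp⟩ := computable_of_primrec' hf (fun i => i) 2 3 (fun i => by omega) (by omega)
    (fun i => by omega)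
  -- guess the second argument of `f`, compute `f`, and check that the value is `0`
  let P : Prog := .seq (.star (.act (.inc 1))) (.seq p (.act (.zero 2)))
  obtain ⟨B, hB⟩ := P.exists_below
  refine ⟨_, ((finite_reach P []).union (Set.finite_singleton [])).to_subtype, P.machine, B + 1,
    B.succ_pos, fun q => (Prog.machine_act_below hB q).mono (Nat.le_succ B), fun h => hund ?_⟩
  refine h.of_eq fun n => ?_
  rw [Prog.machine_halts_start_iff]
  have hguess : ∀ m, Relation.ReflTransGen (Act.inc 1).Exec (update (fun _ => 0) 0 n) m ↔
      ∃ k, m = update (update (fun _ => 0) 0 n) 1 k := by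
    intro m
    constructor
    · intro h
      induction h with
      | refl => exact ⟨0, by funext r; by_cases h : r = 1 <;> simp [h]⟩
      | tail _ h ih =>
        obtain ⟨k, rfl⟩ := ih
        refine ⟨k + 1, ?_⟩
        rw [show _ = _ from h]
        simp
    · rintro ⟨k, rfl⟩
      induction k with
      | zero =>
        have : update (update (fun _ => 0) 0 n) 1 0 = update (fun _ => 0) 0 n := by
          funext r; by_cases h : r = 1 <;> simp [h]
        rw [this]
      | succ k ih => exact ih.tail (show _ = _ by simp)
  have hpk : ∀ k t, p.Rel (update (update (fun _ => 0) 0 n) 1 k) t ↔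
      t = update (update (update (fun _ => 0) 0 n) 1 k) 2 (f (n ::ᵥ k ::ᵥ List.Vector.nil)) := by
    intro k t
    refine hp _ ⟨fun r hr => ?_, by simp⟩ t
    rw [update_of_ne (by omega), update_of_ne (by omega)]
  constructor
  · rintro ⟨t, m, h₁, m', h₂, h₃, rfl⟩
    obtain ⟨k, rfl⟩ := (hguess m).1 h₁
    rw [hpk] at h₂
    subst h₂
    exact ⟨k, by simpa using h₃⟩
  · rintro ⟨k, hk⟩
    exact ⟨_, _, (hguess _).2 ⟨k, rfl⟩, _, (hpk k _).2 rfl, by simpa using hk, rfl⟩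

end Counter

/-! ### Helices -/

/-- A helix system: horizontal and vertical constraints on letters. -/
structure HelixSystem (L : Type) where
  H : L → L → Prop
  V : L → L → Prop
  init : L
  inp : L
  pad : L
  halt : L
  /-- The letters that occur only after `halt`. -/
  post : L → Prop
  inp_ne_init : inp ≠ init
  pad_ne_init : pad ≠ init
  init_ne_halt : init ≠ halt
  inp_ne_halt : inp ≠ halt
  not_H_init : ∀ b, ¬ H b init
  not_post_init : ¬ post init
  not_post_inp : ¬ post inp
  not_post_pad : ¬ post pad
  not_post_halt : ¬ post halt
  post_of_H : ∀ b c, H b c → post c → b = halt ∨ post b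
  post_of_H_of_post : ∀ b c, H b c → b = halt ∨ post b → post c
  post_of_V_halt : ∀ c, V halt c → post c

namespace HelixSystem

variable {L : Type} (S : HelixSystem L)

/-- `S.Next n u c`: a word, given in reverse as `u`, may be continued by the letter `c`. The
initial letter is followed by `n` letters `inp` and a letter `pad`. -/
inductive Next (n : ℕ) : List L → L → Prop
  | inp {k : ℕ} (hk : k < n) : Next n (List.replicate k S.inp ++ [S.init]) S.inp
  | pad : Next n (List.replicate n S.inp ++ [S.init]) S.pad
  | H {b c : L} (u : List L) (h : S.H b c) : Next n (b :: u) c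

/-- Words over `L`, given in reverse, that satisfy the horizontal constraints, and that continue
after a letter `halt` only at the prefixes in `σ`. -/
inductive Valid (n : ℕ) (σ : Set (List L)) : List L → Prop
  | init : Valid n σ [S.init]
  | step {u : List L} {c : L} : Valid n σ u → S.Next n u c → (u.head? = some S.halt → u ∈ σ) →
      Valid n σ (c :: u)

/-- A helix: a word `w` that ends in `halt` and has a continuation such that, if the word is wound
up into rows of a fixed odd length, each letter of `w` and the one above it satisfy the vertical
constraint. All words are given in reverse. -/
def Helix (n : ℕ) : Prop :=
  ∃ w r u₁ u₂ : List L, S.Valid n Set.univ (r ++ S.halt :: w) ∧ r ++ S.halt :: w = u₁ ++ u₂ ∧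
    List.Forall₂ S.V (S.halt :: w) u₁ ∧ Odd u₂.length

variable {S}

theorem Valid.mono {n : ℕ} {σ τ : Set (List L)} (h : σ ⊆ τ) {u : List L} (hu : S.Valid n σ u) :
    S.Valid n τ u := by
  induction hu with
  | init => exact .init
  | step _ h₁ h₂ ih => exact .step ih h₁ fun h' => h (h₂ h')

theorem Valid.ne_nil {n : ℕ} {σ : Set (List L)} {u : List L} (hu : S.Valid n σ u) : u ≠ [] := by
  cases hu <;> simp

theorem Valid.exists_eq_append_init {n : ℕ} {σ : Set (List L)} {u : List L}
    (hu : S.Valid n σ u) : ∃ v, u = v ++ [S.init] := by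
  induction hu with
  | init => exact ⟨[], rfl⟩
  | @step u c _ _ _ ih =>
    obtain ⟨v, rfl⟩ := ih
    exact ⟨c :: v, rfl⟩

theorem Valid.of_append {n : ℕ} {σ : Set (List L)} {u : List L} (hne : u ≠ []) :
    ∀ {r : List L}, S.Valid n σ (r ++ u) → S.Valid n σ u := by
  intro r
  induction r with
  | nil => exact id
  | cons c r ih =>
    intro h
    rw [List.cons_append] at h
    generalize hv : r ++ u = v at h ih
    cases h with
    | init => simp [hne] at hv
    | step h _ _ => exact ih h

theorem Next.ne_init {n : ℕ} {u : List L} {c : L} (h : S.Next n u c) : c ≠ S.init := by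
  cases h with
  | inp => exact S.inp_ne_init
  | pad => exact S.pad_ne_init
  | H u h => rintro rfl; exact S.not_H_init _ h

/-- The initial letter occurs only at the beginning. -/
theorem Valid.eq_nil_of_init {n : ℕ} {σ : Set (List L)} {u : List L} (hu : S.Valid n σ u) :
    ∀ {v v' : List L}, u = v ++ S.init :: v' → v' = [] := by
  induction hu with
  | init =>
    intro v v' h
    rcases v with _ | ⟨a, v⟩ <;> simp_all
  | step _ h _ ih =>
    intro v v' he
    rcases v with _ | ⟨a, v⟩
    · simp only [List.nil_append, List.cons.injEq] at he
      exact absurd he.1 h.ne_init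
    · simp only [List.cons_append, List.cons.injEq] at he
      exact ih he.2

/-- A word that ends in a letter that occurs only after `halt` has a proper prefix in `σ`. -/
theorem Valid.exists_of_post {n : ℕ} {σ : Set (List L)} {u : List L} (hu : S.Valid n σ u) :
    ∀ {c : L} {v : List L}, u = c :: v → S.post c → ∃ r w, u = r ++ S.halt :: w ∧
      S.halt :: w ∈ σ := by
  induction hu with
  | init =>
    intro c v he hc
    cases he
    exact absurd hc S.not_post_init
  | @step u c hu h hσ ih =>
    intro c' v he hc
    cases he
    cases h with
    | inp => exact absurd hc S.not_post_inp
    | pad => exact absurd hc S.not_post_pad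
    | @H b c u h =>
      rcases S.post_of_H _ _ h hc with rfl | hb
      · exact ⟨[c], u, rfl, hσ rfl⟩
      · obtain ⟨r, w, h₁, h₂⟩ := ih rfl hb
        exact ⟨c :: r, w, by rw [h₁]; rfl, h₂⟩

/-- The letter `halt` occurs at most once, and is followed by letters that occur only after
`halt`. -/
theorem Valid.not_mem_of_halt {n : ℕ} {σ : Set (List L)} {u : List L} (hu : S.Valid n σ u) :
    ∀ {r w : List L}, u = r ++ S.halt :: w → S.halt ∉ w ∧ ∀ c ∈ r, S.post c := by
  have hrep : ∀ k, S.halt ∉ List.replicate k S.inp ++ [S.init] := by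
    intro k
    simp only [List.mem_append, List.mem_replicate, List.mem_singleton, not_or, not_and]
    exact ⟨fun _ h => S.inp_ne_halt h.symm, fun h => S.init_ne_halt h.symm⟩
  induction hu with
  | init =>
    intro r w he
    have : S.halt ∈ [S.init] := he ▸ by simp
    exact absurd this (hrep 0)
  | @step u c hu h _ ih =>
    -- a letter after `halt` occurs only after `halt`
    have key : S.halt ∈ u → S.post c := by
      intro hmem
      cases h with
      | inp => exact absurd hmem (hrep _)
      | pad => exact absurd hmem (hrep _)
      | @H b c u h =>
        refine S.post_of_H_of_post b c h ?_
        obtain ⟨r, w, he⟩ := List.append_of_mem hmem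
        cases r with
        | nil => cases he; exact .inl rfl
        | cons b' r =>
          have := (ih he).2 b' (by simp)
          cases he
          exact .inr this
    intro r w he
    cases r with
    | nil =>
      cases he
      exact ⟨fun h => S.not_post_halt (key h), by simp⟩
    | cons c' r =>
      cases he
      obtain ⟨h₁, h₂⟩ := ih rfl
      refine ⟨h₁, fun x hx => ?_⟩
      rcases List.mem_cons.1 hx with rfl | hx
      · exact key (by simp)
      · exact h₂ x hx

/-- A word with a letter `halt` continues after `halt` only at this letter. -/
theorem Valid.singleton {n : ℕ} {σ : Set (List L)} {w : List L} : ∀ {r : List L},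
    S.Valid n σ (r ++ S.halt :: w) → S.Valid n {S.halt :: w} (r ++ S.halt :: w) := by
  have hmono : ∀ {u}, S.Valid n σ u → S.halt ∉ u.tail → S.Valid n {S.halt :: w} u := by
    intro u hu
    induction hu with
    | init => exact fun _ => .init
    | @step u c hu h _ ih =>
      intro hmem
      refine .step (ih fun h' => hmem (List.mem_of_mem_tail h')) h fun h' => ?_
      exact absurd (List.mem_of_head? h') hmem
  intro r
  induction r with
  | nil => exact fun hu => hmono hu (hu.not_mem_of_halt (r := []) rfl).1
  | cons c r ih =>
    intro hu
    have hpost := (hu.not_mem_of_halt rfl).2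
    rw [List.cons_append] at hu ⊢
    generalize hv : r ++ S.halt :: w = v at hu ih ⊢
    cases hu with
    | init => simp at hv
    | step hu h _ =>
      subst hv
      refine .step (ih hu) h fun h' => ?_
      cases r with
      | nil => rfl
      | cons c' r =>
        simp only [List.cons_append, List.head?_cons, Option.some.injEq] at h'
        exact absurd (h' ▸ hpost c' (by simp)) S.not_post_halt

/-- The form of a word that satisfies the horizontal constraints. -/
theorem Valid.form {n : ℕ} {σ : Set (List L)} {u : List L} (hu : S.Valid n σ u)
    (hinp : ∀ c, ¬ S.H S.inp c) (hinit : ∀ c, ¬ S.H S.init c) :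
    (∃ k, k ≤ n ∧ u = List.replicate k S.inp ++ [S.init]) ∨
    ∃ t : List L, u = t.reverse ++ S.pad :: (List.replicate n S.inp ++ [S.init]) ∧
      List.IsChain S.H (S.pad :: t) := by
  induction hu with
  | init => exact .inl ⟨0, n.zero_le, rfl⟩
  | @step u c hu h _ ih =>
    cases h with
    | @inp k hk => exact .inl ⟨k + 1, hk, rfl⟩
    | pad => exact .inr ⟨[], rfl, List.isChain_singleton _⟩
    | @H b c u h =>
      rcases ih with ⟨k, _, he⟩ | ⟨t, he, ht⟩
      · rcases k with _ | k
        · cases he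
          exact absurd h (hinit _)
        · cases he
          exact absurd h (hinp _)
      · refine .inr ⟨t ++ [c], by rw [he]; simp, ?_⟩
        rw [← List.cons_append, List.isChain_append]
        refine ⟨ht, List.isChain_singleton _, ?_⟩
        intro x hx y hy
        simp only [List.head?_cons, Option.mem_def, Option.some.injEq] at hy
        subst hy
        have : (S.pad :: t).getLast? = some b := by
          have h' := congrArg List.head? he
          rw [List.getLast?_eq_head?_reverse]
          simp only [List.head?_cons] at h'
          rw [h', List.reverse_cons]
          cases t.reverse <;> rfl
        rw [this] at hx
        cases hx
        exact h

theorem valid_of_isChain {n : ℕ} (t : List L) (ht : List.IsChain S.H (S.pad :: t)) :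
    S.Valid n Set.univ (t.reverse ++ S.pad :: (List.replicate n S.inp ++ [S.init])) := by
  have hrep : ∀ k ≤ n, S.Valid n Set.univ (List.replicate k S.inp ++ [S.init]) := by
    intro k
    induction k with
    | zero => intro _; exact .init
    | succ k ih => intro hk; exact .step (ih (by omega)) (.inp hk) fun _ => trivial
  induction t using List.reverseRecOn with
  | nil => exact .step (hrep n le_rfl) .pad fun _ => trivial
  | append_singleton t c ih =>
    rw [← List.cons_append, List.isChain_append] at ht
    have hv := ih ht.1
    rw [List.reverse_append, List.reverse_singleton, List.append_assoc, List.singleton_append]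
    have hne : ∃ b v, t.reverse ++ S.pad :: (List.replicate n S.inp ++ [S.init]) = b :: v ∧
        (S.pad :: t).getLast? = some b := by
      rw [List.getLast?_eq_head?_reverse, List.reverse_cons]
      cases t.reverse with
      | nil => exact ⟨_, _, rfl, rfl⟩
      | cons b v => exact ⟨_, _, rfl, rfl⟩
    obtain ⟨b, v, hb, hl⟩ := hne
    rw [hb] at hv ⊢
    exact .step hv (.H _ (ht.2.2 b (by rw [hl]; rfl) c rfl)) fun _ => trivial

end HelixSystem

theorem forall₂_append_left {α β : Type*} {R : α → β → Prop} {a b : List α} {l : List β}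
    (h : List.Forall₂ R (a ++ b) l) :
    ∃ l₁ l₂, l = l₁ ++ l₂ ∧ List.Forall₂ R a l₁ ∧ List.Forall₂ R b l₂ := by
  induction a generalizing l with
  | nil => exact ⟨[], l, rfl, .nil, h⟩
  | cons x a ih =>
    rw [List.cons_append, List.forall₂_cons_left_iff] at h
    obtain ⟨y, l', hxy, h', rfl⟩ := h
    obtain ⟨l₁, l₂, rfl, h₁, h₂⟩ := ih h'
    exact ⟨y :: l₁, l₂, rfl, .cons hxy h₁, h₂⟩

namespace Counter

open Function

/-! ### The helix system of a counter machine -/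

/-- Contents of a cell: empty, or a token of a register. A row of cells represents the registers
by the numbers of their tokens. -/
abbrev Content (B : ℕ) := Option (Fin (B + 1))

/-- The letters of the helix system of a counter machine. A row consists of a marker and of cells;
`cell q x y d` is a cell of a row in control state `q` whose content is changed from `x` to `y`,
and `d` records whether the action of the row has been performed up to this cell. The first row
consists of `init`, `inp` and `pad`, the last one of `halt` and `fin`, followed by `close`. -/
inductive Letter (Q : Type) (B : ℕ) : Type where
  | init : Letter Q B
  | inp : Letter Q B
  | pad : Letter Q B
  | mark (first : Bool) (q : Q) : Letter Q B
  | cell (q : Q) (x y : Content B) (d : Bool) : Letter Q B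
  | halt : Letter Q B
  | fin (x : Content B) : Letter Q B
  | close : Letter Q B

variable {Q : Type} {B : ℕ}

instance [Finite Q] : Finite (Letter Q B) := by
  let f : Letter Q B → Fin 8 × Option Q × Content B × Content B × Bool := fun
    | .init => (0, none, none, none, false)
    | .inp => (1, none, none, none, false)
    | .pad => (2, none, none, none, false)
    | .mark b q => (3, some q, none, none, b)
    | .cell q x y d => (4, some q, x, y, d)
    | .halt => (5, none, none, none, false)
    | .fin x => (6, none, x, none, false)
    | .close => (7, none, none, none, false)
  refine Finite.of_injective f fun a b h => ?_
  cases a <;> cases b <;> simp_all [f]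

/-- The change of a cell from `x` to `y` under an action, where `d` and `d'` record whether the
action has been performed before and after this cell. -/
def Trans (a : Act) (d : Bool) (x y : Content B) (d' : Bool) : Prop :=
  match a with
  | .nop => y = x ∧ d' = d
  | .inc r => (y = x ∧ d' = d) ∨ (d = false ∧ x = none ∧ y.map Fin.val = some r ∧ d' = true)
  | .dec r => (y = x ∧ d' = d) ∨ (d = false ∧ x.map Fin.val = some r ∧ y = none ∧ d' = true)
  | .zero r => y = x ∧ d' = d ∧ x.map Fin.val ≠ some r

/-- Whether an action counts as performed at the beginning of a row. -/
def startFlag : Act → Bool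
  | .nop => true
  | .inc _ => false
  | .dec _ => false
  | .zero _ => true

/-- The horizontal constraint. -/
inductive Horiz (M : Machine Q) : Letter Q B → Letter Q B → Prop
  | pad_pad : Horiz M .pad .pad
  | pad_mark : Horiz M .pad (.mark true M.start)
  | mark_cell {b q x y d} (h : Trans (M.act q) (startFlag (M.act q)) x y d) :
      Horiz M (.mark b q) (.cell q x y d)
  | cell_cell {q x y d x' y' d'} (h : Trans (M.act q) d x' y' d') :
      Horiz M (.cell q x y d) (.cell q x' y' d')
  | cell_mark {q q' x y} (h : M.next q q') : Horiz M (.cell q x y true) (.mark false q')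
  | cell_halt {q x y} (h : M.next q M.final) : Horiz M (.cell q x y true) .halt
  | halt_fin {x} : Horiz M .halt (.fin x)
  | fin_fin {x y} : Horiz M (.fin x) (.fin y)
  | fin_close {x} : Horiz M (.fin x) .close

/-- The content of a cell before the action of its row. -/
def Letter.inC : Letter Q B → Option (Content B)
  | .cell _ x _ _ => some x
  | .fin x => some x
  | _ => none

/-- The content of a cell after the action of its row. -/
def Letter.outC : Letter Q B → Option (Content B)
  | .inp => some (some 0)
  | .pad => some none
  | .cell _ _ y _ => some y
  | _ => none

/-- The vertical constraint. -/
inductive Vert : Letter Q B → Letter Q B → Prop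
  | init_mark {q} : Vert .init (.mark true q)
  | mark_mark {b q q'} : Vert (.mark b q) (.mark false q')
  | mark_halt {b q} : Vert (.mark b q) .halt
  | halt_close : Vert .halt .close
  | cell {b c x} (hb : b.outC = some x) (hc : c.inC = some x) : Vert b c

/-- The helix system of a counter machine. -/
def Machine.helixSystem (M : Machine Q) (B : ℕ) : HelixSystem (Letter Q B) where
  H := Horiz M
  V := Vert
  init := .init
  inp := .inp
  pad := .pad
  halt := .halt
  post c := c = .close ∨ ∃ x, c = .fin x
  inp_ne_init := by simp
  pad_ne_init := by simp
  init_ne_halt := by simp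
  inp_ne_halt := by simp
  not_H_init := by rintro b ⟨⟩
  not_post_init := by simp
  not_post_inp := by simp
  not_post_pad := by simp
  post_of_H := by
    rintro b c h hc
    cases h <;> simp_all
  not_post_halt := by simp
  post_of_H_of_post := by
    rintro b c h hb
    cases h <;> simp_all
  post_of_V_halt := by
    rintro c h
    cases h with
    | halt_close => exact .inl rfl
    | cell hb => cases hb

/-- The number of tokens of each register in a row. -/
def cnt (κ : List (Content B)) (r : ℕ) : ℕ := (κ.map (Option.map Fin.val)).count (some r)

theorem cnt_cons (x : Content B) (κ : List (Content B)) (r : ℕ) :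
    cnt (x :: κ) r = cnt κ r + if x.map Fin.val = some r then 1 else 0 := by
  simp only [cnt, List.map_cons, List.count_cons, beq_iff_eq]

/-- A row: the cells are changed one after the other. -/
inductive Sweep (a : Act) : Bool → List (Content B) → List (Content B) → Bool → Prop
  | nil (d) : Sweep a d [] [] d
  | cons {d d₁ d₂ x y xs ys} (h : Trans a d x y d₁) (hs : Sweep a d₁ xs ys d₂) :
      Sweep a d (x :: xs) (y :: ys) d₂

theorem Sweep.exec_inc {r : ℕ} {d d' : Bool} {xs ys : List (Content B)}
    (h : Sweep (.inc r) d xs ys d') : (d' = d ∧ ys = xs) ∨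
      (d = false ∧ d' = true ∧ cnt ys = update (cnt xs) r (cnt xs r + 1)) := by
  induction h with
  | nil d => exact .inl ⟨rfl, rfl⟩
  | @cons d d₁ d₂ x y xs ys h hs ih =>
    rcases h with ⟨rfl, rfl⟩ | ⟨rfl, rfl, hy, rfl⟩
    · rcases ih with ⟨rfl, rfl⟩ | ⟨rfl, rfl, ih⟩
      · exact .inl ⟨rfl, rfl⟩
      · refine .inr ⟨rfl, rfl, ?_⟩
        funext r'
        rw [cnt_cons, ih]
        by_cases hr : r' = r
        · subst hr; simp [cnt_cons]; omega
        · simp [hr, cnt_cons]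
    · rcases ih with ⟨rfl, rfl⟩ | ⟨h, _⟩
      · refine .inr ⟨rfl, rfl, ?_⟩
        funext r'
        rw [cnt_cons, hy]
        by_cases hr : r' = r
        · subst hr; simp [cnt_cons]
        · simp [hr, cnt_cons, Ne.symm hr]
      · cases h

theorem Sweep.exec_dec {r : ℕ} {d d' : Bool} {xs ys : List (Content B)}
    (h : Sweep (.dec r) d xs ys d') : (d' = d ∧ ys = xs) ∨
      (d = false ∧ d' = true ∧ cnt xs = update (cnt ys) r (cnt ys r + 1)) := by
  induction h with
  | nil d => exact .inl ⟨rfl, rfl⟩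
  | @cons d d₁ d₂ x y xs ys h hs ih =>
    rcases h with ⟨rfl, rfl⟩ | ⟨rfl, hx, rfl, rfl⟩
    · rcases ih with ⟨rfl, rfl⟩ | ⟨rfl, rfl, ih⟩
      · exact .inl ⟨rfl, rfl⟩
      · refine .inr ⟨rfl, rfl, ?_⟩
        funext r'
        rw [cnt_cons, ih]
        by_cases hr : r' = r
        · subst hr; simp [cnt_cons]; omega
        · simp [hr, cnt_cons]
    · rcases ih with ⟨rfl, rfl⟩ | ⟨h, _⟩
      · refine .inr ⟨rfl, rfl, ?_⟩
        funext r'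
        rw [cnt_cons, hx]
        by_cases hr : r' = r
        · subst hr; simp [cnt_cons]
        · simp [hr, cnt_cons, Ne.symm hr]
      · cases h

theorem Sweep.exec_zero {r : ℕ} {d d' : Bool} {xs ys : List (Content B)}
    (h : Sweep (.zero r) d xs ys d') : ys = xs ∧ cnt xs r = 0 := by
  induction h with
  | nil d => exact ⟨rfl, rfl⟩
  | cons h hs ih =>
    obtain ⟨rfl, rfl, hx⟩ := h
    exact ⟨by rw [ih.1], by rw [cnt_cons, ih.2, if_neg hx]⟩

theorem Sweep.exec_nop {d d' : Bool} {xs ys : List (Content B)}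
    (h : Sweep .nop d xs ys d') : ys = xs := by
  induction h with
  | nil d => rfl
  | cons h hs ih =>
    obtain ⟨rfl, rfl⟩ := h
    rw [ih]

/-- A complete row performs its action on the registers. -/
theorem Sweep.exec {a : Act} {xs ys : List (Content B)} (h : Sweep a (startFlag a) xs ys true) :
    a.Exec (cnt xs) (cnt ys) := by
  cases a with
  | nop => rw [h.exec_nop]; rfl
  | inc r =>
    rcases h.exec_inc with ⟨h, _⟩ | ⟨_, _, h⟩
    · cases h
    · exact h
  | dec r =>
    rcases h.exec_dec with ⟨h, _⟩ | ⟨_, _, h⟩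
    · cases h
    · rw [h]
      exact ⟨by simp, by simp⟩
  | zero r =>
    obtain ⟨rfl, h⟩ := h.exec_zero
    exact ⟨h, rfl⟩

theorem Sweep.refl {a : Act} (d : Bool) {xs : List (Content B)}
    (h : ∀ x ∈ xs, Trans a d x x d) : Sweep a d xs xs d := by
  induction xs with
  | nil => exact .nil d
  | cons x xs ih =>
    exact .cons (h x (List.mem_cons_self ..)) (ih fun y hy => h y (List.mem_cons_of_mem _ hy))

theorem Sweep.append {a : Act} {d d' d'' : Bool} {xs ys xs' ys' : List (Content B)}
    (h : Sweep a d xs ys d') (h' : Sweep a d' xs' ys' d'') :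
    Sweep a d (xs ++ xs') (ys ++ ys') d'' := by
  induction h with
  | nil => exact h'
  | cons h _ ih => exact .cons h (ih h')

theorem Sweep.length_eq {a : Act} {d d' : Bool} {xs ys : List (Content B)}
    (h : Sweep a d xs ys d') : xs.length = ys.length := by
  induction h with
  | nil => rfl
  | cons _ _ ih => rw [List.length_cons, List.length_cons, ih]

theorem exists_sweep {a : Act} (ha : a.Below (B + 1)) {xs : List (Content B)} {t : ℕ → ℕ}
    (h : a.Exec (cnt xs) t) {N : ℕ} (hN : N + 1 ≤ xs.count none) :
    ∃ ys, Sweep a (startFlag a) xs ys true ∧ cnt ys = t ∧ N ≤ ys.count none := by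
  cases a with
  | nop =>
    obtain rfl : t = cnt xs := h
    exact ⟨xs, .refl _ fun _ _ => ⟨rfl, rfl⟩, rfl, by omega⟩
  | inc r =>
    have hmem : none ∈ xs := List.count_pos_iff.1 (by omega)
    obtain ⟨l₁, l₂, rfl⟩ := List.append_of_mem hmem
    have hs : Sweep (.inc r) false (l₁ ++ none :: l₂) (l₁ ++ some ⟨r, ha⟩ :: l₂) true :=
      (Sweep.refl (a := .inc r) false fun _ _ => Or.inl ⟨rfl, rfl⟩).append
        (.cons (.inr ⟨rfl, rfl, rfl, rfl⟩) (.refl (a := .inc r) true fun _ _ => Or.inl ⟨rfl, rfl⟩))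
    have ht : t = _ := h
    refine ⟨_, hs, Eq.trans (Sweep.exec hs) ht.symm, ?_⟩
    simp at hN ⊢
    omega
  | dec r =>
    obtain ⟨h₀, rfl⟩ := h
    have hmem : some r ∈ xs.map (Option.map Fin.val) := List.count_pos_iff.1 h₀
    obtain ⟨x, hx, hxr⟩ := List.mem_map.1 hmem
    obtain ⟨l₁, l₂, rfl⟩ := List.append_of_mem hx
    have hs : Sweep (.dec r) false (l₁ ++ x :: l₂) (l₁ ++ none :: l₂) true :=
      (Sweep.refl (a := .dec r) false fun _ _ => Or.inl ⟨rfl, rfl⟩).append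
        (.cons (.inr ⟨rfl, hxr, rfl, rfl⟩) (.refl (a := .dec r) true fun _ _ => Or.inl ⟨rfl, rfl⟩))
    refine ⟨_, hs, (Sweep.exec hs).2, ?_⟩
    have : x ≠ none := by rintro rfl; cases hxr
    simp [this] at hN ⊢
    omega
  | zero r =>
    obtain ⟨h₀, rfl⟩ := h
    refine ⟨xs, .refl _ fun x hx => ⟨rfl, rfl, fun hxr => ?_⟩, rfl, by omega⟩
    have : some r ∈ xs.map (Option.map Fin.val) := List.mem_map.2 ⟨x, hx, hxr⟩
    exact absurd (List.count_pos_iff.2 this) (by change ¬ 0 < cnt xs r; omega)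

end Counter

namespace Counter

open Function

variable {Q : Type} {B : ℕ}

/-! ### Helices represent halting runs -/

/-- The horizontal constraints force the cells of a row to perform its action step by step. -/
theorem exists_sweep_of_isChain {M : Machine Q} {q : Q} :
    ∀ (cs : List (Letter Q B)) (κ : List (Content B)) (x y : Content B) (d : Bool)
      (T : List (Letter Q B)), cs.map Letter.inC = κ.map some →
      List.IsChain (Horiz M) (.cell q x y d :: (cs ++ T)) →
      ∃ ys x' y' d', Sweep (M.act q) d κ ys d' ∧ cs.map Letter.outC = ys.map some ∧
        List.IsChain (Horiz M) (.cell q x' y' d' :: T) := by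
  intro cs
  induction cs with
  | nil =>
    intro κ x y d T hin hT
    obtain rfl : κ = [] := by simpa using hin.symm
    exact ⟨[], x, y, d, .nil d, rfl, hT⟩
  | cons c cs ih =>
    intro κ x y d T hin hT
    cases κ with
    | nil => simp at hin
    | cons z κ =>
      simp only [List.map_cons, List.cons.injEq] at hin
      rw [List.cons_append, List.isChain_cons_cons] at hT
      obtain ⟨h, hT⟩ := hT
      cases h with
      | cell_mark => simp [Letter.inC] at hin
      | cell_halt => simp [Letter.inC] at hin
      | @cell_cell _ _ _ _ x₁ y₁ d₁ h =>
        obtain ⟨ys, x', y', d', hs, hout, hT'⟩ := ih κ x₁ y₁ d₁ T hin.2 hT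
        obtain rfl : x₁ = z := by simpa [Letter.inC] using hin.1
        exact ⟨y₁ :: ys, x', y', d', .cons h hs, by simp [Letter.outC, hout], hT'⟩

/-- A row of cells that performs the action of a control state. -/
theorem exists_isChain_of_sweep {M : Machine Q} {q : Q} {d d' : Bool} {κ ys : List (Content B)}
    (hs : Sweep (M.act q) d κ ys d') {T : List (Letter Q B)}
    (hT : ∀ x y, List.IsChain (Horiz M) (.cell q x y d' :: T)) : ∀ x y,
    ∃ cs : List (Letter Q B), cs.map Letter.inC = κ.map some ∧ cs.map Letter.outC = ys.map some ∧
      List.IsChain (Horiz M) (.cell q x y d :: (cs ++ T)) := by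
  induction hs with
  | nil d => exact fun x y => ⟨[], rfl, rfl, hT x y⟩
  | @cons d d₁ d₂ x₁ y₁ xs ys h _ ih =>
    intro x y
    obtain ⟨cs, h₁, h₂, h₃⟩ := ih hT x₁ y₁
    exact ⟨.cell q x₁ y₁ d₁ :: cs, by simp [h₁, Letter.inC], by simp [h₂, Letter.outC],
      List.isChain_cons_cons.2 ⟨.cell_cell h, h₃⟩⟩

theorem inC_of_forall₂ {κ : List (Content B)} {cs cs' : List (Letter Q B)}
    (h : List.Forall₂ Vert cs cs') (hκ : cs.map Letter.outC = κ.map some) :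
    cs'.map Letter.inC = κ.map some := by
  induction h generalizing κ with
  | nil => exact hκ
  | @cons c c' cs cs' hc _ ih =>
    cases κ with
    | nil => simp at hκ
    | cons x κ =>
      simp only [List.map_cons, List.cons.injEq] at hκ ⊢
      refine ⟨?_, ih hκ.2⟩
      cases hc with
      | cell hb hc =>
        rw [hκ.1] at hb
        cases hb
        exact hc
      | _ => simp [Letter.outC] at hκ

theorem forall₂_of_inC {κ : List (Content B)} : ∀ {cs cs' : List (Letter Q B)},
    cs.map Letter.outC = κ.map some → cs'.map Letter.inC = κ.map some →
      List.Forall₂ Vert cs cs' := by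
  induction κ with
  | nil =>
    intro cs cs' h h'
    obtain rfl : cs = [] := by simpa using h
    obtain rfl : cs' = [] := by simpa using h'
    exact .nil
  | cons x κ ih =>
    intro cs cs' h h'
    cases cs with
    | nil => simp at h
    | cons c cs =>
      cases cs' with
      | nil => simp at h'
      | cons c' cs' =>
        simp only [List.map_cons, List.cons.injEq] at h h'
        exact .cons (.cell h.1 h'.1) (ih h.2 h'.2)

theorem halt_not_mem {cs : List (Letter Q B)} {κ : List (Content B)} {f : Letter Q B → _}
    (hf : f .halt = none) (h : cs.map f = κ.map some) : Letter.halt ∉ cs := by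
  intro hmem
  have : f .halt ∈ κ.map some := h ▸ List.mem_map_of_mem hmem
  simp [hf] at this

/-- Reading a wound-up word row by row gives a halting run. -/
theorem halts_of_rows {M : Machine Q} (N : ℕ) : ∀ (m : Letter Q B) (cs : List (Letter Q B))
    (κ : List (Content B)) (b : Bool) (q : Q) (T w r : List (Letter Q B)), w.length ≤ N →
    m ≠ .halt → κ ≠ [] → cs.map Letter.outC = κ.map some →
    List.IsChain (Horiz M) (.mark b q :: T) → .mark b q :: T = w ++ .halt :: r →
    List.Forall₂ Vert (m :: cs ++ (w ++ [.halt])) (.mark b q :: T) → M.Halts q (cnt κ) := by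
  induction N with
  | zero =>
    intro m cs κ b q T w r hN _ _ _ _ he _
    obtain rfl : w = [] := List.length_eq_zero_iff.1 (by omega)
    cases he
  | succ N ih =>
    intro m cs κ b q T w r hN hm hκ hout hch he hV
    rw [List.cons_append, List.forall₂_cons] at hV
    obtain ⟨cs', T', rfl, hcs, hw⟩ := forall₂_append_left hV.2
    have hin := inC_of_forall₂ hcs hout
    -- the first cell of the row
    obtain ⟨x₀, κ', rfl⟩ := List.exists_cons_of_ne_nil hκ
    cases cs' with
    | nil => simp at hin
    | cons c cs' =>
      simp only [List.map_cons, List.cons.injEq] at hin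
      have hch' := hch
      rw [List.cons_append, List.isChain_cons_cons] at hch'
      obtain ⟨h₁, h₂⟩ := hch'
      cases h₁ with
      | @mark_cell _ _ x y d htr =>
        obtain rfl : x = x₀ := by simpa [Letter.inC] using hin.1
        obtain ⟨ys, x', y', d', hs, hout', hT'⟩ := exists_sweep_of_isChain cs' κ' x y d T' hin.2 h₂
        have hsweep := Sweep.cons htr hs
        -- the letter `halt` does not occur in this row
        have hnot : Letter.halt ∉ Letter.mark b q :: (Letter.cell q x y d :: cs') := by
          have := halt_not_mem rfl hin.2
          simp [this]
        rw [← List.cons_append] at he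
        obtain ⟨w', hw', hT''⟩ : ∃ w', w = .mark b q :: (.cell q x y d :: cs') ++ w' ∧
            T' = w' ++ .halt :: r := by
          rcases List.append_eq_append_iff.1 he with ⟨as, h, h'⟩ | ⟨bs, h, h'⟩
          · exact ⟨as, h, h'⟩
          · cases bs with
            | nil => exact ⟨[], by simpa using h.symm, by simpa using h'.symm⟩
            | cons z bs =>
              simp only [List.cons_append, List.cons.injEq] at h'
              exact absurd (by rw [h, ← h'.1]; simp) hnot
        have hlen : w'.length ≤ N := by
          have := congrArg List.length hw'
          simp at this
          omega
        rw [hw'] at hw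
        have hw₁ := hw
        rw [List.cons_append, List.cons_append, List.forall₂_cons_left_iff] at hw₁
        obtain ⟨t, T'', hmt, _, rfl⟩ := hw₁
        rw [List.isChain_cons_cons] at hT'
        cases hmt with
        | mark_mark =>
          cases hT'.1 with
          | cell_mark hnext =>
            refine .step hsweep.exec hnext (ih (.mark b q) (.cell q x y d :: cs') (y :: ys) _ _ _
              w' r hlen (by simp) (by simp) ?_ hT'.2 hT'' ?_)
            · simp [Letter.outC, hout']
            · simpa using hw
        | mark_halt =>
          cases hT'.1 with
          | cell_halt hnext => exact .last hsweep.exec hnext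
        | cell hb => cases hb

/-- A halting run is written down row by row. -/
theorem exists_rows_of_halts {M : Machine Q} (hM : ∀ q, (M.act q).Below (B + 1)) {q : Q}
    {s : ℕ → ℕ} (h : M.Halts q s) : ∃ N, ∀ κ : List (Content B), cnt κ = s → N ≤ κ.count none →
      κ ≠ [] → ∀ b, ∃ W R : List (Letter Q B),
        List.IsChain (Horiz M) (.mark b q :: W ++ .halt :: R) ∧
        ∀ (m : Letter Q B) cs, cs.map Letter.outC = κ.map some → Vert m (.mark b q) →
          List.Forall₂ Vert (m :: cs ++ (.mark b q :: W ++ [.halt]))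
            (.mark b q :: W ++ .halt :: R) := by
  -- one row, followed by `T`
  have row : ∀ (q : Q) (κ ys : List (Content B)), κ ≠ [] →
      Sweep (M.act q) (startFlag (M.act q)) κ ys true → ∀ (b : Bool) (T : List (Letter Q B)),
      (∀ x y, List.IsChain (Horiz M) (.cell q x y true :: T)) → ∃ cs : List (Letter Q B),
      cs.map Letter.inC = κ.map some ∧ cs.map Letter.outC = ys.map some ∧
      List.IsChain (Horiz M) (.mark b q :: (cs ++ T)) := by
    intro q κ ys hκ hs b T hT
    generalize hd : startFlag (M.act q) = d at hs
    generalize hd' : true = d' at hs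
    cases hs with
    | nil => exact absurd rfl hκ
    | @cons _ d₁ _ x y xs ys h hs =>
      subst hd hd'
      obtain ⟨cs, h₁, h₂, h₃⟩ := exists_isChain_of_sweep hs hT x y
      exact ⟨.cell q x y d₁ :: cs, by simp [h₁, Letter.inC], by simp [h₂, Letter.outC],
        List.isChain_cons_cons.2 ⟨.mark_cell h, h₃⟩⟩
  induction h with
  | @last q s t hex hnext =>
    refine ⟨1, fun κ hcnt hN hκ b => ?_⟩
    obtain ⟨ys, hs, hys, _⟩ := exists_sweep (hM q) (hcnt ▸ hex) (N := 0) (by omega)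
    have hfin : ∀ (ys : List (Content B)) (l : Letter Q B), (l = .halt ∧ ys ≠ []) ∨
        (∃ x, l = .fin x) →
        List.IsChain (Horiz M) (l :: (ys.map Letter.fin ++ [.close])) := by
      intro ys
      induction ys with
      | nil =>
        rintro l (⟨_, h⟩ | ⟨x, rfl⟩)
        · exact absurd rfl h
        · exact List.isChain_cons_cons.2 ⟨.fin_close, List.isChain_singleton _⟩
      | cons y ys ih =>
        intro l hl
        refine List.isChain_cons_cons.2 ⟨?_, ih _ (.inr ⟨y, rfl⟩)⟩
        rcases hl with ⟨rfl, _⟩ | ⟨x, rfl⟩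
        · exact .halt_fin
        · exact .fin_fin
    have hys' : ys ≠ [] := by
      rintro rfl
      exact hκ (List.length_eq_zero_iff.1 hs.length_eq)
    obtain ⟨cs, hin, hout, hch⟩ := row q κ ys hκ hs b (.halt :: (ys.map Letter.fin ++ [.close]))
      (fun x y => List.isChain_cons_cons.2 ⟨.cell_halt hnext, hfin ys _ (.inl ⟨rfl, hys'⟩)⟩)
    refine ⟨cs, (ys.map Letter.fin ++ [Letter.close] : List (Letter Q B)), hch,
      fun m cs₀ hcs₀ hm => ?_⟩
    have h₁ : List.Forall₂ Vert (m :: cs₀) (.mark b q :: cs) :=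
      .cons hm (forall₂_of_inC hcs₀ hin)
    have h₂ : List.Forall₂ Vert (.mark b q :: cs) (.halt :: ys.map Letter.fin) :=
      .cons .mark_halt (forall₂_of_inC hout (by
        rw [List.map_map]; rfl))
    have h₃ : List.Forall₂ Vert [(.halt : Letter Q B)] [.close] := .cons .halt_close .nil
    exact List.rel_append h₁ (List.rel_append h₂ h₃)
  | @step q q' s t hex hnext _ ih =>
    obtain ⟨N, ih⟩ := ih
    refine ⟨N + 1, fun κ hcnt hN hκ b => ?_⟩
    obtain ⟨ys, hs, hys, hNys⟩ := exists_sweep (hM q) (hcnt ▸ hex) hN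
    have hys' : ys ≠ [] := by
      rintro rfl
      exact hκ (List.length_eq_zero_iff.1 hs.length_eq)
    obtain ⟨W, R, hWR, hV⟩ := ih ys hys hNys hys' false
    obtain ⟨cs, hin, hout, hch⟩ := row q κ ys hκ hs b (.mark false q' :: W ++ .halt :: R)
      (fun x y => List.isChain_cons_cons.2 ⟨.cell_mark hnext, hWR⟩)
    refine ⟨cs ++ .mark false q' :: W, R, by simpa using hch, fun m cs₀ hcs₀ hm => ?_⟩
    have h₁ : List.Forall₂ Vert (m :: cs₀) (.mark b q :: cs) :=
      .cons hm (forall₂_of_inC hcs₀ hin)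
    have h₂ := hV (.mark b q) cs hout .mark_mark
    have h₃ := List.rel_append h₁ h₂
    simpa using h₃

theorem cnt_input (n j : ℕ) : cnt (List.replicate n (some 0) ++ List.replicate j none :
    List (Content B)) = update (fun _ => 0) 0 n := by
  funext r
  have h : ∀ j, cnt (List.replicate j none : List (Content B)) r = 0 := by
    intro j
    induction j with
    | zero => rfl
    | succ j ih => rw [List.replicate_succ, cnt_cons, ih]; simp
  induction n with
  | zero =>
    rw [List.replicate_zero, List.nil_append, h]
    by_cases hr : r = 0 <;> simp [hr]
  | succ n ih =>
    rw [List.replicate_succ, List.cons_append, cnt_cons, ih]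
    by_cases hr : r = 0
    · subst hr; simp
    · simp [hr, Ne.symm hr]

/-- After `pad`, a word consists of letters `pad` until the first marker. -/
theorem form_of_isChain_pad {M : Machine Q} : ∀ {t : List (Letter Q B)},
    List.IsChain (Horiz M) (.pad :: t) → (∃ j, t = List.replicate j .pad) ∨
      ∃ j T, t = List.replicate j .pad ++ .mark true M.start :: T ∧
        List.IsChain (Horiz M) (.mark true M.start :: T) := by
  intro t
  induction t with
  | nil => exact fun _ => .inl ⟨0, rfl⟩
  | cons c t ih =>
    intro h
    rw [List.isChain_cons_cons] at h
    obtain ⟨h₁, h₂⟩ := h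
    cases h₁ with
    | pad_pad =>
      rcases ih h₂ with ⟨j, rfl⟩ | ⟨j, T, rfl, hT⟩
      · exact .inl ⟨j + 1, rfl⟩
      · exact .inr ⟨j + 1, T, rfl, hT⟩
    | pad_mark => exact .inr ⟨0, t, rfl, h₂⟩

/-- The letters that precede the first marker. -/
def Letter.Early : Letter Q B → Prop
  | .init => True
  | .inp => True
  | .pad => True
  | _ => False

theorem not_mark_true_of_isChain {M : Machine Q} : ∀ {T : List (Letter Q B)} {c : Letter Q B},
    List.IsChain (Horiz M) (c :: T) → ¬ c.Early → ∀ q, Letter.mark true q ∉ T := by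
  intro T
  induction T with
  | nil => simp
  | cons c' T ih =>
    intro c h hc q hq
    rw [List.isChain_cons_cons] at h
    obtain ⟨h₁, h₂⟩ := h
    rcases List.mem_cons.1 hq with rfl | hq
    · cases h₁
      exact hc trivial
    · refine ih h₂ ?_ q hq
      intro hc'
      cases h₁ <;> first | exact hc hc' | exact hc trivial

theorem halts_of_helix {M : Machine Q} {n : ℕ} (h : (M.helixSystem B).Helix n) :
    M.Halts M.start (update (fun _ => 0) 0 n) := by
  obtain ⟨w, r, u₁, u₂, hval, he, hV, -⟩ := h
  change r ++ Letter.halt :: w = u₁ ++ u₂ at he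
  change List.Forall₂ Vert (Letter.halt :: w) u₁ at hV
  have hmem : Letter.halt ∈ r ++ Letter.halt :: w := by simp
  rcases hval.form (by rintro c ⟨⟩) (by rintro c ⟨⟩) with ⟨k, _, hu⟩ | ⟨t, hu, ht⟩
  · change r ++ Letter.halt :: w = List.replicate k Letter.inp ++ [Letter.init] at hu
    rw [hu] at hmem
    simp at hmem
  change r ++ Letter.halt :: w = t.reverse ++
    Letter.pad :: (List.replicate n Letter.inp ++ [Letter.init]) at hu
  change List.IsChain (Horiz M) (Letter.pad :: t) at ht
  rcases form_of_isChain_pad ht with ⟨j, rfl⟩ | ⟨j, T, rfl, hT⟩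
  · rw [hu] at hmem
    simp at hmem
  -- the word, from the beginning
  have hU : w.reverse ++ Letter.halt :: r.reverse = (Letter.init :: (List.replicate n Letter.inp ++
      List.replicate (j + 1) Letter.pad)) ++ Letter.mark true M.start :: T := by
    have := congrArg List.reverse hu
    simpa [List.replicate_succ] using this
  have hU' : w.reverse ++ Letter.halt :: r.reverse = u₂.reverse ++ u₁.reverse := by
    have := congrArg List.reverse he
    simpa using this
  have hV' : List.Forall₂ Vert (w.reverse ++ [Letter.halt]) u₁.reverse := by
    have := List.forall₂_reverse_iff.2 hV
    simpa using this
  generalize hP : Letter.init :: (List.replicate n Letter.inp ++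
      List.replicate (j + 1) (Letter.pad : Letter Q B)) = P at hU
  have hPearly : ∀ c ∈ P, c.Early := by
    intro c hc
    subst hP
    simp only [List.mem_cons, List.mem_append, List.mem_replicate] at hc
    rcases hc with rfl | ⟨_, rfl⟩ | ⟨_, rfl⟩ <;> trivial
  -- the first row is `P`, since `halt` is not in `P`
  obtain ⟨w', hw', hT'⟩ : ∃ w', w.reverse = P ++ w' ∧
      Letter.mark true M.start :: T = w' ++ .halt :: r.reverse := by
    rcases List.append_eq_append_iff.1 hU with ⟨as, h, h'⟩ | ⟨bs, h, h'⟩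
    · cases as with
      | nil => cases h'
      | cons z as =>
        simp only [List.cons_append, List.cons.injEq] at h'
        exact (hPearly .halt (by rw [h, ← h'.1]; simp)).elim
    · exact ⟨bs, h, h'⟩
  -- the second row begins at the marker, which is the only letter above `init`
  have hu₁ : u₁.reverse = Letter.mark true M.start :: T := by
    rw [hw', ← hP, List.cons_append, List.cons_append, List.forall₂_cons_left_iff] at hV'
    obtain ⟨c, v, hc, _, hv⟩ := hV'
    rw [hU, hv] at hU'
    cases hc with
    | cell hb => cases hb
    | @init_mark q =>
      rw [hv]
      rcases List.append_eq_append_iff.1 hU' with ⟨as, h, h'⟩ | ⟨bs, h, h'⟩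
      · cases as with
        | nil => exact h'.symm
        | cons z as =>
          simp only [List.cons_append, List.cons.injEq] at h'
          refine absurd ?_ (not_mark_true_of_isChain hT (by simp [Letter.Early]) q)
          rw [h'.2]; simp
      · cases bs with
        | nil => exact h'
        | cons z bs =>
          simp only [List.cons_append, List.cons.injEq] at h'
          exact (hPearly (.mark true q) (by rw [h, h'.1]; simp)).elim
  rw [← cnt_input (B := B) n (j + 1)]
  refine halts_of_rows w'.length .init
    (List.replicate n Letter.inp ++ List.replicate (j + 1) Letter.pad) _ true M.start T w' r.reverse
    le_rfl (by simp) (by simp) ?_ hT hT' ?_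
  · simp [Letter.outC]
  · rw [hw', ← hP, hu₁] at hV'
    simpa using hV'

theorem helix_of_halts {M : Machine Q} (hM : ∀ q, (M.act q).Below (B + 1)) {n : ℕ}
    (h : M.Halts M.start (update (fun _ => 0) 0 n)) : (M.helixSystem B).Helix n := by
  obtain ⟨N, hN⟩ := exists_rows_of_halts hM h
  -- enough empty cells, and an odd length of the first row
  obtain ⟨j, hj, hodd⟩ : ∃ j, N ≤ j + 1 ∧ Odd (n + j + 2) := by
    rcases Nat.even_or_odd (n + N) with h | h
    · exact ⟨N + 1, by omega, by obtain ⟨a, ha⟩ := h; exact ⟨a + 1, by omega⟩⟩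
    · exact ⟨N, by omega, by obtain ⟨a, ha⟩ := h; exact ⟨a + 1, by omega⟩⟩
  obtain ⟨W, R, hch, hV⟩ := hN (List.replicate n (some 0) ++ List.replicate (j + 1) none)
    (cnt_input n (j + 1)) (by simp [List.count_replicate]; omega) (by simp) true
  have hV' := hV .init (List.replicate n Letter.inp ++ List.replicate (j + 1) Letter.pad)
    (by simp [Letter.outC]) .init_mark
  have hpad : ∀ j, List.IsChain (Horiz M) (.pad :: (List.replicate j .pad ++
      (.mark true M.start :: W ++ .halt :: R))) := by
    intro j
    induction j with
    | zero => exact List.isChain_cons_cons.2 ⟨.pad_mark, hch⟩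
    | succ j ih => exact List.isChain_cons_cons.2 ⟨.pad_pad, ih⟩
  have hval := HelixSystem.valid_of_isChain (S := M.helixSystem B) (n := n) _ (hpad j)
  refine ⟨(Letter.init :: (List.replicate n Letter.inp ++ List.replicate (j + 1) Letter.pad) ++
      Letter.mark true M.start :: W).reverse, R.reverse,
    (Letter.mark true M.start :: W ++ Letter.halt :: R).reverse,
    (Letter.init :: (List.replicate n Letter.inp ++ List.replicate (j + 1) Letter.pad)).reverse,
    ?_, ?_, ?_, ?_⟩
  · have e : R.reverse ++ Letter.halt :: (Letter.init :: (List.replicate n Letter.inp ++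
        List.replicate (j + 1) Letter.pad) ++ Letter.mark true M.start :: W).reverse =
        (List.replicate j Letter.pad ++
          (Letter.mark true M.start :: W ++ Letter.halt :: R)).reverse ++
            Letter.pad :: (List.replicate n Letter.inp ++ [Letter.init]) := by
      simp [List.replicate_succ]
    exact e ▸ hval
  · change _ ++ Letter.halt :: _ = _
    simp
  · have := List.forall₂_reverse_iff.2 hV'
    change List.Forall₂ Vert (Letter.halt :: _) _
    simpa using this
  · simp only [List.length_reverse, List.length_cons, List.length_append, List.length_replicate]
    exact (by omega : n + j + 2 = n + (j + 1) + 1) ▸ hodd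

end Counter

/-- Some helix system over a finite alphabet has an undecidable existence problem for helices. -/
theorem exists_helixSystem_undecidable : ∃ (L : Type) (_ : Finite L) (S : HelixSystem L),
    ¬ ComputablePred S.Helix := by
  obtain ⟨Q, hQ, M, B, hB, hM, hund⟩ := Counter.exists_machine_undecidable
  obtain ⟨B, rfl⟩ : ∃ B', B = B' + 1 := ⟨B - 1, by omega⟩
  exact ⟨Counter.Letter Q B, inferInstance, M.helixSystem B, fun h => hund
    (h.of_eq fun n => ⟨Counter.halts_of_helix, Counter.helix_of_halts hM⟩)⟩

namespace ALC

/-! ### The TBoxes of a helix system -/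

/-- The elements of the template: `inb p` records whether a reading of a query in progress expects
a letter of colour `p`, `st` and `lab p` record which letters are present. -/
structure Tmpl : Type where
  inb : Bool → Bool
  st : Bool
  lab : Bool → Bool

instance : Finite Tmpl := by
  refine Finite.of_injective (fun ν : Tmpl => (ν.inb, ν.st, ν.lab)) ?_
  rintro ⟨a, b, c⟩ ⟨a', b', c'⟩ h
  simpa using h

/-- Which colours the readings that pass through a template element expect next. -/
def Tmpl.out (ν : Tmpl) (p : Bool) : Bool :=
  (!p && ν.st) || (ν.inb (!p) && ν.lab (!p))

/-- The concept names used by the reduction. `node c` holds at the nodes of the tree of words with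
last letter `c`, `color p` at those at depth of parity `p`; `label c p` are the names visible to
queries; `tmpl ν` holds at the copies of the template element `ν`. -/
inductive Name (L : Type) : Type where
  | root : Name L
  | node (c : L) : Name L
  | color (p : Bool) : Name L
  | label (c : L) (p : Bool) : Name L
  | tmpl (ν : Tmpl) : Name L

instance {L : Type} [Finite L] : Finite (Name L) := by
  let f : Name L → Unit ⊕ L ⊕ Bool ⊕ (L × Bool) ⊕ Tmpl := fun
    | .root => .inl ()
    | .node c => .inr (.inl c)
    | .color p => .inr (.inr (.inl p))
    | .label c p => .inr (.inr (.inr (.inl (c, p))))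
    | .tmpl ν => .inr (.inr (.inr (.inr ν)))
  refine Finite.of_injective f fun a b h => ?_
  cases a <;> cases b <;> simp_all [f]

/-- The inclusions `f a` for the elements `a` of a finite type with the property `P`. -/
noncomputable def axiomList {α : Type} [Finite α] (P : α → Prop) (f : α → CI) : TBox :=
  ((Set.toFinite {a | P a}).toFinset.toList).map f

@[simp]
theorem mem_axiomList {α : Type} [Finite α] {P : α → Prop} {f : α → CI} {x : CI} :
    x ∈ axiomList P f ↔ ∃ a, P a ∧ f a = x := by
  simp [axiomList]

/-- The element `ν` of the template carries the label `(c, p)`. The label `halt` is missing where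
it would complete a reading. -/
def Tmpl.Has {L : Type} (S : HelixSystem L) (ν : Tmpl) (c : L) (p : Bool) : Prop :=
  (c = S.halt → ν.inb p = false) ∧ (c = S.init → p = true → ν.st = true) ∧
    (c ≠ S.halt → ¬ (c = S.init ∧ p = true) → ν.lab p = true)

section

variable {L : Type} [Finite L] (S : HelixSystem L) (num : Name L → ℕ) (ρ : RoleName)

/-- The atomic concept with a given name. -/
abbrev at' (x : Name L) : Concept := .atom (num x)

/-- The TBox that generates the template below each element with the name `root`. -/
noncomputable def templateTBox : TBox :=
  axiomList (fun ν : Tmpl => ∀ p, ν.inb p = false)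
    (fun ν => (at' num .root, .ex ρ (at' num (.tmpl ν)))) ++
  axiomList (fun x : Tmpl × L × Bool => x.1.Has S x.2.1 x.2.2)
    (fun x => (at' num (.tmpl x.1), at' num (.label x.2.1 x.2.2))) ++
  axiomList (fun x : Tmpl × Tmpl => ∀ p, x.2.inb p = x.1.out p)
    (fun x => (at' num (.tmpl x.1), .ex 0 (at' num (.tmpl x.2))))

/-- The inclusions that make the names of the tree of words unsatisfiable. -/
noncomputable def emptyTBox : TBox :=
  axiomList (fun _ : L => True) (fun c => (at' num (.node c), .neg .top)) ++
  axiomList (fun _ : Bool => True) (fun p => (at' num (.color p), .neg .top))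

/-- The chain of `n` letters `inp` and a letter `pad`. -/
def chainConcept : ℕ → Concept
  | 0 => .ex 0 (at' num (.node S.pad))
  | n + 1 => .ex 0 (.inter (at' num (.node S.inp)) (chainConcept n))

/-- The TBox that generates the tree of words below each element with the name `root`. A node with
last letter `c` at depth of parity `p` has the label `(c, p)` and the labels `(b, !p)` for the
letters `b` that `c` may be above of. At `halt`, either this letter is a label, or the words
continue. -/
noncomputable def treeTBox : TBox :=
  [(at' num .root, .ex ρ (at' num (.node S.init))),
    (at' num (.node S.init), at' num (.color true))] ++
  axiomList (fun _ : Bool => True)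
    (fun p => (at' num (.color p), .neg (.ex 0 (.neg (at' num (.color (!p))))))) ++
  axiomList (fun x : L × Bool => x.1 ≠ S.halt)
    (fun x => (.inter (at' num (.node x.1)) (at' num (.color x.2)),
      at' num (.label x.1 x.2))) ++
  axiomList (fun x : L × L × Bool => S.V x.1 x.2.1)
    (fun x => (.inter (at' num (.node x.2.1)) (at' num (.color x.2.2)),
      at' num (.label x.1 (!x.2.2)))) ++
  axiomList (fun x : L × L => S.H x.1 x.2 ∧ x.1 ≠ S.halt)
    (fun x => (at' num (.node x.1), .ex 0 (at' num (.node x.2)))) ++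
  axiomList (fun x : L × Bool => S.H S.halt x.1)
    (fun x => (.inter (at' num (.node S.halt)) (at' num (.color x.2)),
      .neg (.inter (.neg (at' num (.label S.halt x.2)))
        (.neg (.ex 0 (at' num (.node x.1)))))))

/-- The Horn TBox of the reduction. -/
noncomputable def hornTBox : TBox := templateTBox S num ρ ++ emptyTBox num

/-- The `ALC` TBox of the reduction; only one inclusion depends on the input `n`. -/
noncomputable def alcTBox (n : ℕ) : TBox :=
  (at' num (.node S.init), chainConcept S num n) :: (templateTBox S num ρ ++ treeTBox S num ρ)

theorem isHornTBox_hornTBox : IsHornTBox (hornTBox S num ρ) := by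
  intro α hα
  simp only [hornTBox, templateTBox, emptyTBox, List.mem_append, mem_axiomList] at hα
  rcases hα with ((⟨_, _, rfl⟩ | ⟨_, _, rfl⟩) | ⟨_, _, rfl⟩) | (⟨_, _, rfl⟩ | ⟨_, _, rfl⟩) <;>
    simp [OccursInCI, Occurs]

/-- `I` satisfies the inclusions of `T`. -/
def Interp.Sat (I : Interp) (T : TBox) : Prop := ∀ α ∈ T, I.ext α.1 ⊆ I.ext α.2

theorem Interp.sat_append {I : Interp} {T T' : TBox} :
    I.Sat (T ++ T') ↔ I.Sat T ∧ I.Sat T' := by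
  simp only [Interp.Sat, List.mem_append, or_imp, forall_and]

theorem Interp.sat_cons {I : Interp} {α : CI} {T : TBox} :
    I.Sat (α :: T) ↔ I.ext α.1 ⊆ I.ext α.2 ∧ I.Sat T := by
  simp only [Interp.Sat, List.mem_cons, or_imp, forall_and, forall_eq]

theorem Interp.sat_axiomList {I : Interp} {α : Type} [Finite α] {P : α → Prop} {f : α → CI} :
    I.Sat (axiomList P f) ↔ ∀ a, P a → I.ext (f a).1 ⊆ I.ext (f a).2 := by
  simp [Interp.Sat]

/-- The extension of a name of the reduction. -/
abbrev Interp.At (I : Interp) (x : Name L) : Set I.Dom := I.conceptExt (num x)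

theorem Interp.sat_templateTBox {I : Interp} : I.Sat (templateTBox S num ρ) ↔
    (∀ ν : Tmpl, (∀ p, ν.inb p = false) → ∀ d ∈ I.At num .root,
      ∃ e, I.roleExt ρ d e ∧ e ∈ I.At num (.tmpl ν)) ∧
    (∀ (ν : Tmpl) c p, ν.Has S c p → ∀ d ∈ I.At num (.tmpl ν), d ∈ I.At num (.label c p)) ∧
    (∀ ν ν' : Tmpl, (∀ p, ν'.inb p = ν.out p) → ∀ d ∈ I.At num (.tmpl ν),
      ∃ e, I.roleExt 0 d e ∧ e ∈ I.At num (.tmpl ν')) := by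
  simp only [templateTBox, Interp.sat_append, Interp.sat_axiomList, Interp.ext, Prod.forall,
    Set.subset_def, Set.mem_ofPred_eq, and_assoc]

theorem Interp.sat_emptyTBox {I : Interp} : I.Sat (emptyTBox num) ↔
    (∀ c d, d ∉ I.At num (.node c)) ∧ ∀ p d, d ∉ I.At num (.color p) := by
  simp only [emptyTBox, Interp.sat_append, Interp.sat_axiomList, Interp.ext,
    Set.subset_def, Set.compl_univ, Set.mem_empty_iff_false, forall_true_left, imp_false]

theorem Interp.sat_treeTBox {I : Interp} : I.Sat (treeTBox S num ρ) ↔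
    (∀ d ∈ I.At num .root, ∃ e, I.roleExt ρ d e ∧ e ∈ I.At num (.node S.init)) ∧
    (∀ d ∈ I.At num (.node S.init), d ∈ I.At num (.color true)) ∧
    (∀ p, ∀ d ∈ I.At num (.color p), ∀ e, I.roleExt 0 d e → e ∈ I.At num (.color (!p))) ∧
    (∀ c p, c ≠ S.halt → ∀ d ∈ I.At num (.node c), d ∈ I.At num (.color p) →
      d ∈ I.At num (.label c p)) ∧
    (∀ b c p, S.V b c → ∀ d ∈ I.At num (.node c), d ∈ I.At num (.color p) →
      d ∈ I.At num (.label b (!p))) ∧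
    (∀ b c, S.H b c → b ≠ S.halt → ∀ d ∈ I.At num (.node b),
      ∃ e, I.roleExt 0 d e ∧ e ∈ I.At num (.node c)) ∧
    (∀ c p, S.H S.halt c → ∀ d ∈ I.At num (.node S.halt), d ∈ I.At num (.color p) →
      d ∈ I.At num (.label S.halt p) ∨ ∃ e, I.roleExt 0 d e ∧ e ∈ I.At num (.node c)) := by
  have hnil : I.Sat [] ↔ True := by simp [Interp.Sat]
  simp only [treeTBox, Interp.sat_append, Interp.sat_cons, Interp.sat_axiomList, Prod.forall,
    and_assoc, hnil, true_and, forall_true_left]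
  refine and_congr Iff.rfl (and_congr Iff.rfl (and_congr ?_ (and_congr ?_ (and_congr ?_
    (and_congr ?_ ?_)))))
  · refine forall_congr' fun p => forall_congr' fun d => imp_congr Iff.rfl ?_
    simp only [Interp.ext, Set.mem_compl_iff, Set.mem_ofPred_eq, not_exists, not_and, not_not]
  · exact forall₃_congr fun c p _ => forall_congr' fun d => and_imp
  · exact forall₄_congr fun b c p _ => forall_congr' fun d => and_imp
  · refine forall₂_congr fun b c => and_imp
  · refine forall₃_congr fun c p _ => forall_congr' fun d => and_imp.trans ?_
    refine imp_congr Iff.rfl (imp_congr Iff.rfl ?_)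
    simp only [Interp.ext, Set.mem_compl_iff, Set.mem_inter_iff, Set.mem_ofPred_eq, not_and,
      not_not]
    tauto

end

end ALC

namespace ALC

/-! ### Attaching the trees of words to a model of the Horn TBox -/

variable {L : Type} {S : HelixSystem L} {num : Name L → ℕ} {ρ : RoleName}

/-- The names of a node `u` of a tree of words, where the words continue after `halt` exactly at
the nodes in `σ`. -/
def TreeHas (S : HelixSystem L) (σ : Set (List L)) (u : List L) : Name L → Prop
  | .root => False
  | .node c => u.head? = some c
  | .color p => u.length.bodd = p
  | .label c p => (u.length.bodd = p ∧ u.head? = some c ∧ (c = S.halt → u ∉ σ)) ∨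
      (u.length.bodd = !p ∧ ∃ c', u.head? = some c' ∧ S.V c c')
  | .tmpl _ => False

/-- The interpretation that consists of `J` and, for each element `d` of `J` with the name `root`,
of a tree of words `(d, u)`, whose root is a `ρ`-successor of `d`. The remaining pairs in the domain
are isolated and have no names. -/
def treeInterp (S : HelixSystem L) (num : Name L → ℕ) (ρ : RoleName) (J : Interp) (n : ℕ)
    (σ : Set (List L)) : Interp where
  Dom := J.Dom ⊕ (J.Dom × List L)
  ind a := .inl (J.ind a)
  ind_injective _ _ h := J.ind_injective (Sum.inl_injective h)
  conceptExt k := {x | match x with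
    | .inl d => d ∈ J.conceptExt k
    | .inr (d, u) => (d ∈ J.At num .root ∧ S.Valid n σ u) ∧ ∃ x, num x = k ∧ TreeHas S σ u x}
  roleExt R x y := match x, y with
    | .inl d, .inl e => J.roleExt R d e
    | .inl d, .inr (d', u) => R = ρ ∧ d' = d ∧ u = [S.init] ∧ d ∈ J.At num .root
    | .inr (d, u), .inr (d', u') => R = 0 ∧ d' = d ∧ (d ∈ J.At num .root ∧ S.Valid n σ u') ∧
        u ≠ [] ∧ ∃ c, u' = c :: u
    | .inr _, .inl _ => False

variable {J : Interp} {n : ℕ} {σ : Set (List L)}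

theorem inr_mem_treeInterp (hnum : Function.Injective num) {x : Name L} {d : J.Dom} {u : List L} :
    (Sum.inr (d, u) : (treeInterp S num ρ J n σ).Dom) ∈ (treeInterp S num ρ J n σ).At num x ↔
      (d ∈ J.At num .root ∧ S.Valid n σ u) ∧ TreeHas S σ u x := by
  refine and_congr Iff.rfl ⟨?_, fun h => ⟨x, rfl, h⟩⟩
  rintro ⟨y, hy, h⟩
  exact hnum hy ▸ h

theorem inr_roleExt_inr {d : J.Dom} {u : List L} {c : L} (hd : d ∈ J.At num .root)
    (hu : S.Valid n σ (c :: u)) (hne : u ≠ []) :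
    (treeInterp S num ρ J n σ).roleExt 0 (.inr (d, u)) (.inr (d, c :: u)) :=
  ⟨rfl, rfl, ⟨hd, hu⟩, hne, c, rfl⟩

theorem mem_chainConcept (hnum : Function.Injective num) {d : J.Dom} (hd : d ∈ J.At num .root)
    (m : ℕ) : ∀ k, k + m = n →
    (Sum.inr (d, List.replicate k S.inp ++ [S.init]) : (treeInterp S num ρ J n σ).Dom) ∈
      (treeInterp S num ρ J n σ).ext (chainConcept S num m) := by
  have hhead : ∀ k, (List.replicate k S.inp ++ [S.init]).head? = some S.halt →
      List.replicate k S.inp ++ [S.init] ∈ σ := by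
    intro k h
    cases k with
    | zero => exact absurd (by simpa using h) S.init_ne_halt
    | succ k => exact absurd (by simpa [List.replicate_succ] using h) S.inp_ne_halt
  have hval : ∀ k ≤ n, S.Valid n σ (List.replicate k S.inp ++ [S.init]) := by
    intro k
    induction k with
    | zero => intro _; exact .init
    | succ k ih => intro hk; exact .step (ih (by omega)) (.inp hk) (hhead k)
  induction m with
  | zero =>
    rintro k rfl
    have hv := HelixSystem.Valid.step (hval k le_rfl) .pad (hhead k)
    exact ⟨.inr (d, S.pad :: (List.replicate k S.inp ++ [S.init])),
      inr_roleExt_inr hd hv (by simp), (inr_mem_treeInterp hnum).2 ⟨⟨hd, hv⟩, rfl⟩⟩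
  | succ m ih =>
    rintro k rfl
    have hv := hval (k + 1) (by omega)
    exact ⟨.inr (d, List.replicate (k + 1) S.inp ++ [S.init]),
      inr_roleExt_inr hd hv (by simp), (inr_mem_treeInterp hnum).2 ⟨⟨hd, hv⟩, rfl⟩,
      ih (k + 1) (by omega)⟩

variable [Finite L]

theorem sat_alcTBox_treeInterp (hnum : Function.Injective num)
    (hJ : J.Sat (hornTBox S num ρ)) : (treeInterp S num ρ J n σ).Sat (alcTBox S num ρ n) := by
  rw [hornTBox, Interp.sat_append, Interp.sat_templateTBox, Interp.sat_emptyTBox] at hJ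
  obtain ⟨⟨h₁, h₂, h₃⟩, h₄, h₅⟩ := hJ
  rw [alcTBox, Interp.sat_cons, Interp.sat_append, Interp.sat_templateTBox, Interp.sat_treeTBox]
  refine ⟨?_, ⟨?_, ?_, ?_⟩, ?_, ?_, ?_, ?_, ?_, ?_, ?_⟩
  · rintro (d | ⟨d, u⟩) hd
    · exact absurd hd (h₄ _ _)
    · obtain ⟨⟨hr, hu⟩, h⟩ := (inr_mem_treeInterp hnum).1 hd
      obtain ⟨v, rfl⟩ : ∃ v, u = S.init :: v := by
        cases u with
        | nil => cases h
        | cons c u => exact ⟨u, by cases h; rfl⟩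
      obtain rfl := hu.eq_nil_of_init (v := []) rfl
      exact mem_chainConcept hnum hr n 0 (by omega)
  · rintro ν hν (d | ⟨d, u⟩) hd
    · obtain ⟨e, he, he'⟩ := h₁ ν hν d hd
      exact ⟨.inl e, he, he'⟩
    · exact ((inr_mem_treeInterp hnum).1 hd).2.elim
  · rintro ν c p hν (d | ⟨d, u⟩) hd
    · exact h₂ ν c p hν d hd
    · exact ((inr_mem_treeInterp hnum).1 hd).2.elim
  · rintro ν ν' hν (d | ⟨d, u⟩) hd
    · obtain ⟨e, he, he'⟩ := h₃ ν ν' hν d hd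
      exact ⟨.inl e, he, he'⟩
    · exact ((inr_mem_treeInterp hnum).1 hd).2.elim
  · rintro (d | ⟨d, u⟩) hd
    · exact ⟨.inr (d, [S.init]), ⟨rfl, rfl, rfl, hd⟩,
        (inr_mem_treeInterp hnum).2 ⟨⟨hd, .init⟩, rfl⟩⟩
    · exact ((inr_mem_treeInterp hnum).1 hd).2.elim
  · rintro (d | ⟨d, u⟩) hd
    · exact absurd hd (h₄ _ _)
    · obtain ⟨⟨hr, hu⟩, h⟩ := (inr_mem_treeInterp hnum).1 hd
      refine (inr_mem_treeInterp hnum).2 ⟨⟨hr, hu⟩, ?_⟩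
      obtain ⟨v, rfl⟩ : ∃ v, u = S.init :: v := by
        cases u with
        | nil => cases h
        | cons c u => exact ⟨u, by cases h; rfl⟩
      obtain rfl := hu.eq_nil_of_init (v := []) rfl
      simp [TreeHas]
  · rintro p (d | ⟨d, u⟩) hd (e | ⟨e, v⟩) he
    · exact absurd hd (h₅ _ _)
    · exact absurd hd (h₅ _ _)
    · exact he.elim
    · obtain ⟨-, rfl, hv, -, c, rfl⟩ := he
      obtain ⟨_, h⟩ := (inr_mem_treeInterp hnum).1 hd
      refine (inr_mem_treeInterp hnum).2 ⟨hv, ?_⟩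
      obtain rfl : u.length.bodd = p := h
      exact Nat.bodd_succ _
  · rintro c p hc (d | ⟨d, u⟩) hd hp
    · exact absurd hd (h₄ _ _)
    · obtain ⟨hu, h⟩ := (inr_mem_treeInterp hnum).1 hd
      exact (inr_mem_treeInterp hnum).2
        ⟨hu, .inl ⟨((inr_mem_treeInterp hnum).1 hp).2, h, fun h => absurd h hc⟩⟩
  · rintro b c p hbc (d | ⟨d, u⟩) hd hp
    · exact absurd hd (h₄ _ _)
    · obtain ⟨hu, h⟩ := (inr_mem_treeInterp hnum).1 hd
      refine (inr_mem_treeInterp hnum).2 ⟨hu, .inr ⟨?_, c, h, hbc⟩⟩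
      rw [Bool.not_not]
      exact ((inr_mem_treeInterp hnum).1 hp).2
  · rintro b c hbc hb (d | ⟨d, u⟩) hd
    · exact absurd hd (h₄ _ _)
    · obtain ⟨⟨hr, hu⟩, h⟩ := (inr_mem_treeInterp hnum).1 hd
      obtain ⟨v, rfl⟩ : ∃ v, u = b :: v := by
        cases u with
        | nil => cases h
        | cons c u => exact ⟨u, by cases h; rfl⟩
      have hv : S.Valid n σ (c :: b :: v) := .step hu (.H _ hbc) fun h' =>
        absurd (by simpa using h') hb
      exact ⟨.inr (d, c :: b :: v), inr_roleExt_inr hr hv (by simp),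
        (inr_mem_treeInterp hnum).2 ⟨⟨hr, hv⟩, rfl⟩⟩
  · rintro c p hc (d | ⟨d, u⟩) hd hp
    · exact absurd hd (h₄ _ _)
    · obtain ⟨⟨hr, hu⟩, h⟩ := (inr_mem_treeInterp hnum).1 hd
      by_cases hσ : u ∈ σ
      · obtain ⟨v, rfl⟩ : ∃ v, u = S.halt :: v := by
          cases u with
          | nil => cases h
          | cons c u => exact ⟨u, by cases h; rfl⟩
        have hv : S.Valid n σ (c :: S.halt :: v) := .step hu (.H _ hc) fun _ => hσ
        exact .inr ⟨.inr (d, c :: S.halt :: v), inr_roleExt_inr hr hv (by simp),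
          (inr_mem_treeInterp hnum).2 ⟨⟨hr, hv⟩, rfl⟩⟩
      · exact .inl ((inr_mem_treeInterp hnum).2
          ⟨⟨hr, hu⟩, .inl ⟨((inr_mem_treeInterp hnum).1 hp).2, h, fun _ => hσ⟩⟩)

theorem isModel_treeInterp (hnum : Function.Injective num) {A : ABox}
    (hJ : J.IsModel ⟨hornTBox S num ρ, A⟩) :
    (treeInterp S num ρ J n σ).IsModel ⟨alcTBox S num ρ n, A⟩ := by
  refine ⟨sat_alcTBox_treeInterp hnum hJ.1, fun α hα => ?_⟩
  have := hJ.2 α hα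
  cases α <;> exact this

end ALC

namespace ALC

/-! ### Readings of a query -/

variable {L : Type} {S : HelixSystem L} {num : Name L → ℕ} {ρ : RoleName} {J : Interp} {n : ℕ}

/-- A part `Off` of `J` that is treated like the trees of words: it is closed under successors,
predecessors of its elements are unique, and each element `e` is a copy of the template element
`β e`. -/
structure OffPart (S : HelixSystem L) (num : Name L → ℕ) (J : Interp) where
  Off : Set J.Dom
  β : J.Dom → Tmpl
  pred_unique : ∀ {d d' e}, e ∈ Off → J.roleExt 0 d e → J.roleExt 0 d' e → d = d'
  succ_mem : ∀ {d e}, d ∈ Off → J.roleExt 0 d e → e ∈ Off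
  has : ∀ {e c p}, e ∈ Off → e ∈ J.At num (.label c p) → (β e).Has S c p
  inb : ∀ {d e}, d ∈ Off → J.roleExt 0 d e → (β e).inb = (β d).out
  not_root : ∀ {d}, d ∈ Off → d ∉ J.At num .root

/-- The part `Off` together with the trees of words. -/
def OffPart.Ext (O : OffPart S num J) : J.Dom ⊕ (J.Dom × List L) → Prop
  | .inl d => d ∈ O.Off
  | .inr _ => True

theorem OffPart.ext_succ (O : OffPart S num J) {σ : Set (List L)}
    {x y : J.Dom ⊕ (J.Dom × List L)} (hx : O.Ext x)
    (h : (treeInterp S num ρ J n σ).roleExt 0 x y) : O.Ext y := by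
  rcases x with d | ⟨d, u⟩ <;> rcases y with e | ⟨e, v⟩
  · exact O.succ_mem hx h
  · trivial
  · exact h.elim
  · trivial

theorem OffPart.ext_pred_unique (O : OffPart S num J) {σ : Set (List L)}
    {x x' y : J.Dom ⊕ (J.Dom × List L)} (hy : O.Ext y)
    (h : (treeInterp S num ρ J n σ).roleExt 0 x y)
    (h' : (treeInterp S num ρ J n σ).roleExt 0 x' y) : x = x' := by
  rcases x with d | ⟨d, u⟩ <;> rcases x' with d' | ⟨d', u'⟩ <;> rcases y with e | ⟨e, v⟩
  · exact congrArg _ (O.pred_unique hy h h')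
  · obtain ⟨-, rfl, -⟩ := h
    obtain ⟨-, rfl, -⟩ := h'
    rfl
  · exact h'.elim
  · obtain ⟨-, -, rfl, -⟩ := h
    obtain ⟨-, -, -, hne, c, hc⟩ := h'
    simp only [List.cons.injEq] at hc
    exact absurd hc.2.symm hne
  · exact h.elim
  · obtain ⟨-, -, rfl, -⟩ := h'
    obtain ⟨-, -, -, hne, c, hc⟩ := h
    simp only [List.cons.injEq] at hc
    exact absurd hc.2.symm hne
  · exact h.elim
  · obtain ⟨-, rfl, -, -, c, rfl⟩ := h
    obtain ⟨-, rfl, -, -, c', hc⟩ := h'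
    simp only [List.cons.injEq] at hc
    rw [hc.2]

/-- The homomorphisms from the atoms of a query to the interpretations `treeInterp S num ρ J n σ`,
for all `σ`, that are taken into account. -/
structure HomSystem (S : HelixSystem L) (num : Name L → ℕ) (ρ : RoleName) (J : Interp) (n : ℕ)
    (V : Type) where
  atoms : List (Atom V)
  hom : Set (List L) → Set (V → J.Dom ⊕ (J.Dom × List L))
  holds : ∀ σ, ∀ h ∈ hom σ, ∀ α ∈ atoms, α.Holds (treeInterp S num ρ J n σ) h
  nonempty : ∀ σ, (hom σ).Nonempty

namespace HomSystem

variable {V : Type} (Φ : HomSystem S num ρ J n V) (O : OffPart S num J)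

/-- A fixed homomorphism, for `σ = ∅`. -/
noncomputable def base : V → J.Dom ⊕ (J.Dom × List L) := (Φ.nonempty ∅).some

theorem base_mem : Φ.base ∈ Φ.hom ∅ := (Φ.nonempty ∅).some_mem

/-- Deep variables: all homomorphisms map them to the trees of words or to `Off`. -/
def Deep (z : V) : Prop := ∀ σ, ∀ h ∈ Φ.hom σ, O.Ext (h z)

/-- Variables with the same values; for deep variables all homomorphisms are compared. -/
def Same (z z' : V) : Prop :=
  Φ.base z = Φ.base z' ∧ (Φ.Deep O z ∨ Φ.Deep O z' → ∀ σ, ∀ h ∈ Φ.hom σ, h z = h z')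

/-- The query has a label at a variable, up to `Same`. -/
def Lab (z : V) (c : L) (p : Bool) : Prop :=
  ∃ z', Φ.Same O z z' ∧ Atom.concept (num (.label c p)) z' ∈ Φ.atoms

/-- The query has an edge between two variables, up to `Same`. -/
def Suc (y z : V) : Prop :=
  ∃ y' z', Φ.Same O y y' ∧ Φ.Same O z z' ∧ Atom.role 0 y' z' ∈ Φ.atoms

/-- `Reads z w`: the word `w` (given in reverse) can be read off a path of deep variables that ends
in `z`. -/
inductive Reads : V → List L → Prop
  | start {z : V} (hz : Φ.Deep O z) (h : Φ.Lab O z S.init true) : Reads z [S.init]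
  | step {y z : V} {w : List L} {c : L} (hy : Reads y w) (hz : Φ.Deep O z) (hyz : Φ.Suc O y z)
      (h : Φ.Lab O z c (!w.length.bodd)) (hc : ¬ (c = S.init ∧ (!w.length.bodd) = true)) :
      Reads z (c :: w)

variable {Φ O}

theorem Same.refl (z : V) : Φ.Same O z z := ⟨rfl, fun _ _ _ _ => rfl⟩

theorem Same.symm {z z' : V} (h : Φ.Same O z z') : Φ.Same O z' z :=
  ⟨h.1.symm, fun h' σ f hf => (h.2 h'.symm σ f hf).symm⟩

theorem Same.deep {z z' : V} (h : Φ.Same O z z') (hz : Φ.Deep O z) : Φ.Deep O z' :=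
  fun σ f hf => h.2 (.inl hz) σ f hf ▸ hz σ f hf

theorem Same.deep_iff {z z' : V} (h : Φ.Same O z z') : Φ.Deep O z ↔ Φ.Deep O z' :=
  ⟨h.deep, h.symm.deep⟩

theorem Same.trans {z z' z'' : V} (h : Φ.Same O z z') (h' : Φ.Same O z' z'') :
    Φ.Same O z z'' := by
  refine ⟨h.1.trans h'.1, fun hd σ f hf => ?_⟩
  have hd' : Φ.Deep O z' := hd.elim h.deep h'.symm.deep
  exact (h.2 (.inr hd') σ f hf).trans (h'.2 (.inl hd') σ f hf)

theorem Same.lab_iff {z z' : V} (h : Φ.Same O z z') {c : L} {p : Bool} :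
    Φ.Lab O z c p ↔ Φ.Lab O z' c p :=
  exists_congr fun _ => and_congr_left fun _ => ⟨h.symm.trans, h.trans⟩

theorem Same.suc_right_iff {y z z' : V} (h : Φ.Same O z z') : Φ.Suc O y z ↔ Φ.Suc O y z' :=
  exists₂_congr fun _ _ => and_congr_right fun _ => and_congr_left fun _ =>
    ⟨h.symm.trans, h.trans⟩

theorem Suc.of_mem {y z : V} (h : Atom.role 0 y z ∈ Φ.atoms) : Φ.Suc O y z :=
  ⟨y, z, .refl y, .refl z, h⟩

theorem Lab.of_mem {z : V} {c : L} {p : Bool}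
    (h : Atom.concept (num (.label c p)) z ∈ Φ.atoms) : Φ.Lab O z c p := ⟨z, .refl z, h⟩

theorem Reads.deep {z : V} {w : List L} (h : Φ.Reads O z w) : Φ.Deep O z := by
  cases h <;> assumption

theorem Suc.deep {y z : V} (h : Φ.Suc O y z) (hy : Φ.Deep O y) : Φ.Deep O z := by
  obtain ⟨y', z', h₁, h₂, h⟩ := h
  exact h₂.symm.deep fun σ f hf => O.ext_succ (h₁.deep hy σ f hf) (Φ.holds σ f hf _ h)

theorem Same.reads {z z' : V} {w : List L} (h : Φ.Same O z z') (hz : Φ.Reads O z w) :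
    Φ.Reads O z' w := by
  cases hz with
  | start hz h' => exact .start (h.deep hz) (h.lab_iff.1 h')
  | step hy hz hyz h' hc => exact .step hy (h.deep hz) (h.suc_right_iff.1 hyz) (h.lab_iff.1 h') hc

theorem Suc.base_roleExt {y z : V} (h : Φ.Suc O y z) :
    (treeInterp S num ρ J n ∅).roleExt 0 (Φ.base y) (Φ.base z) := by
  obtain ⟨y', z', h₁, h₂, h⟩ := h
  rw [h₁.1, h₂.1]
  exact Φ.holds _ _ Φ.base_mem _ h

theorem Suc.roleExt {y z : V} (h : Φ.Suc O y z) (hy : Φ.Deep O y) {σ : Set (List L)}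
    {f : V → J.Dom ⊕ (J.Dom × List L)} (hf : f ∈ Φ.hom σ) :
    (treeInterp S num ρ J n σ).roleExt 0 (f y) (f z) := by
  have hz := h.deep hy
  obtain ⟨y', z', h₁, h₂, h⟩ := h
  rw [h₁.2 (.inl hy) σ f hf, h₂.2 (.inl hz) σ f hf]
  exact Φ.holds _ _ hf _ h

theorem Lab.mem {z : V} {c : L} {p : Bool} (h : Φ.Lab O z c p) (hz : Φ.Deep O z)
    {σ : Set (List L)} {f : V → J.Dom ⊕ (J.Dom × List L)} (hf : f ∈ Φ.hom σ) :
    (f z : (treeInterp S num ρ J n σ).Dom) ∈ (treeInterp S num ρ J n σ).At num (.label c p) := by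
  obtain ⟨z', h₁, h⟩ := h
  rw [h₁.2 (.inl hz) σ f hf]
  exact Φ.holds _ _ hf _ h

/-- Predecessors are unique up to `Same`. -/
theorem Suc.same {y y' z : V} (h : Φ.Suc O y z) (h' : Φ.Suc O y' z) (hz : O.Ext (Φ.base z)) :
    Φ.Same O y y' := by
  refine ⟨O.ext_pred_unique hz h.base_roleExt h'.base_roleExt, fun hd σ f hf => ?_⟩
  have key : ∀ {y y' : V}, Φ.Suc O y z → Φ.Suc O y' z → Φ.Deep O y → f y = f y' := by
    rintro y y' h ⟨y₁, z₁, h₁, h₂, h'⟩ hd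
    have hz := h.deep hd
    have hy : f y = f y₁ := by
      refine O.ext_pred_unique (hz σ f hf) (h.roleExt hd hf) ?_
      rw [h₂.2 (.inl hz) σ f hf]
      exact Φ.holds _ _ hf _ h'
    by_cases hd' : Φ.Deep O y'
    · rw [hy, h₁.2 (.inl hd') σ f hf]
    · refine absurd ?_ hd'
      refine h₁.symm.deep fun τ k hk => ?_
      have : k y = k y₁ := by
        refine O.ext_pred_unique (hz τ k hk) (h.roleExt hd hk) ?_
        rw [h₂.2 (.inl hz) τ k hk]
        exact Φ.holds _ _ hk _ h'
      exact this ▸ hd τ k hk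
  rcases hd with hd | hd
  · exact key h h' hd
  · exact (key h' h hd).symm

/-- In a tree of words, a word that is read off the query either is the word of the node, or it is
shifted by one row. -/
theorem Reads.tree (hnum : Function.Injective num) {z : V} {w : List L} (h : Φ.Reads O z w)
    {σ : Set (List L)} {f : V → J.Dom ⊕ (J.Dom × List L)} (hf : f ∈ Φ.hom σ) :
    ∀ {d : J.Dom} {u : List L}, f z = .inr (d, u) → S.Valid n σ u ∧
      ((u = w ∧ (w.head? = some S.halt → u ∉ σ)) ∨
        (u.length.bodd = !w.length.bodd ∧ ∃ u₁ u₂, u = u₁ ++ u₂ ∧ List.Forall₂ S.V w u₁)) := by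
  induction h with
  | @start z hz h =>
    intro d u he
    have h := h.mem hz hf
    rw [he] at h
    obtain ⟨⟨-, hu⟩, h⟩ := (inr_mem_treeInterp hnum).1 h
    refine ⟨hu, ?_⟩
    rcases h with ⟨-, h, -⟩ | ⟨hp, c, h, hV⟩
    · left
      obtain ⟨v, rfl⟩ := List.head?_eq_some_iff.1 h
      obtain rfl := hu.eq_nil_of_init (v := []) rfl
      exact ⟨rfl, fun h' => absurd (by simpa using h') S.init_ne_halt⟩
    · right
      obtain ⟨v, rfl⟩ := List.head?_eq_some_iff.1 h
      exact ⟨by simpa using hp, [c], v, rfl, .cons hV .nil⟩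
  | @step y z w c hy hz hyz h hc ih =>
    intro d u he
    have h := h.mem hz hf
    have hr := hyz.roleExt hy.deep hf
    have hE := hy.deep σ f hf
    rw [he] at h hr
    obtain ⟨⟨-, hu⟩, h⟩ := (inr_mem_treeInterp hnum).1 h
    refine ⟨hu, ?_⟩
    generalize hfy : f y = x at hr hE
    rcases x with e | ⟨e, u'⟩
    · exact absurd hr.2.2.2 (O.not_root hE)
    · obtain ⟨-, rfl, -, -, c', rfl⟩ := hr
      rcases (ih hfy).2 with ⟨rfl, -⟩ | ⟨hp, u₁, u₂, rfl, hV⟩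
      · left
        rcases h with ⟨-, h, hσ⟩ | ⟨hp, -⟩
        · simp only [List.head?_cons, Option.some.injEq] at h
          subst h
          exact ⟨rfl, fun h => hσ (by simpa using h)⟩
        · simp at hp
      · right
        refine ⟨by simp only [List.length_cons, Nat.bodd_succ]; rw [hp], ?_⟩
        rcases h with ⟨hp', -⟩ | ⟨-, c'', h, hV'⟩
        · simp only [List.length_cons, Nat.bodd_succ] at hp'
          rw [hp] at hp'
          simp at hp'
        · simp only [List.head?_cons, Option.some.injEq] at h
          subst h
          exact ⟨c' :: u₁, u₂, rfl, .cons hV' hV⟩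

/-- In `Off`, a word that is read off the query is recorded by the template elements, and it does
not end in `halt`. -/
theorem Reads.off {z : V} {w : List L} (h : Φ.Reads O z w)
    {σ : Set (List L)} {f : V → J.Dom ⊕ (J.Dom × List L)} (hf : f ∈ Φ.hom σ) :
    ∀ {e : J.Dom}, f z = .inl e →
      (O.β e).out (!w.length.bodd) = true ∧ w.head? ≠ some S.halt := by
  induction h with
  | @start z hz h =>
    intro e he
    have h := h.mem hz hf
    have hE := hz σ f hf
    rw [he] at h hE
    have := (O.has hE h).2.1 rfl rfl
    exact ⟨by simp [Tmpl.out, this], by simpa using S.init_ne_halt⟩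
  | @step y z w c hy hz hyz h hc ih =>
    intro e he
    have h := h.mem hz hf
    have hE := hz σ f hf
    have hr := hyz.roleExt hy.deep hf
    have hE' := hy.deep σ f hf
    rw [he] at h hE hr
    generalize hfy : f y = x at hr hE'
    rcases x with d | ⟨d, u⟩
    · have hin : (O.β e).inb (!w.length.bodd) = true := by
        rw [O.inb hE' hr]
        exact (ih hfy).1
      have hh := O.has hE h
      have hc' : c ≠ S.halt := by
        intro hc'
        have := hh.1 hc'
        rw [hin] at this
        exact absurd this (by simp)
      refine ⟨?_, by simpa using hc'⟩
      have := hh.2.2 hc' hc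
      simp only [Tmpl.out, List.length_cons, Nat.bodd_succ, Bool.not_not] at this ⊢
      simp [hin, this]
    · exact hr.elim

/-- A reading that is completed at `halt` gives a helix, by the homomorphism to the trees in which
the words continue only after the word that was read. -/
theorem not_reads_halt (hnum : Function.Injective num) (hn : ¬ S.Helix n) {z : V} {w : List L} :
    ¬ Φ.Reads O z (S.halt :: w) := by
  intro h
  obtain ⟨f, hf⟩ := Φ.nonempty {S.halt :: w}
  generalize hfz : f z = x
  rcases x with e | ⟨d, u⟩
  · exact (h.off hf hfz).2 rfl
  · obtain ⟨hu, ⟨rfl, hσ⟩ | ⟨hp, u₁, u₂, rfl, hV⟩⟩ := h.tree hnum hf hfz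
    · exact hσ rfl rfl
    · have hlen := hV.length_eq
      cases hV with
      | @cons _ c _ u₁ hc hV =>
        obtain ⟨r, w', he, hw⟩ := hu.exists_of_post rfl (S.post_of_V_halt _ hc)
        rw [Set.mem_singleton_iff] at hw
        rw [hw] at he
        refine hn ⟨w, r, c :: u₁, u₂, he ▸ hu.mono (Set.subset_univ _), he.symm,
          .cons hc hV, ?_⟩
        rw [List.length_append, ← hlen, Nat.bodd_add] at hp
        have hodd : u₂.length.bodd = true := by
          revert hp
          generalize (S.halt :: w).length.bodd = a
          generalize u₂.length.bodd = b
          revert a b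
          decide
        rw [Nat.odd_iff, Nat.mod_two_of_bodd, hodd]
        rfl

end HomSystem

end ALC

namespace ALC

/-! ### Mapping a query to the template -/

variable {L : Type} {S : HelixSystem L} {num : Name L → ℕ} {ρ : RoleName} {J : Interp} {n : ℕ}

instance (I : Interp) : Nonempty I.Dom := ⟨I.ind 0⟩

namespace HomSystem

variable {V : Type} (Φ : HomSystem S num ρ J n V) (O : OffPart S num J)

open Classical in
/-- The template element that a variable is mapped to: it records the readings that arrive at the
variable and the labels of the variable. -/
noncomputable def bits (z : V) : Tmpl where
  inb p := decide (∃ y w, Φ.Reads O y w ∧ Φ.Suc O y z ∧ (!w.length.bodd) = p)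
  st := decide (Φ.Deep O z ∧ Φ.Lab O z S.init true)
  lab p := decide (Φ.Deep O z ∧ ∃ c, c ≠ S.halt ∧ ¬ (c = S.init ∧ p = true) ∧ Φ.Lab O z c p)

variable {Φ O}

theorem bits_has (hnum : Function.Injective num) (hn : ¬ S.Helix n) {z : V} (hz : Φ.Deep O z)
    {c : L} {p : Bool} (h : Φ.Lab O z c p) : (Φ.bits O z).Has S c p := by
  refine ⟨?_, ?_, fun h₁ h₂ => ?_⟩
  · rintro rfl
    simp only [bits, decide_eq_false_iff_not]
    rintro ⟨y, w, hy, hyz, rfl⟩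
    exact not_reads_halt hnum hn (.step hy hz hyz h fun h' => S.init_ne_halt h'.1.symm)
  · rintro rfl rfl
    simpa only [bits, decide_eq_true_eq] using ⟨hz, h⟩
  · simpa only [bits, decide_eq_true_eq] using ⟨hz, c, h₁, h₂, h⟩

/-- A template element passes on the readings that end in its variable. -/
theorem out_bits (hnum : Function.Injective num) (hn : ¬ S.Helix n) {z : V} {p : Bool} :
    (Φ.bits O z).out p = true ↔ ∃ w, Φ.Reads O z w ∧ (!w.length.bodd) = p := by
  simp only [Tmpl.out, Bool.or_eq_true, Bool.and_eq_true, bits, decide_eq_true_eq]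
  constructor
  · rintro (⟨hp, hz, h⟩ | ⟨⟨y, w, hy, hyz, hw⟩, hz, c, hc, hc', h⟩)
    · refine ⟨_, .start hz h, ?_⟩
      cases p <;> simp_all
    · rw [← hw] at h hc'
      refine ⟨_, .step hy hz hyz h hc', ?_⟩
      rw [List.length_cons, Nat.bodd_succ, hw, Bool.not_not]
  · rintro ⟨w, hw, rfl⟩
    cases hw with
    | start hz h => exact .inl ⟨by simp, hz, h⟩
    | @step y _ w c hy hz hyz h hc =>
      simp only [List.length_cons, Nat.bodd_succ, Bool.not_not]
      refine .inr ⟨⟨y, w, hy, hyz, rfl⟩, hz, c, ?_, hc, h⟩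
      rintro rfl
      exact not_reads_halt hnum hn (.step hy hz hyz h hc)

theorem Same.bits {z z' : V} (h : Φ.Same O z z') : Φ.bits O z = Φ.bits O z' := by
  simp only [HomSystem.bits, Tmpl.mk.injEq, funext_iff, decide_eq_decide, h.suc_right_iff,
    h.deep_iff, h.lab_iff, implies_true, and_self]

/-- A set of variables that is to be mapped to the template. -/
structure Mappable (Φ : HomSystem S num ρ J n V) (O : OffPart S num J) (κ : V → Prop) : Prop where
  base_eq : ∀ z, κ z → ∃ d u, Φ.base z = .inr (d, u) ∧ d ∈ J.At num .root
  deep : ∀ z c p, Atom.concept (num (.label c p)) z ∈ Φ.atoms → κ z → Φ.Deep O z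
  same : ∀ z z', Φ.Same O z z' → κ z → κ z'
  pred : ∀ y z, Atom.role 0 y z ∈ Φ.atoms → κ z → κ y ∨ ∃ d, Φ.base y = .inl d

variable (Φ O)

open Classical in
/-- The map to the template, for variables that are mapped to depth `m`: a `ρ`-successor of an
element with the name `root`, or a successor of the value at a predecessor. -/
noncomputable def mapAt (κ : V → Prop) : ℕ → V → J.Dom
  | 0, z => epsilon fun e => ∃ d u, Φ.base z = .inr (d, u) ∧ J.roleExt ρ d e ∧
      e ∈ J.At num (.tmpl (Φ.bits O z))
  | m + 1, z =>
    if h : ∃ y, κ y ∧ Φ.Suc O y z then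
      epsilon fun e => J.roleExt 0 (mapAt κ m h.choose) e ∧ e ∈ J.At num (.tmpl (Φ.bits O z))
    else mapAt κ 0 z

/-- The depth in its tree of words of the value of a variable. -/
noncomputable def depth (z : V) : ℕ :=
  match Φ.base z with
  | .inl _ => 0
  | .inr (_, u) => u.length

/-- The map to the template. -/
noncomputable def map (κ : V → Prop) (z : V) : J.Dom := Φ.mapAt O κ (Φ.depth z) z

variable {Φ O} {κ : V → Prop}

theorem Mappable.depth_eq (hκ : Φ.Mappable O κ) {y z : V} (hy : κ y) (hz : κ z)
    (h : Φ.Suc O y z) : Φ.depth z = Φ.depth y + 1 := by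
  obtain ⟨d, u, hu, -⟩ := hκ.base_eq y hy
  obtain ⟨e, v, hv, -⟩ := hκ.base_eq z hz
  have := h.base_roleExt
  rw [hu, hv] at this
  obtain ⟨-, -, -, -, c, rfl⟩ := this
  simp [depth, hu, hv]

theorem Mappable.pred_of_reads (hκ : Φ.Mappable O κ) {y z : V} {w : List L} (hz : κ z)
    (hw : Φ.Reads O y w) (h : Φ.Suc O y z) : κ y := by
  have hd := hw.deep ∅ Φ.base Φ.base_mem
  have hr := h.base_roleExt
  obtain ⟨y', z', h₁, h₂, h⟩ := h
  rcases hκ.pred _ _ h (hκ.same _ _ h₂ hz) with hy | ⟨d, hy⟩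
  · exact hκ.same _ _ h₁.symm hy
  · obtain ⟨e, u, he, -⟩ := hκ.base_eq z hz
    rw [← h₁.1] at hy
    rw [hy] at hd hr
    rw [he] at hr
    exact absurd hr.2.2.2 (O.not_root hd)

variable [Finite L]

theorem Mappable.mapAt_zero (hκ : Φ.Mappable O κ)
    (hJ : J.Sat (hornTBox S num ρ)) {z : V} (hz : κ z) (hno : ¬ ∃ y, κ y ∧ Φ.Suc O y z) :
    ∃ d u, Φ.base z = .inr (d, u) ∧ J.roleExt ρ d (Φ.mapAt O κ 0 z) ∧
      Φ.mapAt O κ 0 z ∈ J.At num (.tmpl (Φ.bits O z)) := by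
  rw [hornTBox, Interp.sat_append, Interp.sat_templateTBox] at hJ
  obtain ⟨d, u, hu, hr⟩ := hκ.base_eq z hz
  suffices h : ∃ e, ∃ d u, Φ.base z = .inr (d, u) ∧ J.roleExt ρ d e ∧
      e ∈ J.At num (.tmpl (Φ.bits O z)) by
    rw [mapAt]
    exact Classical.epsilon_spec h
  have hin : ∀ p, (Φ.bits O z).inb p = false := by
    intro p
    simp only [bits, decide_eq_false_iff_not]
    rintro ⟨y, w, hw, h, -⟩
    exact hno ⟨y, hκ.pred_of_reads hz hw h, h⟩
  obtain ⟨e, he⟩ := hJ.1.1 _ hin d hr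
  exact ⟨e, d, u, hu, he⟩

omit [Finite L] in
theorem Mappable.inb_bits (hκ : Φ.Mappable O κ) (hnum : Function.Injective num)
    (hn : ¬ S.Helix n) {y z : V} (hz : κ z) (h : Φ.Suc O y z) (p : Bool) :
    (Φ.bits O z).inb p = (Φ.bits O y).out p := by
  rw [Bool.eq_iff_iff, out_bits hnum hn]
  simp only [bits, decide_eq_true_eq]
  constructor
  · rintro ⟨y', w, hw, h', hp⟩
    obtain ⟨d, u, hu, -⟩ := hκ.base_eq z hz
    exact ⟨w, (h'.same h (hu ▸ trivial)).reads hw, hp⟩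
  · rintro ⟨w, hw, hp⟩
    exact ⟨y, w, hw, h, hp⟩

theorem Mappable.mapAt_spec (hκ : Φ.Mappable O κ) (hnum : Function.Injective num)
    (hn : ¬ S.Helix n) (hJ : J.Sat (hornTBox S num ρ)) (m : ℕ) : ∀ z, κ z → Φ.depth z = m →
    Φ.mapAt O κ m z ∈ J.At num (.tmpl (Φ.bits O z)) ∧
    (∀ h : ∃ y, κ y ∧ Φ.Suc O y z, J.roleExt 0 (Φ.map O κ h.choose) (Φ.mapAt O κ m z)) ∧
    ((¬ ∃ y, κ y ∧ Φ.Suc O y z) →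
      ∃ d u, Φ.base z = .inr (d, u) ∧ J.roleExt ρ d (Φ.mapAt O κ m z)) := by
  induction m with
  | zero =>
    intro z hz hm
    have hno : ¬ ∃ y, κ y ∧ Φ.Suc O y z := by
      rintro ⟨y, hy, h⟩
      have := hκ.depth_eq hy hz h
      omega
    obtain ⟨d, u, hu, h₁, h₂⟩ := hκ.mapAt_zero hJ hz hno
    exact ⟨h₂, fun h => absurd h hno, fun _ => ⟨d, u, hu, h₁⟩⟩
  | succ m ih =>
    intro z hz hm
    by_cases h : ∃ y, κ y ∧ Φ.Suc O y z
    · obtain ⟨hy, hyz⟩ := h.choose_spec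
      have hd := hκ.depth_eq hy hz hyz
      have hmy : Φ.depth h.choose = m := by omega
      have h₁ := (ih _ hy hmy).1
      rw [hornTBox, Interp.sat_append, Interp.sat_templateTBox] at hJ
      have h₂ := Classical.epsilon_spec
        (hJ.1.2.2 _ (Φ.bits O z) (hκ.inb_bits hnum hn hz hyz) _ h₁)
      rw [mapAt, dif_pos h]
      refine ⟨h₂.2, fun _ => ?_, fun h' => absurd h h'⟩
      rw [map, hmy]
      exact h₂.1
    · obtain ⟨d, u, hu, h₁, h₂⟩ := hκ.mapAt_zero hJ hz h
      rw [mapAt, dif_neg h]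
      exact ⟨h₂, fun h' => absurd h' h, fun _ => ⟨d, u, hu, h₁⟩⟩

omit [Finite L] in
theorem Same.map {z z' : V} (h : Φ.Same O z z') : Φ.map O κ z = Φ.map O κ z' := by
  have hd : Φ.depth z = Φ.depth z' := by rw [depth, depth, h.1]
  rw [HomSystem.map, HomSystem.map, hd]
  have h0 : Φ.mapAt O κ 0 z = Φ.mapAt O κ 0 z' := by rw [mapAt, mapAt, h.1, h.bits]
  cases Φ.depth z' with
  | zero => exact h0
  | succ m =>
    have : (fun y => κ y ∧ Φ.Suc O y z) = fun y => κ y ∧ Φ.Suc O y z' := by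
      funext y
      rw [h.suc_right_iff]
    have key : ∀ P : V → Prop, P = (fun y => κ y ∧ Φ.Suc O y z') → (open Classical in
        (if h : ∃ y, P y then epsilon fun e => J.roleExt 0 (Φ.mapAt O κ m h.choose) e ∧
          e ∈ J.At num (.tmpl (Φ.bits O z')) else Φ.mapAt O κ 0 z')) =
        Φ.mapAt O κ (m + 1) z' := by
      rintro _ rfl
      simp only [mapAt]
    rw [mapAt, h0, h.bits]
    exact key _ this

theorem Mappable.map_label (hκ : Φ.Mappable O κ) (hnum : Function.Injective num)
    (hn : ¬ S.Helix n) (hJ : J.Sat (hornTBox S num ρ)) {z : V} (hz : κ z) {c : L} {p : Bool}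
    (h : Atom.concept (num (.label c p)) z ∈ Φ.atoms) :
    Φ.map O κ z ∈ J.At num (.label c p) := by
  have := (hκ.mapAt_spec hnum hn hJ _ z hz rfl).1
  rw [hornTBox, Interp.sat_append, Interp.sat_templateTBox] at hJ
  exact hJ.1.2.1 _ c p (bits_has hnum hn (hκ.deep z c p h hz) (.of_mem h)) _ this

theorem Mappable.map_role (hκ : Φ.Mappable O κ) (hnum : Function.Injective num)
    (hn : ¬ S.Helix n) (hJ : J.Sat (hornTBox S num ρ)) {y z : V} (hy : κ y) (hz : κ z)
    (h : Atom.role 0 y z ∈ Φ.atoms) : J.roleExt 0 (Φ.map O κ y) (Φ.map O κ z) := by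
  have hs : Φ.Suc O y z := .of_mem h
  have hex : ∃ y, κ y ∧ Φ.Suc O y z := ⟨y, hy, hs⟩
  have := (hκ.mapAt_spec hnum hn hJ _ z hz rfl).2.1 hex
  obtain ⟨d, u, hu, -⟩ := hκ.base_eq z hz
  rwa [(hex.choose_spec.2.same hs (hu ▸ trivial)).map] at this

theorem Mappable.map_role_inl (hκ : Φ.Mappable O κ) (hnum : Function.Injective num)
    (hn : ¬ S.Helix n) (hJ : J.Sat (hornTBox S num ρ)) {y z : V} {d : J.Dom}
    (hy : Φ.base y = .inl d) (hz : κ z) (h : Atom.role 0 y z ∈ Φ.atoms) :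
    J.roleExt 0 d (Φ.map O κ z) := by
  have hr : (treeInterp S num ρ J n ∅).roleExt 0 (Φ.base y) (Φ.base z) :=
    Suc.base_roleExt (O := O) (.of_mem h)
  have hno : ¬ ∃ y, κ y ∧ Φ.Suc O y z := by
    rintro ⟨y', hy', hs⟩
    obtain ⟨d, u, hu, -⟩ := hκ.base_eq z hz
    have := (hs.same (.of_mem h) (hu ▸ trivial)).1
    obtain ⟨d', u', hu', -⟩ := hκ.base_eq y' hy'
    rw [hy, hu'] at this
    cases this
  obtain ⟨d', u, hu, h'⟩ := (hκ.mapAt_spec hnum hn hJ _ z hz rfl).2.2 hno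
  rw [hy, hu] at hr
  obtain ⟨rfl, rfl, -⟩ := hr
  exact h'

end HomSystem

end ALC

namespace ALC

/-! ### Certain answers if there is no helix -/

variable {L : Type} [Finite L] {S : HelixSystem L} {num : Name L → ℕ} {ρ : RoleName} {J : Interp}
  {n : ℕ}

/-- The query signature: the role of the reduction, the name `root` and the labels. -/
noncomputable def querySig (num : Name L → ℕ) : FinSignature :=
  (num .root :: (Set.toFinite (Set.univ : Set (L × Bool))).toFinset.toList.map
    fun x => num (.label x.1 x.2), [0])

/-- The signature with the role of the reduction and the name `root`. -/
def rootSig (num : Name L → ℕ) : FinSignature := ([num .root], [0])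

theorem inSignature_querySig {V : Type} {α : Atom V}
    (h : α.InSignature (querySig num).toSignature) :
    (∃ z, α = .concept (num .root) z) ∨ (∃ c p z, α = .concept (num (.label c p)) z) ∨
      ∃ y z, α = .role 0 y z := by
  cases α with
  | concept k z =>
    simp only [Atom.InSignature, FinSignature.toSignature, querySig, Set.mem_ofPred_eq,
      List.mem_cons, List.mem_map, Finset.mem_toList, Set.Finite.mem_toFinset, Set.mem_univ,
      true_and, Prod.exists] at h
    rcases h with rfl | ⟨c, p, rfl⟩
    · exact .inl ⟨z, rfl⟩
    · exact .inr (.inl ⟨c, p, z, rfl⟩)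
  | role R y z =>
    simp only [Atom.InSignature, FinSignature.toSignature, querySig, Set.mem_ofPred_eq,
      List.mem_singleton] at h
    exact .inr (.inr ⟨y, z, by rw [h]⟩)

/-- Homomorphisms from a query to an interpretation that map the answer variables to a given
tuple. -/
def CQ.IsHom (q : CQ) (a : Fin q.arity → IndName) (I : Interp)
    (h : Fin q.arity ⊕ Fin q.numEx → I.Dom) : Prop :=
  (∀ i, h (.inl i) = I.ind (a i)) ∧ ∀ α ∈ q.atoms, α.Holds I h

theorem Interp.satisfies_iff {I : Interp} {q : CQ} {a : Fin q.arity → IndName} :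
    I.Satisfies q a ↔ ∃ h, q.IsHom a I h := by
  constructor
  · rintro ⟨g, hg⟩
    exact ⟨_, fun i => rfl, hg⟩
  · rintro ⟨h, h₁, h₂⟩
    refine ⟨fun j => h (.inr j), ?_⟩
    convert h₂ using 4
    ext (i | j)
    · exact (h₁ i).symm
    · rfl

variable {A : ABox} {q : CQ} {a : Fin q.arity → IndName}

/-- The homomorphisms that exist if a tuple is a certain answer. -/
def CQ.homSystem (hnum : Function.Injective num) (hJ : J.IsModel ⟨hornTBox S num ρ, A⟩)
    (hq : KB.CertainAnswer ⟨alcTBox S num ρ n, A⟩ q a) :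
    HomSystem S num ρ J n (Fin q.arity ⊕ Fin q.numEx) where
  atoms := q.atoms
  hom σ := {h | q.IsHom a (treeInterp S num ρ J n σ) h}
  holds _ _ h := h.2
  nonempty _ := Interp.satisfies_iff.1 (hq _ (isModel_treeInterp hnum hJ))

omit [Finite L] in
theorem root_of_role {V : Type} {Φ : HomSystem S num ρ J n V} {y z : V} {d : J.Dom} {u : List L}
    (h : Atom.role 0 y z ∈ Φ.atoms) (hz : Φ.base z = .inr (d, u)) : d ∈ J.At num .root := by
  have hr := Φ.holds _ _ Φ.base_mem _ h
  change (treeInterp S num ρ J n ∅).roleExt 0 (Φ.base y) (Φ.base z) at hr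
  generalize Φ.base y = x at hr
  rw [hz] at hr
  rcases x with e | ⟨e, v⟩
  · obtain ⟨-, rfl, -, h⟩ := hr
    exact h
  · obtain ⟨-, rfl, h, -⟩ := hr
    exact h.1

omit [Finite L] in
theorem root_of_role_left {V : Type} {Φ : HomSystem S num ρ J n V} {y z : V} {d : J.Dom}
    {u : List L} (h : Atom.role 0 y z ∈ Φ.atoms) (hy : Φ.base y = .inr (d, u)) :
    d ∈ J.At num .root := by
  have hr := Φ.holds _ _ Φ.base_mem _ h
  change (treeInterp S num ρ J n ∅).roleExt 0 (Φ.base y) (Φ.base z) at hr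
  generalize Φ.base z = x at hr
  rw [hy] at hr
  rcases x with e | ⟨e, v⟩
  · exact hr.elim
  · obtain ⟨-, rfl, h, -⟩ := hr
    exact h.1

omit [Finite L] in
theorem roleExt_isLeft_iff (hρ : ρ ≠ 0) {σ : Set (List L)} {x y : J.Dom ⊕ (J.Dom × List L)}
    (h : (treeInterp S num ρ J n σ).roleExt 0 x y) : x.isLeft ↔ y.isLeft := by
  rcases x with x | ⟨x, u⟩ <;> rcases y with y | ⟨y, v⟩
  · simp
  · exact absurd h.1.symm hρ
  · exact h.elim
  · simp

/-- If the roots of the trees are not visible to queries, then the components of the query that can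
be mapped to `J` are mapped there, and the others to the template. -/
theorem certainAnswer_of_not_helix (hnum : Function.Injective num) (hρ : ρ ≠ 0)
    (hn : ¬ S.Helix n) (hq : KB.CertainAnswer ⟨alcTBox S num ρ n, A⟩ q a)
    (hsig : ∀ α ∈ q.atoms, α.InSignature (querySig num).toSignature) :
    KB.CertainAnswer ⟨hornTBox S num ρ, A⟩ q a := by
  classical
  intro J hJ
  let O : OffPart S num J :=
    { Off := ∅
      β := fun _ => ⟨fun _ => false, false, fun _ => false⟩
      pred_unique := fun h => h.elim
      succ_mem := fun h => h.elim
      has := fun h => h.elim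
      inb := fun h => h.elim
      not_root := fun h => h.elim }
  let Φ := CQ.homSystem hnum hJ hq
  have hdeep : ∀ {z}, Φ.Deep O z ↔ ∀ σ, ∀ h ∈ Φ.hom σ, ¬ (h z).isLeft := by
    intro z
    refine forall₃_congr fun σ h _ => ?_
    generalize h z = x
    rcases x with x | x
    · simp [OffPart.Ext, O]
    · simp [OffPart.Ext]
  have hrole : ∀ {y z}, Atom.role 0 y z ∈ Φ.atoms → ∀ σ, ∀ h ∈ Φ.hom σ,
      ((h y).isLeft ↔ (h z).isLeft) :=
    fun hyz σ h hh => roleExt_isLeft_iff hρ (Φ.holds σ h hh _ hyz)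
  have hroleD : ∀ {y z}, Atom.role 0 y z ∈ Φ.atoms → (Φ.Deep O y ↔ Φ.Deep O z) := by
    intro y z hyz
    rw [hdeep, hdeep]
    exact forall₃_congr fun σ h hh => not_congr (hrole hyz σ h hh)
  -- a homomorphism that maps a given variable to `J`, if there is one
  have hex : ∀ z, ∃ h : _ → J.Dom ⊕ (J.Dom × List L), ∃ σ, h ∈ Φ.hom σ ∧
      (¬ Φ.Deep O z → (h z).isLeft) := by
    intro z
    by_cases hz : Φ.Deep O z
    · exact ⟨Φ.base, ∅, Φ.base_mem, fun h => absurd hz h⟩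
    · have hz' := hz
      rw [hdeep] at hz'
      push Not at hz'
      obtain ⟨σ, h, hh, hl⟩ := hz'
      exact ⟨h, σ, hh, fun _ => hl⟩
  choose H σ hH hleft using hex
  let r : _ → _ → Prop := fun y z => Atom.role 0 y z ∈ q.atoms
  let rep : _ → Fin q.arity ⊕ Fin q.numEx := fun z => (Quot.mk r z).out
  have hrep : ∀ {y z}, Atom.role 0 y z ∈ Φ.atoms → rep y = rep z :=
    fun h => congrArg Quot.out (Quot.sound h)
  have hcomp : ∀ {y z}, Relation.EqvGen r y z →
      (∀ σ, ∀ h ∈ Φ.hom σ, ((h y).isLeft ↔ (h z).isLeft)) := by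
    intro y z h
    induction h with
    | rel y z h => exact hrole h
    | refl y => exact fun _ _ _ => Iff.rfl
    | symm y z _ ih => exact fun σ h hh => (ih σ h hh).symm
    | trans x y z _ _ ih₁ ih₂ => exact fun σ h hh => (ih₁ σ h hh).trans (ih₂ σ h hh)
  have hrepE : ∀ z, Relation.EqvGen r (rep z) z :=
    fun z => Quot.eqvGen_exact (Quot.out_eq (Quot.mk r z))
  have hval : ∀ z, ¬ Φ.Deep O z → ∃ d, H (rep z) z = .inl d := by
    intro z hz
    have hz' : ¬ Φ.Deep O (rep z) := by
      rw [hdeep] at hz ⊢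
      intro h
      exact hz fun σ f hf => (not_congr (hcomp (hrepE z) σ f hf)).1 (h σ f hf)
    exact Sum.isLeft_iff.1 ((hcomp (hrepE z) _ _ (hH _)).1 (hleft _ hz'))
  let κ : _ → Prop := fun z => Φ.Deep O z ∧ ∃ d u, Φ.base z = .inr (d, u) ∧ d ∈ J.At num .root
  have hbase : ∀ {z}, Φ.Deep O z → ∃ d u, Φ.base z = .inr (d, u) := by
    intro z hz
    have h := hz ∅ _ Φ.base_mem
    generalize Φ.base z = x at h
    rcases x with x | ⟨d, u⟩
    · exact h.elim
    · exact ⟨d, u, rfl⟩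
  have hκ : Φ.Mappable O κ :=
    { base_eq := fun z hz => hz.2
      deep := fun z _ _ _ hz => hz.1
      same := fun z z' h hz => ⟨h.deep hz.1, h.1 ▸ hz.2⟩
      pred := fun y z h hz => by
        have hy := (hroleD h).2 hz.1
        obtain ⟨d, u, hu⟩ := hbase hy
        exact .inl ⟨hy, d, u, hu, root_of_role_left h hu⟩ }
  let f : Fin q.arity ⊕ Fin q.numEx → J.Dom := fun z =>
    if Φ.Deep O z then Φ.map O κ z else Sum.elim id Prod.fst (H (rep z) z)
  have hf : ∀ {z}, ¬ Φ.Deep O z → H (rep z) z = .inl (f z) := by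
    intro z hz
    obtain ⟨d, hd⟩ := hval z hz
    simp only [f, if_neg hz, hd, Sum.elim_inl, id]
  rw [Interp.satisfies_iff]
  refine ⟨f, fun i => ?_, fun α hα => ?_⟩
  · have hi : ∀ σ, ∀ h ∈ Φ.hom σ, h (.inl i) = .inl (J.ind (a i)) := fun σ h hh => hh.1 i
    have hi' : ¬ Φ.Deep O (.inl i) := by
      rw [hdeep]
      intro h
      have := h ∅ _ Φ.base_mem
      rw [hi _ _ Φ.base_mem] at this
      exact this rfl
    exact Sum.inl_injective ((hf hi').symm.trans (hi _ _ (hH _)))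
  · have hholds : ∀ z, α.Holds (treeInterp S num ρ J n (σ z)) (H z) :=
      fun z => Φ.holds _ _ (hH z) α hα
    have hold : α.Holds (treeInterp S num ρ J n ∅) Φ.base := Φ.holds _ _ Φ.base_mem α hα
    rcases inSignature_querySig (hsig α hα) with ⟨z, rfl⟩ | ⟨c, p, z, rfl⟩ | ⟨y, z, rfl⟩
    · have hz : ¬ Φ.Deep O z := by
        intro hz
        obtain ⟨d, u, hu⟩ := hbase hz
        simp only [Atom.Holds, hu] at hold
        exact ((inr_mem_treeInterp hnum).1 hold).2
      have := hholds (rep z)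
      simp only [Atom.Holds, hf hz] at this
      exact this
    · by_cases hz : Φ.Deep O z
      · simp only [Atom.Holds, f, if_pos hz]
        refine hκ.map_label hnum hn hJ.1 ⟨hz, ?_⟩ hα
        obtain ⟨d, u, hu⟩ := hbase hz
        simp only [Atom.Holds, hu] at hold
        exact ⟨d, u, hu, ((inr_mem_treeInterp hnum).1 hold).1.1⟩
      · have := hholds (rep z)
        simp only [Atom.Holds, hf hz] at this
        exact this
    · by_cases hz : Φ.Deep O z
      · have hy := (hroleD hα).2 hz
        simp only [Atom.Holds, f, if_pos hz, if_pos hy]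
        obtain ⟨d, u, hu⟩ := hbase hz
        obtain ⟨d', u', hu'⟩ := hbase hy
        exact hκ.map_role hnum hn hJ.1 ⟨hy, d', u', hu', root_of_role_left hα hu'⟩
          ⟨hz, d, u, hu, root_of_role hα hu⟩ hα
      · have hy := mt (hroleD hα).1 hz
        have := hholds (rep z)
        simp only [Atom.Holds, hf hz] at this
        rw [← hrep hα, hf hy] at this
        exact this

end ALC

namespace ALC

/-! ### Unravelling the template -/

variable {L : Type} [Finite L] {S : HelixSystem L} {num : Name L → ℕ} {J : Interp}
  {n : ℕ} {A : ABox}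

/-- The model that consists of the individual names, with the facts of the ABox only, and of the
paths of copies of template elements in `J` that start at individuals with the name `root`. The
path with the reversed steps `(e, ν) :: l` is a copy of the template element `ν`, and is projected
to `e`. The conditions on edges and names concern one step only, so that lists that do not describe
a path need not be excluded from the domain. -/
def unravel (S : HelixSystem L) (num : Name L → ℕ) (J : Interp) (A : ABox) : Interp where
  Dom := IndName ⊕ (IndName × List (J.Dom × Tmpl))
  ind := .inl
  ind_injective := Sum.inl_injective
  conceptExt k := {x | match x with
    | .inl b => Atom.concept k b ∈ A
    | .inr (_, []) => False
    | .inr (_, (e, ν) :: _) => e ∈ J.At num (.tmpl ν) ∧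
        (num (.tmpl ν) = k ∨ ∃ c p, num (.label c p) = k ∧ ν.Has S c p)}
  roleExt R x y := match x, y with
    | .inl b, .inl b' => Atom.role R b b' ∈ A
    | .inl b, .inr (b', l) => R = 0 ∧ b' = b ∧ Atom.concept (num .root) b ∈ A ∧
        ∃ e ν, l = [(e, ν)] ∧ e ∈ J.At num (.tmpl ν) ∧ J.roleExt 0 (J.ind b) e
    | .inr (b, l), .inr (b', l') => R = 0 ∧ b' = b ∧ ∃ e ν e' ν' l₁, l = (e, ν) :: l₁ ∧
        l' = (e', ν') :: l ∧ e' ∈ J.At num (.tmpl ν') ∧ J.roleExt 0 e e' ∧ ν'.inb = ν.out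
    | .inr _, .inl _ => False

theorem isModel_unravel (hnum : Function.Injective num) (hJ : J.IsModel ⟨hornTBox S num 0, A⟩)
    (hA : ∀ α ∈ A, α.InSignature (rootSig num).toSignature) :
    (unravel S num J A).IsModel ⟨hornTBox S num 0, A⟩ := by
  have hroot : ∀ k b, Atom.concept k b ∈ A → k = num .root := by
    intro k b h
    simpa [Atom.InSignature, FinSignature.toSignature, rootSig] using hA _ h
  obtain ⟨hT, hJA⟩ := hJ
  change J.Sat _ at hT
  rw [hornTBox, Interp.sat_append, Interp.sat_templateTBox, Interp.sat_emptyTBox] at hT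
  obtain ⟨⟨h₁, h₂, h₃⟩, h₄, h₅⟩ := hT
  have hnot : ∀ x : Name L, x ≠ .root → (∀ ν, .tmpl ν ≠ x) → (∀ c p, .label c p ≠ x) →
      ∀ d, d ∉ (unravel S num J A).At num x := by
    rintro x hx hx₁ hx₂ (b | ⟨b, _ | ⟨⟨e, ν⟩, l⟩⟩) h
    · exact hx (hnum (hroot _ _ h))
    · exact h
    · rcases h.2 with h | ⟨c, p, h, -⟩
      · exact hx₁ _ (hnum h)
      · exact hx₂ _ _ (hnum h)
  have htmpl : ∀ ν d, d ∈ (unravel S num J A).At num (.tmpl ν) →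
      ∃ b e l, d = .inr (b, (e, ν) :: l) ∧ e ∈ J.At num (.tmpl ν) := by
    rintro ν (b | ⟨b, _ | ⟨⟨e, ν⟩, l⟩⟩) h
    · exact absurd (hnum (hroot _ _ h)) (by simp)
    · exact h.elim
    · obtain ⟨he, h | ⟨c, p, h, -⟩⟩ := h
      · cases hnum h
        exact ⟨b, e, l, rfl, he⟩
      · cases hnum h
  refine ⟨?_, fun α hα => ?_⟩
  · change (unravel S num J A).Sat _
    rw [hornTBox, Interp.sat_append, Interp.sat_templateTBox, Interp.sat_emptyTBox]
    refine ⟨⟨?_, ?_, ?_⟩, fun c d => hnot _ (by simp) (by simp) (by simp) d,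
      fun p d => hnot _ (by simp) (by simp) (by simp) d⟩
    · rintro ν hν (b | ⟨b, _ | ⟨⟨e, ν'⟩, l⟩⟩) h
      · obtain ⟨e, he, he'⟩ := h₁ ν hν (J.ind b) (hJA _ h)
        exact ⟨.inr (b, [(e, ν)]), ⟨rfl, rfl, h, e, ν, rfl, he', he⟩, he', .inl rfl⟩
      · exact h.elim
      · rcases h.2 with h | ⟨c, p, h, -⟩ <;> cases hnum h
    · intro ν c p hν d hd
      obtain ⟨b, e, l, rfl, he⟩ := htmpl ν d hd
      exact ⟨he, .inr ⟨c, p, rfl, hν⟩⟩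
    · intro ν ν' hν d hd
      obtain ⟨b, e, l, rfl, he⟩ := htmpl ν d hd
      obtain ⟨e', he', he''⟩ := h₃ ν ν' hν e he
      exact ⟨.inr (b, (e', ν') :: (e, ν) :: l),
        ⟨rfl, rfl, e, ν, e', ν', l, rfl, rfl, he'', he', funext hν⟩, he'', .inl rfl⟩
  · cases α <;> exact hα

/-- The projection of the unravelling. -/
def unravelProj (J : Interp) : IndName ⊕ (IndName × List (J.Dom × Tmpl)) → J.Dom
  | .inl b => J.ind b
  | .inr (b, []) => J.ind b
  | .inr (_, (e, _) :: _) => e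

theorem holds_unravelProj (hnum : Function.Injective num)
    (hJ : J.IsModel ⟨hornTBox S num 0, A⟩) {V : Type} {h : V → (unravel S num J A).Dom}
    {α : Atom V} (hsig : α.InSignature (querySig num).toSignature)
    (hα : α.Holds (unravel S num J A) h) : α.Holds J (fun v => unravelProj J (h v)) := by
  obtain ⟨hT, hJA⟩ := hJ
  change J.Sat _ at hT
  rw [hornTBox, Interp.sat_append, Interp.sat_templateTBox] at hT
  rcases inSignature_querySig hsig with ⟨z, rfl⟩ | ⟨c, p, z, rfl⟩ | ⟨y, z, rfl⟩
  · simp only [Atom.Holds] at hα ⊢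
    generalize h z = x at hα
    rcases x with b | ⟨b, _ | ⟨⟨e, ν⟩, l⟩⟩
    · exact hJA _ hα
    · exact hα.elim
    · rcases hα.2 with h | ⟨c, p, h, -⟩ <;> cases hnum h
  · simp only [Atom.Holds] at hα ⊢
    generalize h z = x at hα
    rcases x with b | ⟨b, _ | ⟨⟨e, ν⟩, l⟩⟩
    · exact hJA _ hα
    · exact hα.elim
    · obtain ⟨he, h | ⟨c, p, h, hν⟩⟩ := hα
      · cases hnum h
      · cases hnum h
        exact hT.1.2.1 ν c p hν e he
  · simp only [Atom.Holds] at hα ⊢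
    generalize h y = x at hα
    generalize h z = x' at hα
    rcases x with b | ⟨b, l⟩ <;> rcases x' with b' | ⟨b', l'⟩
    · exact hJA _ hα
    · obtain ⟨-, -, -, e, ν, rfl, -, h⟩ := hα
      exact h
    · exact hα.elim
    · obtain ⟨-, -, e, ν, e', ν', l₁, rfl, rfl, -, h, -⟩ := hα
      exact h

/-- The elements of the unravelling that are not individuals. -/
def offUnravel (hnum : Function.Injective num) (A : ABox) :
    OffPart S num (unravel S num J A) where
  Off := {x | x.isRight}
  β x := match x with
    | .inr (_, (_, ν) :: _) => ν
    | _ => ⟨fun _ => false, false, fun _ => false⟩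
  pred_unique := by
    rintro (d | ⟨d, l⟩) (d' | ⟨d', l'⟩) (e | ⟨e, l''⟩) he h h'
    · cases he
    · obtain ⟨-, rfl, -⟩ := h
      obtain ⟨-, rfl, -⟩ := h'
      rfl
    · cases he
    · obtain ⟨-, rfl, -, _, _, rfl, -⟩ := h
      obtain ⟨-, -, _, _, _, _, _, rfl, h, -⟩ := h'
      cases h
    · cases he
    · obtain ⟨-, rfl, -, _, _, rfl, -⟩ := h'
      obtain ⟨-, -, _, _, _, _, _, rfl, h, -⟩ := h
      cases h
    · cases he
    · obtain ⟨-, rfl, _, _, _, _, _, rfl, rfl, -⟩ := h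
      obtain ⟨-, rfl, _, _, _, _, _, rfl, h, -⟩ := h'
      cases h
      rfl
  succ_mem := by
    rintro (d | ⟨d, l⟩) (e | ⟨e, l'⟩) hd h
    · cases hd
    · cases hd
    · exact h.elim
    · rfl
  has := by
    rintro (b | ⟨b, _ | ⟨⟨e, ν⟩, l⟩⟩) c p he h
    · cases he
    · exact h.elim
    · obtain ⟨-, h | ⟨c', p', h, hν⟩⟩ := h
      · cases hnum h
      · cases hnum h
        exact hν
  inb := by
    rintro (d | ⟨d, l⟩) (e | ⟨e, l'⟩) hd h
    · cases hd
    · cases hd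
    · exact h.elim
    · obtain ⟨-, -, _, _, _, _, _, rfl, rfl, -, -, h⟩ := h
      exact h
  not_root := by
    rintro (b | ⟨b, _ | ⟨⟨e, ν⟩, l⟩⟩) hd h
    · cases hd
    · exact h
    · rcases h.2 with h | ⟨c, p, h, -⟩ <;> cases hnum h

/-- If the ABox has no labels, then all labelled variables are mapped outside of the individuals.
The part of a query that is mapped to the trees of words is mapped to the template, in the
unravelling of a given model. -/
theorem certainAnswer_of_not_helix_of_rootSig (hnum : Function.Injective num)
    (hn : ¬ S.Helix n) {q : CQ} {a : Fin q.arity → IndName}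
    (hA : ∀ α ∈ A, α.InSignature (rootSig num).toSignature)
    (hq : KB.CertainAnswer ⟨alcTBox S num 0 n, A⟩ q a)
    (hsig : ∀ α ∈ q.atoms, α.InSignature (querySig num).toSignature) :
    KB.CertainAnswer ⟨hornTBox S num 0, A⟩ q a := by
  classical
  intro J₀ hJ₀
  suffices h : (unravel S num J₀ A).Satisfies q a by
    rw [Interp.satisfies_iff] at h ⊢
    obtain ⟨h, h₁, h₂⟩ := h
    exact ⟨fun v => unravelProj J₀ (h v), fun i => congrArg _ (h₁ i),
      fun α hα => holds_unravelProj hnum hJ₀ (hsig α hα) (h₂ α hα)⟩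
  have hJ := isModel_unravel hnum hJ₀ hA
  let O : OffPart S num (unravel S num J₀ A) := offUnravel hnum A
  let Φ := CQ.homSystem hnum hJ hq
  have hlab : ∀ c p z, Atom.concept (num (.label c p)) z ∈ Φ.atoms → Φ.Deep O z := by
    intro c p z hz σ h hh
    have h' := Φ.holds σ h hh _ hz
    simp only [Atom.Holds] at h'
    generalize h z = x at h'
    rcases x with (b | ⟨b, l⟩) | x
    · have h' : Atom.concept (num (.label c p)) b ∈ A := h'
      have := hA _ h'
      simp only [Atom.InSignature, FinSignature.toSignature, rootSig, Set.mem_ofPred_eq,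
        List.mem_singleton] at this
      cases hnum this
    · rfl
    · trivial
  let κ : _ → Prop := fun z => ∃ d u, Φ.base z = .inr (d, u) ∧
    d ∈ (unravel S num J₀ A).At num .root
  have hκ : Φ.Mappable O κ :=
    { base_eq := fun z hz => hz
      deep := fun z c p hz _ => hlab c p z hz
      same := fun z z' h hz => by
        obtain ⟨d, u, hu, hd⟩ := hz
        exact ⟨d, u, h.1 ▸ hu, hd⟩
      pred := fun y z h _ => by
        rcases hy : Φ.base y with d | ⟨d, u⟩
        · exact .inr ⟨d, rfl⟩
        · exact .inl ⟨d, u, hy, root_of_role_left h hy⟩ }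
  let f : Fin q.arity ⊕ Fin q.numEx → (unravel S num J₀ A).Dom := fun z =>
    Sum.elim id (fun _ => Φ.map O κ z) (Φ.base z)
  have hfl : ∀ {z d}, Φ.base z = .inl d → f z = d := fun {z d} h => by simp only [f, h]; rfl
  have hfr : ∀ {z x}, Φ.base z = .inr x → f z = Φ.map O κ z :=
    fun {z d} h => by simp only [f, h]; rfl
  rw [Interp.satisfies_iff]
  refine ⟨f, fun i => hfl (Φ.base_mem.1 i), fun α hα => ?_⟩
  have hold : α.Holds (treeInterp S num 0 (unravel S num J₀ A) n ∅) Φ.base :=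
    Φ.holds _ _ Φ.base_mem α hα
  rcases inSignature_querySig (hsig α hα) with ⟨z, rfl⟩ | ⟨c, p, z, rfl⟩ | ⟨y, z, rfl⟩
  · simp only [Atom.Holds] at hold ⊢
    rcases hz : Φ.base z with d | ⟨d, u⟩
    · rw [hz] at hold
      rw [hfl hz]
      exact hold
    · rw [hz] at hold
      exact ((inr_mem_treeInterp hnum).1 hold).2.elim
  · simp only [Atom.Holds] at hold ⊢
    rcases hz : Φ.base z with d | ⟨d, u⟩
    · rw [hz] at hold
      rw [hfl hz]
      exact hold
    · rw [hz] at hold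
      rw [hfr hz]
      exact hκ.map_label hnum hn hJ.1 ⟨d, u, hz, ((inr_mem_treeInterp hnum).1 hold).1.1⟩ hα
  · simp only [Atom.Holds] at hold ⊢
    rcases hz : Φ.base z with d | ⟨d, u⟩ <;> rcases hy : Φ.base y with d' | ⟨d', u'⟩
    · rw [hz, hy] at hold
      rw [hfl hz, hfl hy]
      exact hold
    · rw [hz, hy] at hold
      exact hold.elim
    · rw [hfr hz, hfl hy]
      exact hκ.map_role_inl hnum hn hJ.1 hy ⟨d, u, hz, root_of_role hα hz⟩ hα
    · rw [hfr hz, hfr hy]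
      exact hκ.map_role hnum hn hJ.1 ⟨d', u', hy, root_of_role_left hα hy⟩
        ⟨d, u, hz, root_of_role hα hz⟩ hα

end ALC

namespace ALC

/-! ### Following a helix in the models of the `ALC` TBox -/

variable {L : Type} {S : HelixSystem L} {num : Name L → ℕ} {ρ : RoleName} {n : ℕ}

/-- A path in `I` whose nodes carry the letters of the word `u` (given in reverse). -/
structure IsPath (num : Name L → ℕ) (ρ : RoleName) (I : Interp) (d : I.Dom) (u : List L)
    (f : ℕ → I.Dom) : Prop where
  root : I.roleExt ρ d (f 0)
  edge : ∀ i, i + 1 < u.length → I.roleExt 0 (f i) (f (i + 1))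
  node : ∀ i c, u.reverse[i]? = some c → f i ∈ I.At num (.node c)
  color : ∀ i < u.length, f i ∈ I.At num (.color (i + 1).bodd)

theorem IsPath.update {I : Interp} {d : I.Dom} {u : List L} {f : ℕ → I.Dom} {b c : L}
    (h : IsPath num ρ I d (b :: u) f) {e : I.Dom} (hr : I.roleExt 0 (f u.length) e)
    (he : e ∈ I.At num (.node c)) (hcol : e ∈ I.At num (.color (u.length + 2).bodd)) :
    IsPath num ρ I d (c :: b :: u) (Function.update f (u.length + 1) e) := by
  have hlt : ∀ i, i < u.length + 1 → Function.update f (u.length + 1) e i = f i :=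
    fun i hi => Function.update_of_ne (by omega) _ _
  refine ⟨?_, fun i hi => ?_, fun i c' hi => ?_, fun i hi => ?_⟩
  · rw [hlt 0 (by omega)]
    exact h.root
  · simp only [List.length_cons] at hi
    rw [hlt i (by omega)]
    rcases Nat.lt_or_ge (i + 1) (u.length + 1) with hi' | hi'
    · rw [hlt _ hi']
      exact h.edge i (by simpa using hi')
    · obtain rfl : i = u.length := by omega
      rwa [Function.update_self]
  · rw [List.reverse_cons] at hi
    rcases Nat.lt_or_ge i (u.length + 1) with hi' | hi'
    · rw [hlt i hi']
      rw [List.getElem?_append_left (by simpa using hi')] at hi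
      exact h.node i c' hi
    · rw [List.getElem?_append_right (by simpa using hi')] at hi
      obtain ⟨hi₁, hi₂⟩ := List.getElem?_eq_some_iff.1 hi
      simp only [List.length_reverse, List.length_cons, List.length_nil] at hi₁
      obtain rfl : i = u.length + 1 := by omega
      rw [Function.update_self]
      simp at hi₂
      exact hi₂ ▸ he
  · simp only [List.length_cons] at hi
    rcases Nat.lt_or_ge i (u.length + 1) with hi' | hi'
    · rw [hlt i hi']
      exact h.color i (by simpa using hi')
    · obtain rfl : i = u.length + 1 := by omega
      rwa [Function.update_self]

variable [Finite L]

/-- In each model, either the word `halt :: w` labels a path, or the words continue after it. -/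
theorem exists_path {I : Interp} (hI : I.Sat (alcTBox S num ρ n)) {d : I.Dom}
    (hd : d ∈ I.At num .root) {w u : List L} (hu : S.Valid n {S.halt :: w} u) :
    (∃ f, IsPath num ρ I d (S.halt :: w) f ∧
      f w.length ∈ I.At num (.label S.halt (w.length + 1).bodd)) ∨
    ∃ f, IsPath num ρ I d u f ∧ ∀ k ≤ n, u = List.replicate k S.inp ++ [S.init] →
      f k ∈ I.ext (chainConcept S num (n - k)) := by
  rw [alcTBox, Interp.sat_cons, Interp.sat_append, Interp.sat_treeTBox] at hI
  obtain ⟨hchain, -, h₁, h₂, h₃, -, -, h₄, h₅⟩ := hI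
  induction hu with
  | init =>
    obtain ⟨e, he, he'⟩ := h₁ d hd
    refine .inr ⟨fun _ => e, ⟨he, fun i hi => ?_, fun i c hi => ?_, fun i hi => ?_⟩,
      fun k _ hk => ?_⟩
    · simp at hi
    · obtain ⟨hi₁, hi₂⟩ := List.getElem?_eq_some_iff.1 hi
      simp at hi₂
      exact hi₂ ▸ he'
    · obtain rfl : i = 0 := by simpa using hi
      exact h₂ e he'
    · obtain rfl : k = 0 := by
        have := congrArg List.length hk
        simp at this
        omega
      exact hchain he'
  | @step u c hu h hσ ih =>
    rcases ih with hf | ⟨f, hf, hk⟩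
    · exact .inl hf
    obtain ⟨b, u, rfl⟩ := List.exists_cons_of_ne_nil hu.ne_nil
    have hcol := hf.color u.length (by simp)
    have hnode : f u.length ∈ I.At num (.node b) := by
      refine hf.node _ _ ?_
      rw [List.reverse_cons, List.getElem?_append_right (by simp)]
      simp
    have hcol' : ∀ e, I.roleExt 0 (f u.length) e → e ∈ I.At num (.color (u.length + 2).bodd) := by
      intro e he
      have := h₃ _ _ hcol e he
      rwa [← Nat.bodd_succ] at this
    have hupd : ∀ e, I.roleExt 0 (f u.length) e → e ∈ I.At num (.node c) →
        (∀ k ≤ n, c :: b :: u = List.replicate k S.inp ++ [S.init] →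
          e ∈ I.ext (chainConcept S num (n - k))) →
        ∃ f, IsPath num ρ I d (c :: b :: u) f ∧ ∀ k ≤ n, c :: b :: u =
          List.replicate k S.inp ++ [S.init] → f k ∈ I.ext (chainConcept S num (n - k)) := by
      intro e he he' hk
      refine ⟨_, hf.update he he' (hcol' e he), fun k hkn he => ?_⟩
      have : k = u.length + 1 := by
        have := congrArg List.length he
        simp at this
        omega
      subst this
      rw [Function.update_self]
      exact hk _ hkn he
    by_cases hform : ∃ k < n, b :: u = List.replicate k S.inp ++ [S.init] ∧ c = S.inp
    · obtain ⟨k, hkn, hbu, rfl⟩ := hform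
      have hlen : k = u.length := by
        have := congrArg List.length hbu
        simp at this
        omega
      have := hk k hkn.le hbu
      rw [show n - k = (n - (k + 1)) + 1 by omega, hlen] at this
      obtain ⟨e, he, he', he''⟩ := this
      refine .inr (hupd e he he' fun k' _ hk' => ?_)
      have : k' = u.length + 1 := by
        have := congrArg List.length hk'
        simp at this
        omega
      exact this ▸ he''
    have hvac : ∀ k ≤ n, c :: b :: u ≠ List.replicate k S.inp ++ [S.init] := by
      intro k hkn he
      cases k with
      | zero => simp at he
      | succ k =>
        simp only [List.replicate_succ, List.cons_append, List.cons.injEq] at he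
        exact hform ⟨k, by omega, he.2, he.1⟩
    generalize hbu : b :: u = u' at h
    cases h with
    | @inp k hkn => exact absurd ⟨k, hkn, hbu, rfl⟩ hform
    | pad =>
      have hlen : n = u.length := by
        have := congrArg List.length hbu
        simp at this
        omega
      have := hk n le_rfl hbu
      rw [Nat.sub_self, hlen] at this
      obtain ⟨e, he, he'⟩ := this
      rw [← hbu]
      exact .inr (hupd e he he' fun k hkn hk' => absurd hk' (hvac k hkn))
    | H u h =>
      cases hbu
      by_cases hb : b = S.halt
      · subst hb
        rcases h₅ _ _ h _ hnode hcol with hl | ⟨e, he, he'⟩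
        · left
          have := hσ rfl
          rw [Set.mem_singleton_iff, List.cons.injEq] at this
          obtain ⟨-, rfl⟩ := this
          exact ⟨f, hf, hl⟩
        · exact .inr (hupd e he he' fun k hkn hk' => absurd hk' (hvac k hkn))
      · obtain ⟨e, he, he'⟩ := h₄ _ _ h hb _ hnode
        exact .inr (hupd e he he' fun k hkn hk' => absurd hk' (hvac k hkn))

/-- In the tree below an element with the name `root`, there is a path that has the labels of the
word `halt :: w`: either they are found at the first `w.length + 1` nodes, or they are found one
row later. -/
theorem exists_labelled_path {I : Interp} (hI : I.Sat (alcTBox S num ρ n)) {d : I.Dom}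
    (hd : d ∈ I.At num .root) {w r u₁ u₂ : List L} (hu : S.Valid n Set.univ (r ++ S.halt :: w))
    (he : r ++ S.halt :: w = u₁ ++ u₂) (hV : List.Forall₂ S.V (S.halt :: w) u₁)
    (hodd : Odd u₂.length) :
    ∃ s, (s = 0 ∨ s = u₂.length) ∧ ∃ f : ℕ → I.Dom, I.roleExt ρ d (f 0) ∧
      (∀ i, i < s + w.length → I.roleExt 0 (f i) (f (i + 1))) ∧
      ∀ i c, (S.halt :: w).reverse[i]? = some c →
        f (s + i) ∈ I.At num (.label c (i + 1).bodd) := by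
  have hw := (hu.not_mem_of_halt rfl).1
  have hbodd : u₂.length.bodd = true := by
    rw [Nat.odd_iff, Nat.mod_two_of_bodd] at hodd
    cases h : u₂.length.bodd <;> simp_all
  have hsat := hI
  rw [alcTBox, Interp.sat_cons, Interp.sat_append, Interp.sat_treeTBox] at hI
  obtain ⟨-, -, -, -, -, h₁, h₂, -, -⟩ := hI
  rcases exists_path hsat hd hu.singleton with ⟨f, hf, hl⟩ | ⟨f, hf, -⟩
  · refine ⟨0, .inl rfl, f, hf.root, fun i hi => hf.edge i (by simp; omega), fun i c hi => ?_⟩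
    rw [Nat.zero_add]
    by_cases hc : c = S.halt
    · subst hc
      obtain rfl : i = w.length := by
        rw [List.reverse_cons] at hi
        rcases Nat.lt_or_ge i w.length with hi' | hi'
        · rw [List.getElem?_append_left (by simpa using hi')] at hi
          exact absurd (List.mem_reverse.1 (List.mem_of_getElem? hi)) hw
        · have := (List.getElem?_eq_some_iff.1 hi).1
          simp at this
          omega
      exact hl
    · refine h₁ c _ hc _ (hf.node i c hi) (hf.color i ?_)
      simpa using (List.getElem?_eq_some_iff.1 hi).1
  · have hlen : (r ++ S.halt :: w).length = u₂.length + w.length + 1 := by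
      rw [he, List.length_append, ← hV.length_eq, List.length_cons]
      omega
    refine ⟨u₂.length, .inr rfl, f, hf.root, fun i hi => hf.edge i (by omega), fun i c hi => ?_⟩
    have hV' := List.forall₂_reverse_iff.2 hV
    have hi' := (List.getElem?_eq_some_iff.1 hi).1
    obtain ⟨c', hc', hcc⟩ : ∃ c', u₁.reverse[i]? = some c' ∧ S.V c c' := by
      have hi'' : i < u₁.reverse.length := hV'.length_eq ▸ hi'
      refine ⟨_, List.getElem?_eq_getElem hi'', ?_⟩
      have := hV'.get hi' hi''
      rw [List.getElem?_eq_getElem hi'] at hi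
      cases hi
      exact this
    have hnode := hf.node (u₂.length + i) c' (by
      rw [he, List.reverse_append, List.getElem?_append_right (by simp)]
      simpa using hc')
    have hcol := hf.color (u₂.length + i) (by
      rw [hlen]
      simp at hi'
      omega)
    have := h₂ c c' _ hcc _ hnode hcol
    rw [Nat.add_assoc, Nat.bodd_add, hbodd, Bool.true_xor, Bool.not_not] at this
    exact this

end ALC

namespace ALC

/-! ### Refuting the query of a helix in the template -/

variable {L : Type} [Finite L] {S : HelixSystem L} {num : Name L → ℕ} {ρ : RoleName} {n : ℕ}

/-- The ABox with an element with the name `root`; it has a loop if rooted queries are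
considered. -/
def rootABox (num : Name L → ℕ) (rooted : Bool) : ABox :=
  .concept (num .root) 0 :: if rooted then [.role 0 0 0] else []

/-- The template over the ABox `rootABox num rooted`. -/
def templateInterp (S : HelixSystem L) (num : Name L → ℕ) (ρ : RoleName) (rooted : Bool) :
    Interp where
  Dom := IndName ⊕ Tmpl
  ind := .inl
  ind_injective := Sum.inl_injective
  conceptExt k := {x | match x with
    | .inl a => a = 0 ∧ k = num .root
    | .inr ν => num (.tmpl ν) = k ∨ ∃ c p, num (.label c p) = k ∧ ν.Has S c p}
  roleExt R x y := match x, y with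
    | .inl a, .inl b => rooted = true ∧ R = 0 ∧ a = 0 ∧ b = 0
    | .inl a, .inr ν => R = ρ ∧ a = 0 ∧ ∀ p, ν.inb p = false
    | .inr ν, .inr ν' => R = 0 ∧ ∀ p, ν'.inb p = ν.out p
    | .inr _, .inl _ => False

omit [Finite L] in
theorem inr_mem_templateInterp (hnum : Function.Injective num) {rooted : Bool} {ν : Tmpl} {c : L}
    {p : Bool} (h : (Sum.inr ν : (templateInterp S num ρ rooted).Dom) ∈
      (templateInterp S num ρ rooted).At num (.label c p)) : ν.Has S c p := by
  rcases h with h | ⟨c', p', h, hν⟩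
  · cases hnum h
  · cases hnum h
    exact hν

theorem isModel_templateInterp (hnum : Function.Injective num) (rooted : Bool) :
    (templateInterp S num ρ rooted).IsModel ⟨hornTBox S num ρ, rootABox num rooted⟩ := by
  have hemp : ∀ x : Name L, x ≠ .root → (∀ ν, .tmpl ν ≠ x) → (∀ c p, .label c p ≠ x) →
      ∀ d, d ∉ (templateInterp S num ρ rooted).At num x := by
    rintro x hx hx₁ hx₂ (a | ν) h
    · exact hx (hnum h.2)
    · rcases h with h | ⟨c, p, h, -⟩
      · exact hx₁ _ (hnum h)
      · exact hx₂ _ _ (hnum h)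
  constructor
  · change (templateInterp S num ρ rooted).Sat _
    rw [hornTBox, Interp.sat_append, Interp.sat_templateTBox, Interp.sat_emptyTBox]
    refine ⟨⟨?_, ?_, ?_⟩, fun c d => hemp _ (by simp) (by simp) (by simp) d,
      fun p d => hemp _ (by simp) (by simp) (by simp) d⟩
    · rintro ν hν (a | ν') h
      · exact ⟨.inr ν, ⟨rfl, h.1, hν⟩, .inl rfl⟩
      · rcases h with h | ⟨c, p, h, -⟩ <;> cases hnum h
    · rintro ν c p hν (a | ν') h
      · cases hnum h.2
      · rcases h with h | ⟨c, p, h, -⟩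
        · cases hnum h
          exact .inr ⟨c, p, rfl, hν⟩
        · cases hnum h
    · rintro ν ν' hν (a | ν₀) h
      · cases hnum h.2
      · rcases h with h | ⟨c, p, h, -⟩
        · cases hnum h
          exact ⟨.inr ν', ⟨rfl, hν⟩, .inl rfl⟩
        · cases hnum h
  · intro α hα
    cases rooted with
    | false =>
      obtain rfl : α = .concept (num .root) 0 := by simpa [rootABox] using hα
      exact ⟨rfl, rfl⟩
    | true =>
      have hα : α = .concept (num .root) 0 ∨ α = .role 0 0 0 := by simpa [rootABox] using hα
      rcases hα with rfl | rfl
      · exact ⟨rfl, rfl⟩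
      · exact ⟨rfl, rfl, rfl, rfl⟩

open Classical in
/-- The query that describes a path with `s` nodes, followed by a path with the labels of the word
`x :: w` (given in reverse). The nodes of the first path are connected to each other and to the
answer variable only in rooted queries. -/
noncomputable def pathQuery (num : Name L → ℕ) (rooted : Bool) (s : ℕ) (x : L) (w : List L) :
    CQ where
  arity := 1
  numEx := s + w.length + 1
  atoms := (if rooted then [.role 0 (.inl 0) (.inr 0)] else []) ++
    ((List.finRange (s + w.length)).filter fun i => rooted = true ∨ s ≤ i.val).map
      (fun i => .role 0 (.inr i.castSucc) (.inr i.succ)) ++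
    (List.finRange (w.length + 1)).map fun i =>
      .concept (num (.label ((x :: w).reverse[i.val]'(by simp; omega)) (i.val + 1).bodd))
        (.inr ⟨s + i.val, by omega⟩)

omit [Finite L] in
theorem mem_pathQuery {rooted : Bool} {s : ℕ} {x : L} {w : List L}
    {α : Atom (Fin 1 ⊕ Fin (s + w.length + 1))} :
    α ∈ (pathQuery num rooted s x w).atoms ↔ (rooted = true ∧ α = .role 0 (.inl 0) (.inr 0)) ∨
      (∃ (i : ℕ) (hi : i < s + w.length), (rooted = true ∨ s ≤ i) ∧
        α = .role 0 (.inr ⟨i, by omega⟩) (.inr ⟨i + 1, by omega⟩)) ∨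
      ∃ (i : ℕ) (hi : i < w.length + 1) (c : L), (x :: w).reverse[i]? = some c ∧
        α = .concept (num (.label c (i + 1).bodd)) (.inr ⟨s + i, by omega⟩) := by
  have h₁ : α ∈ (if rooted then [Atom.role 0 (.inl 0) (.inr 0)] else [] :
      List (Atom (Fin 1 ⊕ Fin (s + w.length + 1)))) ↔
      rooted = true ∧ α = .role 0 (.inl 0) (.inr 0) := by
    cases rooted <;> simp
  refine List.mem_append.trans ((or_congr (List.mem_append.trans (or_congr h₁ ?_)) ?_).trans
    or_assoc)
  · simp only [List.mem_map, List.mem_filter, List.mem_finRange, true_and, decide_eq_true_eq]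
    constructor
    · rintro ⟨i, hi, rfl⟩
      exact ⟨i.val, i.isLt, hi, rfl⟩
    · rintro ⟨i, hi, hi', rfl⟩
      exact ⟨⟨i, hi⟩, hi', rfl⟩
  · simp only [List.mem_map, List.mem_finRange, true_and]
    constructor
    · rintro ⟨i, rfl⟩
      exact ⟨i.val, i.isLt, _, List.getElem?_eq_getElem _, rfl⟩
    · rintro ⟨i, hi, c, hc, rfl⟩
      obtain ⟨_, rfl⟩ := List.getElem?_eq_some_iff.1 hc
      exact ⟨⟨i, hi⟩, rfl⟩

theorem inSignature_pathQuery {rooted : Bool} {s : ℕ} {x : L} {w : List L} :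
    ∀ α ∈ (pathQuery num rooted s x w).atoms, α.InSignature (querySig num).toSignature := by
  intro α hα
  rcases mem_pathQuery.1 hα with ⟨-, rfl⟩ | ⟨i, -, -, rfl⟩ | ⟨i, -, c, -, rfl⟩
  · simp [Atom.InSignature, FinSignature.toSignature, querySig]
  · simp [Atom.InSignature, FinSignature.toSignature, querySig]
  · exact List.mem_cons_of_mem _ (List.mem_map.2 ⟨(c, (i + 1).bodd), by simp, rfl⟩)

omit [Finite L] in
theorem isRooted_pathQuery {s : ℕ} {x : L} {w : List L} :
    (pathQuery num true s x w).IsRooted := by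
  suffices h : ∀ i (hi : i < s + w.length + 1),
      (pathQuery num true s x w).graph.Reachable (.inr ⟨i, hi⟩) (.inl (0 : Fin 1)) from
    fun y => ⟨(0 : Fin 1), h y.val y.isLt⟩
  intro i
  induction i with
  | zero =>
    intro hi
    exact SimpleGraph.Adj.reachable ⟨by simp, .inr ⟨0, mem_pathQuery.2 (.inl ⟨rfl, rfl⟩)⟩⟩
  | succ i ih =>
    intro hi
    refine SimpleGraph.Reachable.trans (SimpleGraph.Adj.reachable ⟨?_, .inr ⟨0, ?_⟩⟩)
      (ih (by omega))
    · intro h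
      simpa using congrArg Fin.val (Sum.inr_injective h)
    · exact mem_pathQuery.2 (.inr (.inl ⟨i, by omega, .inl rfl, rfl⟩))

omit [Finite L] in
/-- No path in the template has the labels of a word that ends in `halt`. -/
theorem not_satisfies_pathQuery (hnum : Function.Injective num) {rooted : Bool} {s n : ℕ}
    {σ : Set (List L)} {w : List L} (hw : S.Valid n σ (S.halt :: w)) {a : Fin 1 → IndName} :
    ¬ (templateInterp S num ρ rooted).Satisfies (pathQuery num rooted s S.halt w) a := by
  intro h
  obtain ⟨f, -, hf⟩ := Interp.satisfies_iff.1 h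
  have hlab : ∀ i c (hi : i < w.length + 1), (S.halt :: w).reverse[i]? = some c →
      ∃ ν, f (.inr ⟨s + i, by change _ < s + w.length + 1; omega⟩) = .inr ν ∧
        ν.Has S c (i + 1).bodd := by
    intro i c hi hc
    have hmem := hf _ (mem_pathQuery.2 (.inr (.inr ⟨i, hi, c, hc, rfl⟩)))
    have key : ∀ y : (templateInterp S num ρ rooted).Dom,
        y ∈ (templateInterp S num ρ rooted).At num (.label c (i + 1).bodd) →
        ∃ ν, y = .inr ν ∧ ν.Has S c (i + 1).bodd := by
      rintro (a | ν) h
      · cases hnum h.2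
      · exact ⟨ν, rfl, inr_mem_templateInterp hnum h⟩
    exact key _ hmem
  have hedge : ∀ i (hi : i < w.length), (templateInterp S num ρ rooted).roleExt 0
      (f (.inr ⟨s + i, by change _ < s + w.length + 1; omega⟩))
      (f (.inr ⟨s + (i + 1), by change _ < s + w.length + 1; omega⟩)) := by
    intro i hi
    exact hf _ (mem_pathQuery.2 (.inr (.inl ⟨s + i, by omega, .inr (by omega), rfl⟩)))
  -- the letter `init` occurs only at the beginning
  have hinit : ∀ i c, (S.halt :: w).reverse[i]? = some c → (c = S.init ↔ i = 0) := by
    intro i c hc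
    obtain ⟨v, hv⟩ := hw.exists_eq_append_init
    have hnot : S.init ∉ v := by
      intro h
      obtain ⟨a, b, rfl⟩ := List.append_of_mem h
      simpa using hw.eq_nil_of_init (v := a) (v' := b ++ [S.init]) (by simpa using hv)
    rw [hv, List.reverse_append, List.reverse_singleton, List.singleton_append] at hc
    cases i with
    | zero => simpa using hc.symm
    | succ i =>
      refine iff_of_false ?_ (by simp)
      rintro rfl
      exact hnot (List.mem_reverse.1 (List.mem_of_getElem? hc))
  have key : ∀ i (hi : i < w.length + 1), ∃ ν,
      f (.inr ⟨s + i, by change _ < s + w.length + 1; omega⟩) = .inr ν ∧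
        ν.out (i + 2).bodd = true ∧ (S.halt :: w).reverse[i]? ≠ some S.halt := by
    intro i
    induction i with
    | zero =>
      intro hi
      have hc : (S.halt :: w).reverse[0]? = some S.init := by
        rw [List.getElem?_eq_getElem (by simp)]
        rw [(hinit 0 _ (List.getElem?_eq_getElem (by simp))).2 rfl]
      obtain ⟨ν, h₁, h₂⟩ := hlab 0 _ hi hc
      refine ⟨ν, h₁, ?_, ?_⟩
      · simp [Tmpl.out, h₂.2.1 rfl rfl]
      · rw [hc]
        simpa using S.init_ne_halt
    | succ i ih =>
      intro hi
      obtain ⟨ν, h₁, h₂, -⟩ := ih (by omega)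
      have hc := List.getElem?_eq_getElem (l := (S.halt :: w).reverse) (i := i + 1)
        (by simpa using hi)
      generalize (S.halt :: w).reverse[i + 1]'(by simpa using hi) = c at hc
      obtain ⟨ν', h₁', h₂'⟩ := hlab (i + 1) c hi hc
      have hr := hedge i (by omega)
      rw [h₁, h₁'] at hr
      have hin : ν'.inb (i + 2).bodd = true := (hr.2 _).trans h₂
      have hhalt : c ≠ S.halt := by
        intro hh
        have := h₂'.1 hh
        rw [hin] at this
        cases this
      refine ⟨ν', h₁', ?_, ?_⟩
      · have hl : ν'.lab (i + 2).bodd = true :=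
          h₂'.2.2 hhalt fun h => by simpa using (hinit _ _ hc).1 h.1
        have hp : (i + 1 + 2).bodd = !(i + 2).bodd := Nat.bodd_succ _
        rw [hp, Tmpl.out, Bool.not_not, hin, hl, Bool.and_self, Bool.or_true]
      · rw [hc]
        simpa using hhalt
  obtain ⟨-, -, -, h⟩ := key w.length (by omega)
  exact h (by simp)

/-- A helix gives a query that shows that the Horn TBox does not entail the `ALC` TBox. -/
theorem not_entails_of_helix (hnum : Function.Injective num) (h : S.Helix n) {rooted : Bool}
    (hρ : rooted = true → ρ = 0) {Q : QueryClass} (hQ : rooted = false → Q = .CQ)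
    {sig : Signature} (hroot : num .root ∈ sig.concepts) (hrole : 0 ∈ sig.roles) :
    ¬ TBoxEntails sig (querySig num).toSignature Q (hornTBox S num ρ) (alcTBox S num ρ n) := by
  obtain ⟨w, r, u₁, u₂, hu, he, hV, hodd⟩ := h
  intro hent
  have hJ := isModel_templateInterp (S := S) (ρ := ρ) hnum rooted
  have hA : ∀ α ∈ rootABox num rooted, α.InSignature sig := by
    intro α hα
    rcases List.mem_cons.1 hα with rfl | hα
    · exact hroot
    · cases rooted with
      | false => cases hα
      | true =>
        obtain rfl := List.mem_singleton.1 hα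
        exact hrole
  have hcontains : Q.Contains (pathQuery num rooted u₂.length S.halt w) := by
    cases rooted with
    | false => rw [hQ rfl]; trivial
    | true =>
      cases Q with
      | CQ => trivial
      | rCQ => exact isRooted_pathQuery
  have hind : (0 : IndName) ∈ ABox.inds (rootABox num rooted) := ⟨_, List.mem_cons_self .., rfl⟩
  have hcert := (hent _ hA ⟨_, hJ⟩ ⟨_, isModel_treeInterp (n := n) (σ := ∅) hnum hJ⟩
    (pathQuery num rooted u₂.length S.halt w) hcontains inSignature_pathQuery (fun _ => 0)
    (fun _ => hind) ?_).2
  · have hw : S.Valid n Set.univ (S.halt :: w) := .of_append (by simp) hu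
    exact not_satisfies_pathQuery hnum hw (hcert _ hJ)
  intro I hI
  have hd : I.ind 0 ∈ I.At num .root := hI.2 _ (List.mem_cons_self ..)
  have hloop : rooted = true → I.roleExt 0 (I.ind 0) (I.ind 0) := by
    rintro rfl
    exact hI.2 (.role 0 0 0) (List.mem_cons_of_mem _ (List.mem_singleton.2 rfl))
  obtain ⟨s, hs, f, hf₀, hf₁, hf₂⟩ := exists_labelled_path hI.1 hd hu he hV hodd
  have hpos := hodd.pos
  -- in the first case, the unlabelled nodes are mapped to the loop
  obtain ⟨g, hg₀, hg₁, hg₂⟩ : ∃ g : ℕ → I.Dom, (rooted = true → I.roleExt 0 (I.ind 0) (g 0)) ∧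
      (∀ i, i < u₂.length + w.length → rooted = true ∨ u₂.length ≤ i →
        I.roleExt 0 (g i) (g (i + 1))) ∧
      ∀ i, g (u₂.length + i) = f (s + i) := by
    rcases hs with rfl | rfl
    · refine ⟨fun i => if i < u₂.length then I.ind 0 else f (i - u₂.length), fun hr => ?_,
        fun i hi hr => ?_, fun i => ?_⟩
      · dsimp only
        rw [if_pos hpos]
        exact hloop hr
      · dsimp only
        rcases Nat.lt_or_ge (i + 1) u₂.length with h | h
        · rw [if_pos (by omega), if_pos h]
          exact hloop (hr.resolve_right (by omega))
        · rw [if_neg (Nat.not_lt.2 h)]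
          rcases Nat.lt_or_ge i u₂.length with h' | h'
          · obtain rfl := hρ (hr.resolve_right (by omega))
            rw [if_pos h', show i + 1 - u₂.length = 0 by omega]
            exact hf₀
          · rw [if_neg (Nat.not_lt.2 h'), Nat.sub_add_comm h']
            exact hf₁ _ (by omega)
      · dsimp only
        rw [if_neg (by omega), Nat.zero_add, Nat.add_sub_cancel_left]
    · refine ⟨f, fun hr => ?_, fun i hi _ => hf₁ i hi, fun i => rfl⟩
      obtain rfl := hρ hr
      exact hf₀
  refine ⟨fun i => g i.val, fun α hα => ?_⟩
  rcases mem_pathQuery.1 hα with ⟨hr, rfl⟩ | ⟨i, hi, hr, rfl⟩ | ⟨i, hi, c, hc, rfl⟩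
  · exact hg₀ hr
  · exact hg₁ i hi hr
  · change g (u₂.length + i) ∈ _
    rw [hg₂]
    exact hf₂ i c hc

end ALC

namespace ALC

/-! ### The `ALC` TBox entails the Horn TBox -/

variable {L : Type} [Finite L] {S : HelixSystem L} {num : Name L → ℕ} {ρ : RoleName} {n : ℕ}

/-- The interpretation without the names of the tree of words. -/
def Interp.withoutTree (num : Name L → ℕ) (I : Interp) : Interp where
  Dom := I.Dom
  ind := I.ind
  ind_injective := I.ind_injective
  conceptExt k := {d | d ∈ I.conceptExt k ∧ (∀ c : L, num (.node c) ≠ k) ∧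
    ∀ p, num (.color p) ≠ k}
  roleExt := I.roleExt

/-- The names of the tree of words are empty in the models of the Horn TBox, hence they do not occur
in consistent ABoxes, and they may be taken out of each model of the `ALC` TBox. -/
theorem alcTBox_entails_hornTBox (hnum : Function.Injective num) (sig sig' : Signature)
    (Q : QueryClass) : TBoxEntails sig sig' Q (alcTBox S num ρ n) (hornTBox S num ρ) := by
  rintro A - - ⟨J, hJ⟩ q - - a ha hq
  refine ⟨ha, fun I hI => ?_⟩
  suffices h : (I.withoutTree num).IsModel ⟨hornTBox S num ρ, A⟩ by
    obtain ⟨g, hg⟩ := hq _ h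
    refine ⟨g, fun α hα => ?_⟩
    have := hg α hα
    cases α with
    | concept k z => exact this.1
    | role R y z => exact this
  obtain ⟨hJ, hJA⟩ := hJ
  change J.Sat _ at hJ
  rw [hornTBox, Interp.sat_append, Interp.sat_emptyTBox] at hJ
  obtain ⟨-, hnode, hcolor⟩ := hJ
  obtain ⟨hI, hIA⟩ := hI
  change I.Sat _ at hI
  rw [alcTBox, Interp.sat_cons, Interp.sat_append, Interp.sat_templateTBox] at hI
  obtain ⟨-, ⟨h₁, h₂, h₃⟩, -⟩ := hI
  have hmem : ∀ x : Name L, (∀ c, .node c ≠ x) → (∀ p, .color p ≠ x) → ∀ {d},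
      d ∈ I.At num x → d ∈ (I.withoutTree num).At num x :=
    fun x hx hx' d hd => ⟨hd, fun c h => hx c (hnum h), fun p h => hx' p (hnum h)⟩
  constructor
  · change (I.withoutTree num).Sat _
    rw [hornTBox, Interp.sat_append, Interp.sat_templateTBox, Interp.sat_emptyTBox]
    refine ⟨⟨?_, ?_, ?_⟩, fun c d hd => hd.2.1 c rfl, fun p d hd => hd.2.2 p rfl⟩
    · intro ν hν d hd
      obtain ⟨e, he, he'⟩ := h₁ ν hν d hd.1
      exact ⟨e, he, hmem _ (by simp) (by simp) he'⟩
    · exact fun ν c p hν d hd => hmem _ (by simp) (by simp) (h₂ ν c p hν d hd.1)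
    · intro ν ν' hν d hd
      obtain ⟨e, he, he'⟩ := h₃ ν ν' hν d hd.1
      exact ⟨e, he, hmem _ (by simp) (by simp) he'⟩
  · intro α hα
    cases α with
    | concept k b =>
      refine ⟨hIA _ hα, ?_, ?_⟩
      · rintro c rfl
        exact hnode c _ (hJA _ hα)
      · rintro p rfl
        exact hcolor p _ (hJA _ hα)
    | role R b b' => exact hIA _ hα

theorem inseparable_iff_entails (hnum : Function.Injective num) {sig sig' : Signature}
    {Q : QueryClass} :
    TBoxInseparable sig sig' Q (hornTBox S num ρ) (alcTBox S num ρ n) ↔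
      TBoxEntails sig sig' Q (hornTBox S num ρ) (alcTBox S num ρ n) :=
  and_iff_left (alcTBox_entails_hornTBox hnum sig sig' Q)

/-! ### Undecidability -/

theorem entails_iff_not_helix (hnum : Function.Injective num) {sig : Signature}
    (hroot : num .root ∈ sig.concepts) (hrole : 0 ∈ sig.roles) :
    TBoxEntails sig (querySig num).toSignature .CQ (hornTBox S num 1) (alcTBox S num 1 n) ↔
      ¬ S.Helix n := by
  refine ⟨fun h hn => not_entails_of_helix hnum hn (rooted := false) (by simp) (fun _ => rfl)
    hroot hrole h, fun hn A _ _ _ q _ hsig a ha hq => ⟨ha, ?_⟩⟩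
  exact certainAnswer_of_not_helix hnum one_ne_zero hn hq hsig

theorem entails_rCQ_iff_not_helix (hnum : Function.Injective num) :
    TBoxEntails (rootSig num).toSignature (querySig num).toSignature .rCQ (hornTBox S num 0)
      (alcTBox S num 0 n) ↔ ¬ S.Helix n := by
  refine ⟨fun h hn => not_entails_of_helix hnum hn (rooted := true) (by simp) (by simp)
    (by simp [rootSig, FinSignature.toSignature]) (by simp [rootSig, FinSignature.toSignature]) h,
    fun hn A hA _ _ q _ hsig a ha hq => ⟨ha, ?_⟩⟩
  exact certainAnswer_of_not_helix_of_rootSig hnum hn hA hq hsig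

omit [Finite L] in
theorem primrec_chainConcept : Primrec (chainConcept S num) := by
  have hstep : Primrec fun C : Concept => Concept.ex 0 (.inter (at' num (.node S.inp)) C) := by
    have h : Primrec fun C : Concept =>
        4 * Nat.pair 0 (4 * Nat.pair (4 * num (.node S.inp) + 1) (Concept.equivNat C) + 3) + 4 :=
      Primrec.nat_add.comp (Primrec.nat_mul.comp (.const 4) (Primrec₂.natPair.comp (.const 0)
        (Primrec.nat_add.comp (Primrec.nat_mul.comp (.const 4) (Primrec₂.natPair.comp (.const _)
          Primrec.of_equiv)) (.const 3)))) (.const 4)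
    refine ((Primrec.of_equiv_symm (e := Concept.equivNat)).comp h).of_eq fun C => ?_
    rw [Equiv.symm_apply_eq]
    rfl
  refine (Primrec.nat_rec₁ (f := fun _ C => Concept.ex 0 (.inter (at' num (.node S.inp)) C))
    (Concept.ex 0 (at' num (.node S.pad))) (hstep.comp .snd)).of_eq fun n => ?_
  induction n with
  | zero => rfl
  | succ n ih => exact congrArg (fun C => Concept.ex 0 (.inter (at' num (.node S.inp)) C)) ih

theorem primrec_alcTBox : Primrec (alcTBox S num ρ) :=
  Primrec.list_cons.comp (Primrec.pair (.const _) primrec_chainConcept) (.const _)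

/-- Undecidability by a reduction from the complement of an undecidable problem. -/
theorem undecidableOn_of_reduction {α : Type} [Primcodable α] {dom P : α → Prop} {p : ℕ → Prop}
    (hp : ¬ ComputablePred p) {f : ℕ → α} (hf : Primrec f) (hdom : ∀ n, dom (f n))
    (hP : ∀ n, P (f n) ↔ ¬ p n) : UndecidableOn dom P := by
  rintro ⟨D, hD, hDP⟩
  have h : ComputablePred fun n => D (f n) :=
    ComputablePred.computable_of_manyOneReducible ⟨f, hf.to_comp, fun _ => Iff.rfl⟩ hD
  refine hp (h.not.of_eq fun n => ?_)
  rw [hDP _ (hdom n), hP, not_not]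

end ALC

theorem mainTheorem5 :
    -- entailment, for CQs and for rooted CQs; input `(T₁, T₂, S₁, S₂)`
    (∀ Q : ALC.QueryClass,
      ALC.UndecidableOn (α := ALC.TBox × ALC.TBox × ALC.FinSignature × ALC.FinSignature)
        (fun x => ALC.IsHornTBox x.1)
        (fun x => ALC.TBoxEntails (ALC.FinSignature.toSignature x.2.2.1)
          (ALC.FinSignature.toSignature x.2.2.2) Q x.1 x.2.1)) ∧
    -- inseparability, for CQs and for rooted CQs; input `(T₁, T₂, S₁, S₂)`
    (∀ Q : ALC.QueryClass,
      ALC.UndecidableOn (α := ALC.TBox × ALC.TBox × ALC.FinSignature × ALC.FinSignature)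
        (fun x => ALC.IsHornTBox x.1)
        (fun x => ALC.TBoxInseparable (ALC.FinSignature.toSignature x.2.2.1)
          (ALC.FinSignature.toSignature x.2.2.2) Q x.1 x.2.1)) ∧
    -- full ABox signature, CQs: entailment and inseparability; input `(T₁, T₂, S)`
    ALC.UndecidableOn (α := ALC.TBox × ALC.TBox × ALC.FinSignature)
      (fun x => ALC.IsHornTBox x.1)
      (fun x => ALC.TBoxEntails ALC.Signature.full (ALC.FinSignature.toSignature x.2.2)
        ALC.QueryClass.CQ x.1 x.2.1) ∧
    ALC.UndecidableOn (α := ALC.TBox × ALC.TBox × ALC.FinSignature)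
      (fun x => ALC.IsHornTBox x.1)
      (fun x => ALC.TBoxInseparable ALC.Signature.full (ALC.FinSignature.toSignature x.2.2)
        ALC.QueryClass.CQ x.1 x.2.1) ∧
    -- equal ABox and query signatures, CQs: entailment and inseparability; input `(T₁, T₂, S)`
    ALC.UndecidableOn (α := ALC.TBox × ALC.TBox × ALC.FinSignature)
      (fun x => ALC.IsHornTBox x.1)
      (fun x => ALC.TBoxEntails (ALC.FinSignature.toSignature x.2.2)
        (ALC.FinSignature.toSignature x.2.2) ALC.QueryClass.CQ x.1 x.2.1) ∧
    ALC.UndecidableOn (α := ALC.TBox × ALC.TBox × ALC.FinSignature)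
      (fun x => ALC.IsHornTBox x.1)
      (fun x => ALC.TBoxInseparable (ALC.FinSignature.toSignature x.2.2)
        (ALC.FinSignature.toSignature x.2.2) ALC.QueryClass.CQ x.1 x.2.1) := by
  obtain ⟨L, hL, S, hS⟩ := exists_helixSystem_undecidable
  obtain ⟨num, hnum⟩ := Countable.exists_injective_nat (ALC.Name L)
  have hroot : num .root ∈ (ALC.querySig num).toSignature.concepts := List.mem_cons_self ..
  have hrole : 0 ∈ (ALC.querySig num).toSignature.roles := List.mem_cons_self ..
  have hhorn := ALC.isHornTBox_hornTBox S num
  have h₁ : Primrec fun n => (ALC.hornTBox S num 1, ALC.alcTBox S num 1 n, ALC.querySig num) :=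
    .pair (.const _) (.pair ALC.primrec_alcTBox (.const _))
  have h₂ : ∀ (ρ : ALC.RoleName) (sig : ALC.FinSignature), Primrec fun n =>
      (ALC.hornTBox S num ρ, ALC.alcTBox S num ρ n, sig, ALC.querySig num) :=
    fun ρ sig => .pair (.const _) (.pair ALC.primrec_alcTBox (.const _))
  refine ⟨fun Q => ?_, fun Q => ?_, ?_, ?_, ?_, ?_⟩
  · cases Q with
    | CQ =>
      exact ALC.undecidableOn_of_reduction hS (h₂ 1 (ALC.querySig num)) (fun _ => hhorn 1)
        fun n => ALC.entails_iff_not_helix hnum hroot hrole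
    | rCQ =>
      exact ALC.undecidableOn_of_reduction hS (h₂ 0 (ALC.rootSig num)) (fun _ => hhorn 0)
        fun n => ALC.entails_rCQ_iff_not_helix hnum
  · cases Q with
    | CQ =>
      exact ALC.undecidableOn_of_reduction hS (h₂ 1 (ALC.querySig num)) (fun _ => hhorn 1)
        fun n => (ALC.inseparable_iff_entails hnum).trans
          (ALC.entails_iff_not_helix hnum hroot hrole)
    | rCQ =>
      exact ALC.undecidableOn_of_reduction hS (h₂ 0 (ALC.rootSig num)) (fun _ => hhorn 0)
        fun n => (ALC.inseparable_iff_entails hnum).trans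
          (ALC.entails_rCQ_iff_not_helix hnum)
  · exact ALC.undecidableOn_of_reduction hS h₁ (fun _ => hhorn 1)
      fun n => ALC.entails_iff_not_helix hnum trivial trivial
  · exact ALC.undecidableOn_of_reduction hS h₁ (fun _ => hhorn 1)
      fun n => (ALC.inseparable_iff_entails hnum).trans
        (ALC.entails_iff_not_helix hnum trivial trivial)
  · exact ALC.undecidableOn_of_reduction hS h₁ (fun _ => hhorn 1)
      fun n => ALC.entails_iff_not_helix hnum hroot hrole
  · exact ALC.undecidableOn_of_reduction hS h₁ (fun _ => hhorn 1)
      fun n => (ALC.inseparable_iff_entails hnum).trans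
        (ALC.entails_iff_not_helix hnum hroot hrole)
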